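/- Let $(M,g)$ be a smooth (Hausdorff) Lorentzian manifold of dimension $n\ge 4$, of signature $(n-1,1)$ and of constant curvature $K$, that is, $R(u,v)w=K\,(g(v,w)u-g(u,w)v)$ for all tangent vectors $u,v,w$. Let $V$ be a connected (Hausdorff) smooth manifold of dimension $n-1$ and $\iota\colon V\to M$ a map. Call $\iota$ a *totally umbilical lightlike hypersurface* if it is a smooth immersion, if each hyperplane $d\iota(T_xV)$ is isotropic (there is $N\in T_xV$, $N\ne 0$, with $g(d\iota N,d\iota X)=0$ for all $X\in T_xV$), and if at every $x\in V$, for such an $N$, the second fundamental form $\lambda_N(X,Y)=-g(\nabla_XY,N)=g(\nabla_XN,Y)$ satisfies $\lambda_N(X,Y)=\lambda\,g(X,Y)$ for all $X,Y\in T_xV$ with a number $\lambda\neq 0$. Call $\iota$ (an open part of) the *light cone with vertex $p\in M$* if $\iota=\exp_p\circ\varphi$ for a smooth immersion $\varphi$ of $V$ into $T_pM$ with values in the isotropic cone without its vertex, $\{v\in T_pM : v\ne 0,\ g(v,v)=0\}$ (where $\exp_p$ is required to be defined on $\varphi(V)$). Then: (a) if $\iota$ is an open part of the light cone with some vertex $p\in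 M$, then $\iota$ is a totally umbilical lightlike hypersurface; (b) conversely, if the isotropic geodesics of $(M,g)$ are complete (as they are in the Minkowski space $R^n_1$ and in the de Sitter spaces $S^n_1$ and $H^n_1$), and if $\iota$ is a totally umbilical lightlike hypersurface, then $\iota$ is an open part of the light cone with some vertex $p\in M$. -/

import Mathlib

open Set Module
open scoped Manifold ContDiff

noncomputable section

namespace Lorentz

section Coordinates

variable {E : Type*} [NormedAddCommGroup E] [NormedSpace ℝ E]
  {M : Type*} [TopologicalSpace M] [ChartedSpace E M]

/-- The coordinate expression, in the preferred chart `extChartAt 𝓘(ℝ, E) c` around `c`, of a field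
`b` of bilinear forms on the tangent spaces of `M`. The value at the point `y` of the target of the
chart is the pullback of `b` by the derivative of the inverse of the chart. -/
def chartForm (b : ∀ x : M, TangentSpace 𝓘(ℝ, E) x →L[ℝ] TangentSpace 𝓘(ℝ, E) x →L[ℝ] ℝ)
    (c : M) (y : E) : E →L[ℝ] E →L[ℝ] ℝ :=
  let B : E →L[ℝ] E →L[ℝ] ℝ := b ((extChartAt 𝓘(ℝ, E) c).symm y)
  let D : E →L[ℝ] E := mfderiv 𝓘(ℝ, E) 𝓘(ℝ, E) (extChartAt 𝓘(ℝ, E) c).symm y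
  B.bilinearComp D D

end Coordinates

/-- A smooth Lorentzian metric, of signature `(n - 1, 1)`, on a manifold `M` modelled on `E`. -/
structure LorentzianMetric (E : Type*) [NormedAddCommGroup E] [NormedSpace ℝ E]
    (M : Type*) [TopologicalSpace M] [ChartedSpace E M] where
  /-- The scalar product on each tangent space. -/
  form : ∀ x : M, TangentSpace 𝓘(ℝ, E) x →L[ℝ] TangentSpace 𝓘(ℝ, E) x →L[ℝ] ℝ
  symm : ∀ x v w, form x v w = form x w v
  /-- There is a timelike vector, on the orthogonal complement of which the form is positive
  definite. -/
  signature : ∀ x, ∃ τ, form x τ τ < 0 ∧ ∀ v, form x τ v = 0 → v ≠ 0 → 0 < form x v v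
  /-- The components of the metric are smooth in the charts. -/
  smooth : ∀ c : M, ContDiffOn ℝ ∞ (chartForm form c) (extChartAt 𝓘(ℝ, E) c).target

variable {E : Type*} [NormedAddCommGroup E] [NormedSpace ℝ E]
  {M : Type*} [TopologicalSpace M] [ChartedSpace E M]

namespace LorentzianMetric

/-- The metric in the chart around `c`: the matrix `g_{ij}` as a function of the coordinates. -/
def coord (g : LorentzianMetric E M) (c : M) (y : E) : E →L[ℝ] E →L[ℝ] ℝ :=
  chartForm g.form c y

/-- Christoffel symbols of the first kind in the chart around `c`:
`z ↦ (∂_v g(w, z) + ∂_w g(v, z) - ∂_z g(v, w)) / 2`. -/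
def christoffelFirst (g : LorentzianMetric E M) (c : M) (y v w : E) : E →L[ℝ] ℝ :=
  (1 / 2 : ℝ) • (fderiv ℝ (g.coord c) y v w + fderiv ℝ (g.coord c) y w v
    - ((fderiv ℝ (g.coord c) y).flip v).flip w)

/-- Christoffel symbols (of the second kind) `Γ(v, w)` of the Levi-Civita connection in the chart
around `c`, so that `∇_v W = ∂_v W + Γ(v, W)`. They are obtained from the symbols of the first kind
by raising an index with the inverse of the metric. -/
def christoffel (g : LorentzianMetric E M) (c : M) (y v w : E) : E :=
  (g.coord c y).inverse (g.christoffelFirst c y v w)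

/-- The curvature tensor `R(u, v) w = ∇_u ∇_v w - ∇_v ∇_u w - ∇_[u, v] w` in the chart
around `c`. -/
def curvature (g : LorentzianMetric E M) (c : M) (y u v w : E) : E :=
  fderiv ℝ (fun z => g.christoffel c z v w) y u - fderiv ℝ (fun z => g.christoffel c z u w) y v
    + g.christoffel c y u (g.christoffel c y v w) - g.christoffel c y v (g.christoffel c y u w)

/-- The metric has constant curvature `K`: `R(u, v) w = K (g(v, w) u - g(u, w) v)`, that is
`R_{ijkl} = K (g_{ik} g_{jl} - g_{il} g_{jk})`. -/
def HasConstantCurvature (g : LorentzianMetric E M) (K : ℝ) : Prop :=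
  ∀ c : M, ∀ y ∈ (extChartAt 𝓘(ℝ, E) c).target, ∀ u v w : E,
    g.curvature c y u v w = K • (g.coord c y v w • u - g.coord c y u w • v)

/-- `γ` is an (affinely parametrized) geodesic on the open set `s` of parameters: it is smooth there
and satisfies `γ'' + Γ(γ', γ') = 0` in the charts. -/
def IsGeodesicOn (g : LorentzianMetric E M) (γ : ℝ → M) (s : Set ℝ) : Prop :=
  ContMDiffOn 𝓘(ℝ, ℝ) 𝓘(ℝ, E) ∞ γ s ∧
  ∀ t ∈ s, ∀ c : M, γ t ∈ (extChartAt 𝓘(ℝ, E) c).source →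
    deriv (deriv (extChartAt 𝓘(ℝ, E) c ∘ γ)) t
      + g.christoffel c (extChartAt 𝓘(ℝ, E) c (γ t))
          (deriv (extChartAt 𝓘(ℝ, E) c ∘ γ) t) (deriv (extChartAt 𝓘(ℝ, E) c ∘ γ) t) = 0

/-- The curve `γ` starts at `p` at time `0` with velocity `v`. Mathlib identifies the tangent space
at `p` with `E` through the preferred chart at `p`, so the velocity is read in that chart. -/
def StartsWith (γ : ℝ → M) (p : M) (v : TangentSpace 𝓘(ℝ, E) p) : Prop :=
  γ 0 = p ∧ HasDerivAt (F := E) (extChartAt 𝓘(ℝ, E) p ∘ γ) v 0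

/-- `exp_p v` is defined and equal to `q`: the geodesic that starts at `p` with velocity `v` exists
on an open interval containing `[0, 1]` and is at `q` at time `1`. -/
def ExpEq (g : LorentzianMetric E M) (p : M) (v : TangentSpace 𝓘(ℝ, E) p) (q : M) : Prop :=
  ∃ γ : ℝ → M, ∃ ε > 0, g.IsGeodesicOn γ (Ioo (-ε) (1 + ε)) ∧ StartsWith γ p v ∧ γ 1 = q

/-- Every isotropic (null) geodesic can be extended to all values of its affine parameter. -/
def IsNullComplete (g : LorentzianMetric E M) : Prop :=
  ∀ (p : M) (v : TangentSpace 𝓘(ℝ, E) p), g.form p v v = 0 →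
    ∃ γ : ℝ → M, g.IsGeodesicOn γ univ ∧ StartsWith γ p v

end LorentzianMetric

open LorentzianMetric

variable {F : Type*} [NormedAddCommGroup F] [NormedSpace ℝ F]
  {V : Type*} [TopologicalSpace V] [ChartedSpace F V]

/-- The first fundamental form `g(dι X, dι Y)` of a map `ι : V → M` at `x`. -/
def firstForm (g : LorentzianMetric E M) (ι : V → M) (x : V)
    (X Y : TangentSpace 𝓘(ℝ, F) x) : ℝ :=
  g.form (ι x) (mfderiv 𝓘(ℝ, F) 𝓘(ℝ, E) ι x X) (mfderiv 𝓘(ℝ, F) 𝓘(ℝ, E) ι x Y)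

/-- `N` is a nonzero vector of `T_x V` orthogonal to all of `T_x V`; such an `N` is isotropic. -/
def IsRadical (g : LorentzianMetric E M) (ι : V → M) (x : V)
    (N : TangentSpace 𝓘(ℝ, F) x) : Prop :=
  N ≠ 0 ∧ ∀ X : TangentSpace 𝓘(ℝ, F) x, firstForm g ι x N X = 0

/-- `∇_X (dι Y)` at `x` along `ι`, for the field `Y` on `V` that is constant in the preferred chart
of `V` at `x`, computed in the preferred charts at `x` and at `ι x`. Another choice of charts, or of
the extension of `Y`, changes the value only by a vector of `dι (T_x V)`. -/
def hessian (g : LorentzianMetric E M) (ι : V → M) (x : V)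
    (X Y : TangentSpace 𝓘(ℝ, F) x) : TangentSpace 𝓘(ℝ, E) (ι x) :=
  let u : F → E := writtenInExtChartAt 𝓘(ℝ, F) 𝓘(ℝ, E) x ι
  let y : F := extChartAt 𝓘(ℝ, F) x x
  (fderiv ℝ (fderiv ℝ u) y X Y
    + g.christoffel (ι x) (u y) (fderiv ℝ u y X) (fderiv ℝ u y Y) : E)

/-- The second fundamental form at `x` with respect to the isotropic normal vector `N`,
`λ(X, Y) = - g(∇_X Y, N)` (which is `g(∇_X N, Y)`). It is well defined because `N` is orthogonal
to the tangent space. -/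
def secondForm (g : LorentzianMetric E M) (ι : V → M) (x : V)
    (N X Y : TangentSpace 𝓘(ℝ, F) x) : ℝ :=
  - g.form (ι x) (hessian g ι x X Y) (mfderiv 𝓘(ℝ, F) 𝓘(ℝ, E) ι x N)

variable (F)

/-- `ι : V → M` is an immersion whose image hyperplanes are isotropic, that is, the induced form is
degenerate everywhere. (The codimension of `V` is fixed by the dimensions of `E` and `F`.) -/
def IsLightlikeHypersurface (g : LorentzianMetric E M) (ι : V → M) : Prop :=
  ContMDiff 𝓘(ℝ, F) 𝓘(ℝ, E) ∞ ι ∧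
  ∀ x, Function.Injective (mfderiv 𝓘(ℝ, F) 𝓘(ℝ, E) ι x) ∧ ∃ N : TangentSpace 𝓘(ℝ, F) x, IsRadical g ι x N

/-- Totally umbilical lightlike hypersurface: the second fundamental form is at every point a
nonzero multiple of the first one (for one isotropic normal vector, equivalently for all). -/
def IsTotallyUmbilicalLightlike (g : LorentzianMetric E M) (ι : V → M) : Prop :=
  IsLightlikeHypersurface F g ι ∧
  ∀ (x : V) (N : TangentSpace 𝓘(ℝ, F) x), IsRadical g ι x N → ∃ l : ℝ, l ≠ 0 ∧
    ∀ X Y : TangentSpace 𝓘(ℝ, F) x, secondForm g ι x N X Y = l * firstForm g ι x X Y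

/-- `ι : V → M` is (an open part of) the light cone with vertex `p`: it is `exp_p ∘ φ` for an
immersion `φ` of `V` into the isotropic cone of `T_p M = E` without its vertex. If
`dim V = dim M - 1`, then `φ` is a local diffeomorphism onto an open part of the isotropic cone. -/
def IsLightConeAt (g : LorentzianMetric E M) (p : M) (ι : V → M) : Prop :=
  ∃ φ : V → E,
    ContMDiff 𝓘(ℝ, F) 𝓘(ℝ, E) ∞ φ ∧
    (∀ x, Function.Injective (mfderiv 𝓘(ℝ, F) 𝓘(ℝ, E) φ x)) ∧
    (∀ x, φ x ≠ 0 ∧ g.form p (φ x) (φ x) = 0) ∧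
    ∀ x, g.ExpEq p (φ x) (ι x)

end Lorentz

end

/-! Both directions follow from one infinitesimal condition, `IsConical`, on a family of null
geodesics with positions `P (s, t)` and velocities `Q (s, t)`: for every direction `X` of the
parameter, `∂_X P = t • ∇_X Q`, and `∇_X Q` vanishes only for `X = 0`.

At time `0` the condition says that the positions have zero derivative, so that the curves issue
locally from one point `p`, and that the initial velocities immerse the parameter space into the
null cone of `T_p M`. At time `1` it says that the hypersurface of end points has a null normal
field `W` with `∇_X W = X`. Differentiating `g(Y, W) = 0` then gives `-g(∇_X Y, W) = g(X, Y)`, which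
is umbilicity with factor `1` for the normal `W`.

Constant curvature makes the condition independent of time (`IsGeodesicVariation.isConical`). Let `J
= ∂_X P`. Since `Q` is null and `J` is orthogonal to `Q`, the curvature `R(Q, J) Q = K (g(J, Q) Q -
g(Q, Q) J)` vanishes. Hence `∇_X Q`, the covariant time derivative of `J`, is parallel, and so is `J
- t • ∇_X Q`. Part (a) transports the condition from time `0` to time `1`.

For (b), scale the radical vector so that the second fundamental form equals the first. The
resulting field `W` is smooth (`exists_contDiffAt_isNormal`) and satisfies `∇_X W = X + a(X) W`. The
commutator of covariant derivatives, together with `R(X, Y) W = 0`, gives a relation `(…) W + a(Y) X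
- a(X) Y = 0`. The hypersurface has dimension at least `3`, so `X` can be chosen independent of `W`
and `Y`, and `a = 0` (`covDeriv_normal`). Thus the condition holds at time `1`. Following the null
geodesics back to time `0`, which completeness allows, gives a locally constant vertex, and
connectedness of `V` makes it unique.

The geodesics are chosen pointwise, so their smooth dependence on the parameter must be proved. It
is part of the conical condition and is carried along by a smooth local flow of the geodesic
equation. -/

noncomputable section

set_option maxSynthPendingDepth 3

namespace Lorentz

/-! ### Smoothness of composition operators on spaces of continuous maps. -/

section Nemytskii

variable {K : Type*} [TopologicalSpace K] [CompactSpace K]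

/-- Pointwise application of a continuous family of continuous linear maps. -/
def pointwiseApply (K : Type*) [TopologicalSpace K] [CompactSpace K]
    (E G : Type*) [NormedAddCommGroup E] [NormedSpace ℝ E] [NormedAddCommGroup G]
    [NormedSpace ℝ G] : C(K, E →L[ℝ] G) →L[ℝ] C(K, E) →L[ℝ] C(K, G) :=
  LinearMap.mkContinuous₂
    (LinearMap.mk₂ ℝ (fun (φ : C(K, E →L[ℝ] G)) (h : C(K, E)) =>
        (⟨fun x => φ x (h x), by fun_prop⟩ : C(K, G)))
      (fun _ _ _ => by ext; simp) (fun _ _ _ => by ext; simp)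
      (fun _ _ _ => by ext; simp) (fun _ _ _ => by ext; simp)) 1
    (fun φ h => by
      rw [ContinuousMap.norm_le _ (by positivity)]
      intro x
      rw [one_mul]
      exact ((φ x).le_opNorm _).trans
        (mul_le_mul (φ.norm_coe_le_norm x) (h.norm_coe_le_norm x) (norm_nonneg _)
          (norm_nonneg (E := C(K, E →L[ℝ] G)) φ)))

/-- Composition with a differentiable map is differentiable on spaces of continuous maps. -/
theorem hasFDerivAt_comp_continuousMap {E G : Type*} [NormedAddCommGroup E] [NormedSpace ℝ E]
    [NormedAddCommGroup G] [NormedSpace ℝ G] (f : C(E, G)) (f' : C(E, E →L[ℝ] G))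
    (hf : ∀ x, HasFDerivAt f (f' x) x) (α : C(K, E)) :
    HasFDerivAt (fun β : C(K, E) => f.comp β) (pointwiseApply K E G (f'.comp α)) α := by
  rw [hasFDerivAt_iff_isLittleO_nhds_zero, Asymptotics.isLittleO_iff]
  intro ε hε
  have hc : IsCompact (range α) := isCompact_range α.continuous
  -- Compactness of the range of `α` gives one `δ` for all `x`, although points near the range need
  -- not lie in a compact set. The mean value inequality on each ball around `α x` then has the
  -- uniform constant `ε`.
  have := hc.uniformContinuousAt_of_continuousAt f' (fun _ _ => f'.continuous.continuousAt)
    (Metric.dist_mem_uniformity hε)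
  obtain ⟨δ, hδ, h⟩ := Metric.mem_uniformity_dist.1 this
  filter_upwards [Metric.ball_mem_nhds (0 : C(K, E)) hδ] with β hβ
  rw [mem_ball_zero_iff] at hβ
  rw [ContinuousMap.norm_le _ (by positivity)]
  intro x
  have hx : ‖β x‖ < δ := (β.norm_coe_le_norm x).trans_lt hβ
  have key := Convex.norm_image_sub_le_of_norm_hasFDerivWithin_le' (f := f) (f' := f')
    (φ := f' (α x)) (C := ε) (s := Metric.ball (α x) δ) (x := α x) (y := α x + β x)
    (fun y _ => (hf y).hasFDerivWithinAt)
    (fun y hy => by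
      have := h (a := α x) (b := y) (by rwa [dist_comm]) ⟨x, rfl⟩
      rw [← dist_eq_norm, dist_comm]
      exact le_of_lt this)
    (convex_ball _ _) (Metric.mem_ball_self hδ) (by simpa using hx)
  rw [add_sub_cancel_left] at key
  exact key.trans (mul_le_mul_of_nonneg_left (β.norm_coe_le_norm x) hε.le)

/-- Composition with a smooth map is smooth on spaces of continuous maps. -/
theorem contDiff_comp_continuousMap.{u} {E : Type u} [NormedAddCommGroup E] [NormedSpace ℝ E]
    (n : ℕ) : ∀ {G : Type u} [NormedAddCommGroup G] [NormedSpace ℝ G] (f : C(E, G)),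
    ContDiff ℝ n f → ContDiff ℝ n (fun β : C(K, E) => f.comp β) := by
  induction n with
  | zero =>
    intro G _ _ f _
    exact contDiff_zero.2 (ContinuousMap.continuous_postcomp f)
  | succ n ih =>
    intro G _ _ f hf
    have hf0 := hf
    push_cast at hf ⊢
    obtain ⟨f', hf', hd⟩ := contDiff_succ_iff_hasFDerivAt.1 hf
    refine contDiff_succ_iff_hasFDerivAt.2 ⟨_, ?_,
      hasFDerivAt_comp_continuousMap f ⟨f', hf'.continuous⟩ hd⟩
    -- The derivative is a fixed continuous linear map applied to composition with `f'`, so the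
    -- induction passes from `G` to `E →L[ℝ] G`; a common universe for `E` and `G` keeps this target
    -- admissible.
    exact (pointwiseApply K E G).contDiff.comp (ih ⟨f', hf'.continuous⟩ hf')

end Nemytskii

/-! ### Smooth dependence of solutions of an autonomous ODE on time and initial value. -/

section Flow

open MeasureTheory intervalIntegral

variable {E : Type*} [NormedAddCommGroup E] [NormedSpace ℝ E] [CompleteSpace E]

/-- The indefinite integral of a continuous function on the unit interval. -/
def primitive (E : Type*) [NormedAddCommGroup E] [NormedSpace ℝ E] [CompleteSpace E] :
    C(unitInterval, E) →L[ℝ] C(unitInterval, E) :=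
  LinearMap.mkContinuous
    { toFun := fun α => ⟨fun τ => ∫ t in (0 : ℝ)..τ, IccExtend (zero_le_one' ℝ) α t, by
        have h : Continuous (IccExtend (zero_le_one' ℝ) α) := α.continuous.Icc_extend'
        exact (continuous_primitive (fun a b => h.intervalIntegrable a b) 0).comp
          continuous_subtype_val⟩
      map_add' := fun α β => by
        ext τ
        have h : Continuous (IccExtend (zero_le_one' ℝ) α) := α.continuous.Icc_extend'
        have h' : Continuous (IccExtend (zero_le_one' ℝ) β) := β.continuous.Icc_extend'
        exact integral_add (h.intervalIntegrable _ _) (h'.intervalIntegrable _ _)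
      map_smul' := fun c α => by
        ext τ
        exact integral_smul c _ } 1
    (fun α => by
      rw [ContinuousMap.norm_le _ (by positivity)]
      intro τ
      refine (norm_integral_le_of_norm_le_const (C := ‖α‖)
        (fun t _ => α.norm_coe_le_norm _)).trans ?_
      rw [one_mul, sub_zero, abs_of_nonneg τ.2.1]
      exact mul_le_of_le_one_right (norm_nonneg _) τ.2.2)

/-- Constant functions on the unit interval. -/
def constantCurve (E : Type*) [NormedAddCommGroup E] [NormedSpace ℝ E] :
    E →L[ℝ] C(unitInterval, E) :=
  LinearMap.mkContinuous
    { toFun := fun z => ContinuousMap.const _ z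
      map_add' := fun _ _ => rfl
      map_smul' := fun _ _ => rfl } 1
    (fun z => by
      rw [ContinuousMap.norm_le _ (by positivity)]
      intro τ
      exact (one_mul ‖z‖).ge)

/-- A curve which satisfies the rescaled integral equation is a rescaled solution of the ODE. -/
theorem eq_of_integral_equation {f : E → E} {L : NNReal} (hL : LipschitzWith L f) {h : ℝ} {z : E}
    (F : C(E, E)) (hF : ∀ x, F x = f x)
    (α : C(unitInterval, E)) (hα : α = constantCurve E z + h • primitive E (F.comp α))
    {y : ℝ → E} (hy0 : y 0 = z)
    (hy : ∀ t ∈ Icc (0 : ℝ) 1, HasDerivAt y (f (y (h * t))) (h * t)) : α 1 = y h := by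
  have hc : Continuous (IccExtend (zero_le_one' ℝ) (F.comp α)) :=
    (F.comp α).continuous.Icc_extend'
  -- `A` extends `α` to the whole line, so that it has two-sided derivatives also at the ends of
  -- `[0, 1]`.
  set A : ℝ → E := fun t => z + h • ∫ s in (0 : ℝ)..t, IccExtend (zero_le_one' ℝ) (F.comp α) s
    with hA
  have hAd : ∀ t, HasDerivAt A (h • IccExtend (zero_le_one' ℝ) (F.comp α) t) t := fun t =>
    ((integral_hasDerivAt_right (hc.intervalIntegrable _ _)
      (hc.stronglyMeasurableAtFilter _ _) hc.continuousAt).const_smul h).const_add z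
  have hAα : ∀ t (ht : t ∈ Icc (0 : ℝ) 1), α ⟨t, ht⟩ = A t := fun t ht => by
    conv_lhs => rw [hα]
    rfl
  have hAd' : ∀ t ∈ Icc (0 : ℝ) 1, HasDerivAt A (h • f (A t)) t := fun t ht => by
    have := hAd t
    rw [IccExtend_of_mem _ _ ht] at this
    rw [← hAα t ht, ← hF]
    exact this
  have hyd : ∀ t ∈ Icc (0 : ℝ) 1, HasDerivAt (fun t => y (h * t)) (h • f (y (h * t))) t :=
    fun t ht => by
      have h1 : HasDerivAt (fun t : ℝ => h * t) h t := by
        simpa using (hasDerivAt_id t).const_mul h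
      exact (hy t ht).scomp t h1
  -- Both `A` and `t ↦ y (h * t)` solve `x' = h • f x` on the fixed interval `[0, 1]`; negative `h`
  -- is covered as well.
  have := ODE_solution_unique (K := ‖h‖₊ * L) (v := fun _ x => h • f x)
    (a := 0) (b := 1) (f := A) (g := fun t => y (h * t))
    (fun _ => (lipschitzWith_smul h).comp hL)
    (fun t ht => (hAd' t ht).continuousAt.continuousWithinAt)
    (fun t ht => (hAd' t ⟨ht.1, ht.2.le⟩).hasDerivWithinAt)
    (fun t ht => (hyd t ht).continuousAt.continuousWithinAt)
    (fun t ht => (hyd t ⟨ht.1, ht.2.le⟩).hasDerivWithinAt)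
    (by simp [hA, hy0]) (right_mem_Icc.2 zero_le_one)
  simp only [mul_one] at this
  rw [← this, ← hAα 1 (right_mem_Icc.2 zero_le_one)]
  rfl

/-- The rescaled integral equation has a solution that depends smoothly on the time scale and on
the initial value. -/
theorem exists_contDiff_integral_equation (F : C(E, E)) (hF : ContDiff ℝ ∞ F) (z₀ : E) :
    ∃ (U : Set (ℝ × E)) (α : ℝ × E → C(unitInterval, E)), U ∈ nhds ((0 : ℝ), z₀) ∧
      (∀ p ∈ U, ContDiffAt ℝ ∞ α p) ∧
      ∀ p ∈ U, α p = constantCurve E p.2 + p.1 • primitive E (F.comp (α p)) := by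
  let X := C(unitInterval, E)
  have hN : ContDiff ℝ ∞ (fun β : X => F.comp β) :=
    contDiff_infty.2 fun n => contDiff_comp_continuousMap n F (hF.of_le (by exact_mod_cast le_top))
  let w : X := primitive E (F.comp (constantCurve E z₀))
  -- The parameters are carried along, so the inverse function theorem for `Ψ` acts as an implicit
  -- function theorem for the integral equation. At `h = 0` the nonlinear term drops out of the
  -- derivative in the curve variable, which is the identity; the full derivative `e` is therefore
  -- triangular and invertible.
  let Ψ : (ℝ × E) × X → (ℝ × E) × X := fun q =>
    (q.1, q.2 - constantCurve E q.1.2 - q.1.1 • primitive E (F.comp q.2))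
  have hP : ContDiff ℝ ∞ (fun β : X => primitive E (F.comp β)) := (primitive E).contDiff.comp hN
  have hΨ : ContDiff ℝ ∞ Ψ := by
    refine contDiff_fst.prodMk ((contDiff_snd.sub ((constantCurve E).contDiff.comp
      (contDiff_snd.comp contDiff_fst))).sub ((contDiff_fst.comp contDiff_fst).smul
        (hP.comp contDiff_snd)))
  let B : ℝ × E →L[ℝ] X := (constantCurve E).comp (ContinuousLinearMap.snd ℝ ℝ E)
    + (ContinuousLinearMap.fst ℝ ℝ E).smulRight w
  let e : ((ℝ × E) × X) ≃L[ℝ] ((ℝ × E) × X) := ContinuousLinearEquiv.equivOfInverse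
    ((ContinuousLinearMap.fst ℝ (ℝ × E) X).prod
      (ContinuousLinearMap.snd ℝ (ℝ × E) X - B.comp (ContinuousLinearMap.fst ℝ (ℝ × E) X)))
    ((ContinuousLinearMap.fst ℝ (ℝ × E) X).prod
      (ContinuousLinearMap.snd ℝ (ℝ × E) X + B.comp (ContinuousLinearMap.fst ℝ (ℝ × E) X)))
    (fun q => by simp) (fun q => by simp)
  let q₀ : (ℝ × E) × X := ((0, z₀), constantCurve E z₀)
  have hder : HasFDerivAt Ψ (e : (ℝ × E) × X →L[ℝ] (ℝ × E) × X) q₀ := by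
    have h1 : HasFDerivAt (fun q : (ℝ × E) × X => q.1.1 • primitive E (F.comp q.2))
        (((ContinuousLinearMap.fst ℝ ℝ E).comp
          (ContinuousLinearMap.fst ℝ (ℝ × E) X)).smulRight w) q₀ := by
      have h2 := ((hasFDerivAt_fst (𝕜 := ℝ) (p := q₀)).fst).smul
        ((((hP.differentiable (by simp)) q₀.2).hasFDerivAt).comp q₀ hasFDerivAt_snd)
      refine h2.congr_fderiv ?_
      ext q <;> simp [q₀, w]
    have h3 := (hasFDerivAt_fst (𝕜 := ℝ) (p := q₀)).prodMk
      (((hasFDerivAt_snd (𝕜 := ℝ) (p := q₀)).sub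
      ((constantCurve E).hasFDerivAt.comp q₀ (hasFDerivAt_fst (𝕜 := ℝ) (p := q₀)).snd)).sub h1)
    refine h3.congr_fderiv ?_
    refine ContinuousLinearMap.ext fun q => Prod.ext rfl ?_
    simp [e, B, sub_sub]
  let Θ := hΨ.contDiffAt.toOpenPartialHomeomorph Ψ hder (by simp)
  have hΘ : ∀ q, Θ q = Ψ q := fun q => rfl
  have hq₀ : q₀ ∈ Θ.source := hΨ.contDiffAt.mem_toOpenPartialHomeomorph_source hder (by simp)
  have hΨq₀ : Ψ q₀ = ((0, z₀), 0) := by simp [Ψ, q₀]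
  have ht₀ : (((0, z₀), 0) : (ℝ × E) × X) ∈ Θ.target := by
    rw [← hΨq₀]; exact Θ.map_source hq₀
  have hs₀ : Θ.symm ((0, z₀), 0) = q₀ := by
    rw [← hΨq₀]; exact Θ.left_inv hq₀
  -- Smoothness of the inverse is needed at every point of one neighbourhood. Smoothness at `q₀`
  -- alone gives for each finite order a neighbourhood that may shrink with the order.
  have hequiv : ∀ᶠ q in nhds q₀, ∃ e' : ((ℝ × E) × X) ≃L[ℝ] ((ℝ × E) × X),
      HasFDerivAt Ψ (e' : (ℝ × E) × X →L[ℝ] (ℝ × E) × X) q := by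
    have hcont : ContinuousAt (fderiv ℝ Ψ) q₀ :=
      (hΨ.continuous_fderiv (by simp)).continuousAt
    have := hcont.preimage_mem_nhds (by rw [hder.fderiv]; exact ContinuousLinearEquiv.nhds e)
    filter_upwards [this] with q ⟨e', he'⟩
    exact ⟨e', he' ▸ (hΨ.differentiable (by simp) q).hasFDerivAt⟩
  have hj : ContinuousAt (fun p : ℝ × E => Θ.symm (p, 0)) (0, z₀) := by
    have h1 : ContinuousAt Θ.symm (((0, z₀), 0) : (ℝ × E) × X) := Θ.symm.continuousAt ht₀
    exact ContinuousAt.comp (f := fun p : ℝ × E => ((p, 0) : (ℝ × E) × X)) h1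
      (by fun_prop)
  have hT : ∀ᶠ p : ℝ × E in nhds (0, z₀), ((p, 0) : (ℝ × E) × X) ∈ Θ.target :=
    (Continuous.continuousAt (f := fun p : ℝ × E => ((p, 0) : (ℝ × E) × X)) (by fun_prop)
      ).preimage_mem_nhds (Θ.open_target.mem_nhds ht₀)
  have hE := hj.eventually (hs₀.symm ▸ hequiv)
  refine ⟨_, fun p => (Θ.symm (p, 0)).2, Filter.inter_mem hT hE, ?_, ?_⟩
  · rintro p ⟨hp1, e', he'⟩
    have := Θ.contDiffAt_symm (n := ∞) hp1 he' hΨ.contDiffAt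
    exact (ContDiffAt.comp (f := fun p : ℝ × E => ((p, 0) : (ℝ × E) × X)) p this
      (by fun_prop)).snd
  · rintro p ⟨hp1, -⟩
    have h := Θ.right_inv hp1
    rw [hΘ] at h
    have h1 : (Θ.symm (p, 0)).1 = p := congrArg Prod.fst h
    have h2 := congrArg Prod.snd h
    simp only [Ψ, h1] at h2
    rw [sub_sub, sub_eq_zero] at h2
    exact h2

/-- A smooth Lipschitz vector field has a smooth local flow. -/
theorem exists_contDiff_flow_of_lipschitz {f : E → E} (hf : ContDiff ℝ ∞ f) {L : NNReal}
    (hL : LipschitzWith L f) (z₀ : E) :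
    ∃ δ > 0, ∃ r > 0, ∃ Φ : ℝ × E → E,
      ContDiffOn ℝ ∞ Φ (Ioo (-δ) δ ×ˢ Metric.ball z₀ r) ∧
      ∀ z ∈ Metric.ball z₀ r, Φ (0, z) = z ∧ ∀ t ∈ Ioo (-δ) δ,
        HasDerivAt (fun τ => Φ (τ, z)) (f (Φ (t, z))) t := by
  obtain ⟨U, α, hU, hα, hαe⟩ := exists_contDiff_integral_equation ⟨f, hf.continuous⟩ hf z₀
  obtain ⟨r₁, hr₁, ε, hε, hsol⟩ :=
    (hf.contDiffAt (x := z₀)).of_le (by simp)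
      |>.exists_forall_mem_closedBall_exists_eq_forall_mem_Ioo_hasDerivAt 0
  choose! y hy0 hy using hsol
  obtain ⟨ρ, hρ, hρU⟩ := Metric.mem_nhds_iff.1 hU
  have hpos : 0 < min ε ρ := lt_min hε hρ
  -- `α (t, z)` is the solution up to time `t`, rescaled to `[0, 1]`; its value at `1` identifies
  -- the Picard–Lindelöf solution with a smooth function of `(t, z)`.
  have heq : ∀ t ∈ Ioo (-(min ε ρ)) (min ε ρ), ∀ z ∈ Metric.ball z₀ (min r₁ ρ),
      (t, z) ∈ U ∧ α (t, z) 1 = y z t := by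
    intro t ht z hz
    have hz' : z ∈ Metric.closedBall z₀ r₁ :=
      Metric.ball_subset_closedBall (Metric.ball_subset_ball (min_le_left _ _) hz)
    have hmem : (t, z) ∈ U := by
      apply hρU
      rw [← ball_prod_same]
      refine ⟨?_, Metric.ball_subset_ball (min_le_right _ _) hz⟩
      rw [mem_ball_zero_iff, Real.norm_eq_abs, abs_lt]
      exact ⟨by linarith [ht.1, min_le_right ε ρ], by linarith [ht.2, min_le_right ε ρ]⟩
    refine ⟨hmem, eq_of_integral_equation hL ⟨f, hf.continuous⟩ (fun _ => rfl) _ (hαe _ hmem)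
      (hy0 z hz') fun s hs => hy z hz' _ ?_⟩
    have h1 : |t * s| ≤ |t| := by
      rw [abs_mul, abs_of_nonneg hs.1]
      exact mul_le_of_le_one_right (abs_nonneg _) hs.2
    have h2 : |t| < ε := (abs_lt.2 ht).trans_le (min_le_left _ _)
    have := abs_lt.1 (h1.trans_lt h2)
    simpa using this
  refine ⟨min ε ρ, hpos, min r₁ ρ, lt_min hr₁ hρ, fun p => y p.2 p.1, ?_, ?_⟩
  · rintro ⟨t, z⟩ ⟨ht, hz⟩
    have h1 : ContDiffWithinAt ℝ ∞ (fun p => α p 1)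
        (Ioo (-(min ε ρ)) (min ε ρ) ×ˢ Metric.ball z₀ (min r₁ ρ)) (t, z) :=
      ((ContinuousMap.evalCLM (M := E) ℝ (1 : unitInterval)).contDiff.contDiffAt.comp (t, z)
        (hα _ (heq t ht z hz).1)).contDiffWithinAt
    exact h1.congr (fun p hp => ((heq p.1 hp.1 p.2 hp.2).2).symm) ((heq t ht z hz).2).symm
  · intro z hz
    have hz' : z ∈ Metric.closedBall z₀ r₁ :=
      Metric.ball_subset_closedBall (Metric.ball_subset_ball (min_le_left _ _) hz)
    refine ⟨hy0 z hz', fun t ht => hy z hz' t ⟨?_, ?_⟩⟩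
    · linarith [ht.1, min_le_left ε ρ]
    · linarith [ht.2, min_le_left ε ρ]

/-- A smooth vector field on an open set has a smooth local flow. -/
theorem exists_contDiff_flow [FiniteDimensional ℝ E] {f : E → E} {U : Set E} (hU : IsOpen U)
    (hf : ContDiffOn ℝ ∞ f U) {z₀ : E} (hz₀ : z₀ ∈ U) :
    ∃ δ > 0, ∃ r > 0, ∃ Φ : ℝ × E → E,
      ContDiffOn ℝ ∞ Φ (Ioo (-δ) δ ×ˢ Metric.ball z₀ r) ∧
      ∀ z ∈ Metric.ball z₀ r, Φ (0, z) = z ∧ ∀ t ∈ Ioo (-δ) δ,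
        Φ (t, z) ∈ U ∧ HasDerivAt (fun τ => Φ (τ, z)) (f (Φ (t, z))) t := by
  obtain ⟨R, hR, hRU⟩ := Metric.isOpen_iff.1 hU z₀ hz₀
  -- The cut-off leaves the field unchanged within `R / 3` of `z₀` and makes it globally Lipschitz.
  -- For small times the flow stays within `R / 3`, where it is a flow of `f` itself.
  let b : ContDiffBump z₀ := ⟨R / 3, R / 2, by positivity, by linarith⟩
  have hbU : tsupport b ⊆ U := by
    rw [b.tsupport_eq]
    exact (Metric.closedBall_subset_ball (by simp only [b]; linarith)).trans hRU
  have hbf : ContDiff ℝ ∞ (fun x => b x • f x) := by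
    refine contDiff_iff_contDiffAt.2 fun x => ?_
    by_cases hx : x ∈ tsupport b
    · exact b.contDiffAt.smul (hf.contDiffAt (hU.mem_nhds (hbU hx)))
    · have : (fun x => b x • f x) =ᶠ[nhds x] fun _ => 0 := by
        filter_upwards [notMem_tsupport_iff_eventuallyEq.1 hx] with y hy
        simp [hy]
      exact contDiffAt_const.congr_of_eventuallyEq this
  have hcs : HasCompactSupport (fun x => b x • f x) := b.hasCompactSupport.smul_right
  obtain ⟨L, hL⟩ := hbf.lipschitzWith_of_hasCompactSupport hcs (by simp)
  obtain ⟨δ, hδ, r, hr, Φ, hΦ, hΦf⟩ := exists_contDiff_flow_of_lipschitz hbf hL z₀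
  have hcont : ContinuousAt Φ (0, z₀) :=
    (hΦ.contDiffAt (prod_mem_nhds (Ioo_mem_nhds (by linarith) hδ)
      (Metric.ball_mem_nhds _ hr))).continuousAt
  have hmem : Φ ⁻¹' Metric.closedBall z₀ (R / 3) ∈ nhds ((0 : ℝ), z₀) :=
    hcont.preimage_mem_nhds (by
      rw [(hΦf z₀ (Metric.mem_ball_self hr)).1]
      exact Metric.closedBall_mem_nhds _ (by positivity))
  obtain ⟨ρ, hρ, hρΦ⟩ := Metric.mem_nhds_iff.1 hmem
  refine ⟨min δ ρ, lt_min hδ hρ, min r ρ, lt_min hr hρ, Φ, hΦ.mono (prod_mono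
    (Ioo_subset_Ioo (neg_le_neg (min_le_left _ _)) (min_le_left _ _))
    (Metric.ball_subset_ball (min_le_left _ _))), fun z hz => ?_⟩
  have hz' := Metric.ball_subset_ball (min_le_left _ _) hz
  refine ⟨(hΦf z hz').1, fun t ht => ?_⟩
  have ht' : t ∈ Ioo (-δ) δ := ⟨by linarith [ht.1, min_le_left δ ρ],
    by linarith [ht.2, min_le_left δ ρ]⟩
  have hin : Φ (t, z) ∈ Metric.closedBall z₀ (R / 3) := by
    apply hρΦ
    rw [← ball_prod_same]
    refine ⟨?_, Metric.ball_subset_ball (min_le_right _ _) hz⟩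
    rw [mem_ball_zero_iff, Real.norm_eq_abs, abs_lt]
    exact ⟨by linarith [ht.1, min_le_right δ ρ], by linarith [ht.2, min_le_right δ ρ]⟩
  refine ⟨hRU (Metric.closedBall_subset_ball (by linarith) hin), ?_⟩
  have := (hΦf z hz').2 t ht'
  rwa [b.one_of_mem_closedBall hin, one_smul] at this

end Flow

/-! ### Levi-Civita connection of a metric on an open set, and its behaviour under isometries. -/

section Coordinates

variable {E : Type*} [NormedAddCommGroup E] [NormedSpace ℝ E]

/-- A smooth field of nondegenerate symmetric bilinear forms on an open set of a normed space. -/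
structure IsMetricOn (G : E → E →L[ℝ] E →L[ℝ] ℝ) (U : Set E) : Prop where
  isOpen : IsOpen U
  contDiffOn : ContDiffOn ℝ ∞ G U
  symm : ∀ y ∈ U, ∀ v w, G y v w = G y w v
  isInvertible : ∀ y ∈ U, (G y).IsInvertible

/-- Christoffel symbols of the first kind, as a trilinear form. -/
def christoffelForm (G : E → E →L[ℝ] E →L[ℝ] ℝ) (y : E) : E →L[ℝ] E →L[ℝ] E →L[ℝ] ℝ :=
  (1 / 2 : ℝ) • (fderiv ℝ G y + (fderiv ℝ G y).flip
    - ((ContinuousLinearMap.flipₗᵢ ℝ E E ℝ).toContinuousLinearEquiv :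
        (E →L[ℝ] E →L[ℝ] ℝ) →L[ℝ] E →L[ℝ] E →L[ℝ] ℝ).comp (fderiv ℝ G y).flip)

/-- Christoffel symbols of the second kind, as a bilinear map. -/
def christoffelMap (G : E → E →L[ℝ] E →L[ℝ] ℝ) (y : E) : E →L[ℝ] E →L[ℝ] E :=
  (ContinuousLinearMap.compL ℝ E (E →L[ℝ] ℝ) E (G y).inverse).comp (christoffelForm G y)

theorem christoffelForm_apply (G : E → E →L[ℝ] E →L[ℝ] ℝ) (y u v w : E) :
    christoffelForm G y u v w = (1 / 2 : ℝ) * (fderiv ℝ G y u v w + fderiv ℝ G y v u w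
      - fderiv ℝ G y w u v) := rfl

variable {G : E → E →L[ℝ] E →L[ℝ] ℝ} {U : Set E}

namespace IsMetricOn

theorem contDiffAt (hG : IsMetricOn G U) {y : E} (hy : y ∈ U) : ContDiffAt ℝ ∞ G y :=
  hG.contDiffOn.contDiffAt (hG.isOpen.mem_nhds hy)

theorem differentiableAt (hG : IsMetricOn G U) {y : E} (hy : y ∈ U) : DifferentiableAt ℝ G y :=
  (hG.contDiffAt hy).differentiableAt (by simp)

theorem eq_of_forall (hG : IsMetricOn G U) {y : E} (hy : y ∈ U) {v w : E}
    (h : ∀ z, G y v z = G y w z) : v = w := by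
  obtain ⟨e, he⟩ := hG.isInvertible y hy
  apply e.injective
  change (e : E →L[ℝ] E →L[ℝ] ℝ) v = (e : E →L[ℝ] E →L[ℝ] ℝ) w
  rw [he]
  exact ContinuousLinearMap.ext h

theorem fderiv_symm (hG : IsMetricOn G U) {y : E} (hy : y ∈ U) (u v w : E) :
    fderiv ℝ G y u v w = fderiv ℝ G y u w v := by
  let f : (E →L[ℝ] E →L[ℝ] ℝ) →L[ℝ] E →L[ℝ] E →L[ℝ] ℝ :=
    (ContinuousLinearMap.flipₗᵢ ℝ E E ℝ).toContinuousLinearEquiv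
  have h : G =ᶠ[nhds y] fun z => f (G z) := by
    filter_upwards [hG.isOpen.mem_nhds hy] with z hz
    ext v w
    exact hG.symm z hz v w
  have h2 : HasFDerivAt (fun z => f (G z)) (f.comp (fderiv ℝ G y)) y :=
    HasFDerivAt.comp y f.hasFDerivAt (hG.differentiableAt hy).hasFDerivAt
  have h3 := h.fderiv_eq.trans h2.fderiv
  exact congrArg (fun A : E →L[ℝ] E →L[ℝ] E →L[ℝ] ℝ => A u v w) h3

theorem apply_christoffelMap (hG : IsMetricOn G U) {y : E} (hy : y ∈ U) (u v w : E) :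
    G y (christoffelMap G y u v) w = christoffelForm G y u v w := by
  obtain ⟨e, he⟩ := hG.isInvertible y hy
  change G y ((G y).inverse (christoffelForm G y u v)) w = _
  rw [← he, ContinuousLinearMap.inverse_equiv]
  exact congrArg (fun A : E →L[ℝ] ℝ => A w) (e.apply_symm_apply _)

/-- The connection is torsion-free. Later this gives the symmetry of the covariant Hessian and the
exchange of time and parameter derivatives. -/
theorem christoffelMap_symm (hG : IsMetricOn G U) {y : E} (hy : y ∈ U) (u v : E) :
    christoffelMap G y u v = christoffelMap G y v u := by
  refine hG.eq_of_forall hy fun z => ?_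
  rw [hG.apply_christoffelMap hy, hG.apply_christoffelMap hy, christoffelForm_apply,
    christoffelForm_apply, hG.fderiv_symm hy z]
  ring

/-- The Levi-Civita connection is metric. -/
theorem fderiv_eq (hG : IsMetricOn G U) {y : E} (hy : y ∈ U) (u v w : E) :
    fderiv ℝ G y u v w
      = G y (christoffelMap G y u v) w + G y v (christoffelMap G y u w) := by
  rw [hG.symm y hy v, hG.apply_christoffelMap hy, hG.apply_christoffelMap hy,
    christoffelForm_apply, christoffelForm_apply, hG.fderiv_symm hy u w v]
  ring

theorem contDiffOn_christoffelMap [CompleteSpace E] (hG : IsMetricOn G U) :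
    ContDiffOn ℝ ∞ (christoffelMap G) U := by
  intro y hy
  refine ContDiffAt.contDiffWithinAt ?_
  have hD : ContDiffAt ℝ ∞ (fderiv ℝ G) y :=
    (hG.contDiffAt hy).fderiv_right (m := ∞) (by simp)
  have hfl : ContDiffAt ℝ ∞ (fun z => (fderiv ℝ G z).flip) y :=
    (ContinuousLinearMap.flipₗᵢ ℝ E E (E →L[ℝ] ℝ)).toContinuousLinearEquiv.contDiff.contDiffAt.comp
      y hD
  have hF : ContDiffAt ℝ ∞ (christoffelForm G) y :=
    ((hD.add hfl).sub (contDiffAt_const.clm_comp hfl)).const_smul (1 / 2 : ℝ)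
  have hI : ContDiffAt ℝ ∞ (fun z => (G z).inverse) y :=
    ((hG.isInvertible y hy).contDiffAt_map_inverse).comp y (hG.contDiffAt hy)
  exact (((ContinuousLinearMap.compL ℝ E (E →L[ℝ] ℝ) E).contDiff.contDiffAt.comp y hI).clm_comp hF)

end IsMetricOn

/-- `ψ` is near `y` a smooth map that pulls `G'` back to `G`, with bijective derivative at `y`. -/
structure IsIsometryAt (G G' : E → E →L[ℝ] E →L[ℝ] ℝ) (ψ : E → E) (y : E) : Prop where
  contDiffAt : ContDiffAt ℝ ∞ ψ y
  bijective : Function.Bijective (fderiv ℝ ψ y)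
  pullback : ∀ᶠ z in nhds y, ∀ v w, G z v w = G' (ψ z) (fderiv ℝ ψ z v) (fderiv ℝ ψ z w)

theorem _root_.ContDiffAt.fderiv_fderiv_symm {F E : Type*} [NormedAddCommGroup E] [NormedSpace ℝ E]
    [NormedAddCommGroup F] [NormedSpace ℝ F] {u : F → E} {y : F}
    (hu : ContDiffAt ℝ ∞ u y) (v w : F) :
    fderiv ℝ (fderiv ℝ u) y v w = fderiv ℝ (fderiv ℝ u) y w v :=
  (hu.isSymmSndFDerivAt (by
    rw [minSmoothness_of_isRCLikeNormedField]
    exact WithTop.coe_le_coe.2 (le_top : (2 : ℕ∞) ≤ ⊤))).eq v w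

theorem _root_.ContDiffAt.hasFDerivAt_fderiv {F E : Type*} [NormedAddCommGroup E] [NormedSpace ℝ E]
    [NormedAddCommGroup F] [NormedSpace ℝ F] {u : F → E} {y : F}
    (hu : ContDiffAt ℝ ∞ u y) : HasFDerivAt (fderiv ℝ u) (fderiv ℝ (fderiv ℝ u) y) y :=
  ((hu.fderiv_right (m := ∞) (by simp)).differentiableAt (by simp)).hasFDerivAt

theorem _root_.ContDiffAt.hasFDerivAt_fderiv' {F E : Type*} [NormedAddCommGroup E]
    [NormedSpace ℝ E] [NormedAddCommGroup F] [NormedSpace ℝ F] {u : F → E} {y : F}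
    (hu : ContDiffAt ℝ ∞ u y) : HasFDerivAt u (fderiv ℝ u y) y :=
  (hu.differentiableAt (by simp)).hasFDerivAt

variable {G' : E → E →L[ℝ] E →L[ℝ] ℝ} {U' : Set E} {ψ : E → E} {y : E}

namespace IsIsometryAt

/-- Product rule applied to the pullback identity. Its three permuted instances, combined as in the
Koszul formula, yield the transformation law of the Christoffel symbols. -/
theorem fderiv_eq (h : IsIsometryAt G G' ψ y) (hG : IsMetricOn G U)
    (hG' : IsMetricOn G' U') (hy : y ∈ U) (hy' : ψ y ∈ U') (u v w : E) :
    fderiv ℝ G y u v w =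
      fderiv ℝ G' (ψ y) (fderiv ℝ ψ y u) (fderiv ℝ ψ y v) (fderiv ℝ ψ y w)
      + G' (ψ y) (fderiv ℝ (fderiv ℝ ψ) y u v) (fderiv ℝ ψ y w)
      + G' (ψ y) (fderiv ℝ ψ y v) (fderiv ℝ (fderiv ℝ ψ) y u w) := by
  have h1 : HasFDerivAt (fun z => G z v w)
      (((fderiv ℝ G y).flip v).flip w) y := by
    have := (((hG.differentiableAt hy).hasFDerivAt.clm_apply
      (hasFDerivAt_const v y)).clm_apply (hasFDerivAt_const w y))
    refine this.congr_fderiv ?_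
    ext; simp
  have hψ := h.contDiffAt.hasFDerivAt_fderiv'
  have hψ2 := h.contDiffAt.hasFDerivAt_fderiv
  have h2 := (((hG'.differentiableAt hy').hasFDerivAt.comp y hψ).clm_apply
    (hψ2.clm_apply (hasFDerivAt_const v y))).clm_apply
    (hψ2.clm_apply (hasFDerivAt_const w y))
  have h3 : (fun z => G z v w) =ᶠ[nhds y]
      fun z => G' (ψ z) (fderiv ℝ ψ z v) (fderiv ℝ ψ z w) :=
    h.pullback.mono fun z hz => hz v w
  have h4 := (h1.congr_of_eventuallyEq h3.symm).unique h2
  have h5 := congrArg (fun A : E →L[ℝ] ℝ => A u) h4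
  simp at h5
  rw [h5]
  ring

/-- Transformation law of the Christoffel symbols. -/
theorem christoffelMap_eq (h : IsIsometryAt G G' ψ y) (hG : IsMetricOn G U)
    (hG' : IsMetricOn G' U') (hy : y ∈ U) (hy' : ψ y ∈ U') (v w : E) :
    fderiv ℝ ψ y (christoffelMap G y v w)
      = christoffelMap G' (ψ y) (fderiv ℝ ψ y v) (fderiv ℝ ψ y w)
        + fderiv ℝ (fderiv ℝ ψ) y v w := by
  refine hG'.eq_of_forall hy' fun z' => ?_
  -- Testing against vectors `fderiv ℝ ψ y z` suffices because the derivative is onto; the unwanted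
  -- second derivatives of `ψ` then cancel in pairs.
  obtain ⟨z, rfl⟩ := h.bijective.2 z'
  rw [map_add, add_apply, hG'.apply_christoffelMap hy', ← h.pullback.self_of_nhds,
    hG.apply_christoffelMap hy, christoffelForm_apply, christoffelForm_apply,
    h.fderiv_eq hG hG' hy hy', h.fderiv_eq hG hG' hy hy', h.fderiv_eq hG hG' hy hy',
    h.contDiffAt.fderiv_fderiv_symm w v, h.contDiffAt.fderiv_fderiv_symm z v,
    h.contDiffAt.fderiv_fderiv_symm z w,
    hG'.symm _ hy' (fderiv ℝ (fderiv ℝ ψ) y v z) (fderiv ℝ ψ y w)]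
  ring

end IsIsometryAt

section AlongMap

variable {F : Type*} [NormedAddCommGroup F] [NormedSpace ℝ F]

/-- The covariant derivative in the direction `X` of the field `W` along the map `u`. -/
def covDeriv (G : E → E →L[ℝ] E →L[ℝ] ℝ) (u W : F → E) (s X : F) : E :=
  fderiv ℝ W s X + christoffelMap G (u s) (fderiv ℝ u s X) (W s)

/-- The covariant Hessian of the map `u`. -/
def covHessian (G : E → E →L[ℝ] E →L[ℝ] ℝ) (u : F → E) (s X Y : F) : E :=
  fderiv ℝ (fderiv ℝ u) s X Y + christoffelMap G (u s) (fderiv ℝ u s X) (fderiv ℝ u s Y)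

theorem covHessian_symm (hG : IsMetricOn G U) {u : F → E} {s : F} (hu : ContDiffAt ℝ ∞ u s)
    (hs : u s ∈ U) (X Y : F) : covHessian G u s X Y = covHessian G u s Y X := by
  rw [covHessian, covHessian, hu.fderiv_fderiv_symm, hG.christoffelMap_symm hs]

theorem fderiv_fderiv_comp {F' : Type*} [NormedAddCommGroup F'] [NormedSpace ℝ F']
    {u : F → E} {θ : F' → F} {s : F'} (hu : ContDiffAt ℝ ∞ u (θ s))
    (hθ : ContDiffAt ℝ ∞ θ s) (X Y : F') :
    fderiv ℝ (fderiv ℝ (fun z => u (θ z))) s X Y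
      = fderiv ℝ (fderiv ℝ u) (θ s) (fderiv ℝ θ s X) (fderiv ℝ θ s Y)
        + fderiv ℝ u (θ s) (fderiv ℝ (fderiv ℝ θ) s X Y) := by
  have h : (fderiv ℝ (fun z => u (θ z))) =ᶠ[nhds s]
      fun z => (fderiv ℝ u (θ z)).comp (fderiv ℝ θ z) := by
    have h1 : ∀ᶠ z in nhds s, ContDiffAt ℝ 1 u (θ z) :=
      hθ.continuousAt.eventually ((hu.of_le (by simp)).eventually (by simp))
    have h2 : ∀ᶠ z in nhds s, ContDiffAt ℝ 1 θ z := (hθ.of_le (by simp)).eventually (by simp)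
    filter_upwards [h1, h2] with z h1 h2
    exact fderiv_comp z (h1.differentiableAt (by simp)) (h2.differentiableAt (by simp))
  have h3 := (hu.hasFDerivAt_fderiv.comp s hθ.hasFDerivAt_fderiv').clm_comp hθ.hasFDerivAt_fderiv
  have h4 : fderiv ℝ (fun z => (fderiv ℝ u (θ z)).comp (fderiv ℝ θ z)) s = _ :=
    HasFDerivAt.fderiv h3
  rw [h.fderiv_eq, h4]
  simp [add_comm]

/-- Reparametrization adds only a vector tangent to the image. Pairing with a normal vector kills
it, so the second fundamental form is a tensor. -/
theorem covHessian_comp_right {F' : Type*} [NormedAddCommGroup F'] [NormedSpace ℝ F']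
    {u : F → E} {θ : F' → F} {s : F'} (hu : ContDiffAt ℝ ∞ u (θ s))
    (hθ : ContDiffAt ℝ ∞ θ s) (X Y : F') :
    covHessian G (fun z => u (θ z)) s X Y
      = covHessian G u (θ s) (fderiv ℝ θ s X) (fderiv ℝ θ s Y)
        + fderiv ℝ u (θ s) (fderiv ℝ (fderiv ℝ θ) s X Y) := by
  have h : fderiv ℝ (fun z => u (θ z)) s = (fderiv ℝ u (θ s)).comp (fderiv ℝ θ s) :=
    fderiv_comp s (hu.differentiableAt (by simp)) (hθ.differentiableAt (by simp))
  simp only [covHessian, fderiv_fderiv_comp hu hθ, h, ContinuousLinearMap.comp_apply]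
  abel

/-- The inhomogeneous term in the transformation law of the Christoffel symbols cancels the second
derivative of `ψ` that the chain rule produces. -/
theorem IsIsometryAt.covHessian_comp {u : F → E} {s : F} (h : IsIsometryAt G G' ψ (u s))
    (hG : IsMetricOn G U) (hG' : IsMetricOn G' U') (hs : u s ∈ U) (hs' : ψ (u s) ∈ U')
    (hu : ContDiffAt ℝ ∞ u s) (X Y : F) :
    covHessian G' (fun z => ψ (u z)) s X Y = fderiv ℝ ψ (u s) (covHessian G u s X Y) := by
  have h1 : fderiv ℝ (fun z => ψ (u z)) s = (fderiv ℝ ψ (u s)).comp (fderiv ℝ u s) :=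
    fderiv_comp s (h.contDiffAt.differentiableAt (by simp)) (hu.differentiableAt (by simp))
  simp only [covHessian, fderiv_fderiv_comp h.contDiffAt hu, h1, ContinuousLinearMap.comp_apply,
    map_add, h.christoffelMap_eq hG hG' hs hs']
  abel

theorem IsIsometryAt.covDeriv_comp {u W : F → E} {s : F} (h : IsIsometryAt G G' ψ (u s))
    (hG : IsMetricOn G U) (hG' : IsMetricOn G' U') (hs : u s ∈ U) (hs' : ψ (u s) ∈ U')
    (hu : ContDiffAt ℝ ∞ u s) (hW : ContDiffAt ℝ ∞ W s) (X : F) :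
    covDeriv G' (fun z => ψ (u z)) (fun z => fderiv ℝ ψ (u z) (W z)) s X
      = fderiv ℝ ψ (u s) (covDeriv G u W s X) := by
  have h1 : fderiv ℝ (fun z => ψ (u z)) s = (fderiv ℝ ψ (u s)).comp (fderiv ℝ u s) :=
    fderiv_comp s (h.contDiffAt.differentiableAt (by simp)) (hu.differentiableAt (by simp))
  have h2 := (h.contDiffAt.hasFDerivAt_fderiv.comp s hu.hasFDerivAt_fderiv').clm_apply
    hW.hasFDerivAt_fderiv'
  have h3 : fderiv ℝ (fun z => fderiv ℝ ψ (u z) (W z)) s = _ := HasFDerivAt.fderiv h2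
  simp only [covDeriv, h1, h3, map_add, h.christoffelMap_eq hG hG' hs hs']
  simp
  abel

/-- The product rule for the metric along a map. -/
theorem IsMetricOn.hasFDerivAt_apply (hG : IsMetricOn G U) {u V W : F → E} {s : F} (hs : u s ∈ U)
    (hu : ContDiffAt ℝ ∞ u s) (hV : ContDiffAt ℝ ∞ V s) (hW : ContDiffAt ℝ ∞ W s) (X : F) :
    fderiv ℝ (fun z => G (u z) (V z) (W z)) s X
      = G (u s) (covDeriv G u V s X) (W s) + G (u s) (V s) (covDeriv G u W s X) := by
  have h := (((hG.differentiableAt hs).hasFDerivAt.comp s hu.hasFDerivAt_fderiv').clm_apply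
    hV.hasFDerivAt_fderiv').clm_apply hW.hasFDerivAt_fderiv'
  have h3 : fderiv ℝ (fun z => G (u z) (V z) (W z)) s = _ := HasFDerivAt.fderiv h
  rw [h3]
  simp [covDeriv, hG.fderiv_eq hs]
  ring

end AlongMap

end Coordinates

/-! ### Families of geodesics and the propagation of the conical condition. -/

section Variation

variable {E : Type*} [NormedAddCommGroup E] [NormedSpace ℝ E]
  {F : Type*} [NormedAddCommGroup F] [NormedSpace ℝ F]
  {G : E → E →L[ℝ] E →L[ℝ] ℝ} {U : Set E}

/-- The curvature tensor of the Levi-Civita connection. -/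
def curvatureMap (G : E → E →L[ℝ] E →L[ℝ] ℝ) (y u v w : E) : E :=
  fderiv ℝ (christoffelMap G) y u v w - fderiv ℝ (christoffelMap G) y v u w
    + christoffelMap G y u (christoffelMap G y v w)
    - christoffelMap G y v (christoffelMap G y u w)

theorem IsMetricOn.contDiffAt_christoffelMap [CompleteSpace E] (hG : IsMetricOn G U) {y : E}
    (hy : y ∈ U) : ContDiffAt ℝ ∞ (christoffelMap G) y :=
  hG.contDiffOn_christoffelMap.contDiffAt (hG.isOpen.mem_nhds hy)

theorem IsMetricOn.contDiffAt_covDeriv [CompleteSpace E] (hG : IsMetricOn G U) {u W : F → E}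
    {s : F} (hs : u s ∈ U) (hu : ContDiffAt ℝ ∞ u s) (hW : ContDiffAt ℝ ∞ W s) (X : F) :
    ContDiffAt ℝ ∞ (fun z => covDeriv G u W z X) s := by
  have h1 : ContDiffAt ℝ ∞ (fun z => fderiv ℝ W z X) s :=
    (hW.fderiv_right (m := ∞) (by simp)).clm_apply contDiffAt_const
  have h2 : ContDiffAt ℝ ∞ (fun z => fderiv ℝ u z X) s :=
    (hu.fderiv_right (m := ∞) (by simp)).clm_apply contDiffAt_const
  have h3 : ContDiffAt ℝ ∞ (fun z => christoffelMap G (u z)) s :=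
    (hG.contDiffAt_christoffelMap hs).comp s hu
  exact h1.add ((h3.clm_apply h2).clm_apply hW)

/-- Covariant derivatives along a map commute up to the curvature. -/
theorem IsMetricOn.covDeriv_covDeriv_sub [CompleteSpace E] (hG : IsMetricOn G U) {u W : F → E}
    {s : F} (hs : u s ∈ U) (hu : ContDiffAt ℝ ∞ u s) (hW : ContDiffAt ℝ ∞ W s) (X Y : F) :
    covDeriv G u (fun z => covDeriv G u W z Y) s X - covDeriv G u (fun z => covDeriv G u W z X) s Y
      = curvatureMap G (u s) (fderiv ℝ u s X) (fderiv ℝ u s Y) (W s) := by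
  have hΓ : HasFDerivAt (fun z => christoffelMap G (u z)) _ s :=
    ((hG.contDiffAt_christoffelMap hs).hasFDerivAt_fderiv').comp s hu.hasFDerivAt_fderiv'
  have key : ∀ Z, fderiv ℝ (fun z => covDeriv G u W z Z) s = _ := fun Z =>
    HasFDerivAt.fderiv ((hW.hasFDerivAt_fderiv.clm_apply (hasFDerivAt_const Z s)).add
      ((hΓ.clm_apply (hu.hasFDerivAt_fderiv.clm_apply (hasFDerivAt_const Z s))).clm_apply
        hW.hasFDerivAt_fderiv'))
  unfold curvatureMap
  have e : ∀ V Z, covDeriv G u V s Z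
      = fderiv ℝ V s Z + christoffelMap G (u s) (fderiv ℝ u s Z) (V s) := fun _ _ => rfl
  rw [e (fun z => covDeriv G u W z Y), e (fun z => covDeriv G u W z X), key, key]
  simp [covDeriv, hW.fderiv_fderiv_symm X Y, hu.fderiv_fderiv_symm X Y]
  abel

/-- A solution of a homogeneous linear ODE which vanishes once vanishes identically. -/
theorem eq_zero_of_linear_ode {A : ℝ → E →L[ℝ] E} {L : ℝ → E} {a b : ℝ}
    (hA : ContinuousOn A (Ioo a b)) (hL : ∀ τ ∈ Ioo a b, HasDerivAt L (A τ (L τ)) τ)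
    {t : ℝ} (ht : t ∈ Ioo a b) (h0 : L t = 0) {τ : ℝ} (hτ : τ ∈ Ioo a b) : L τ = 0 := by
  -- The coefficient need not be bounded on the open interval, so uniqueness is applied on a compact
  -- subinterval around `t` and `τ`, where a bound of `A` is a Lipschitz constant.
  obtain ⟨a', ha, ha'⟩ := exists_between (lt_min ht.1 hτ.1)
  obtain ⟨b', hb, hb'⟩ := exists_between (max_lt ht.2 hτ.2)
  have hsub : Icc a' b' ⊆ Ioo a b := fun x hx => ⟨ha.trans_le hx.1, hx.2.trans_lt hb'⟩
  obtain ⟨C, hC⟩ := isCompact_Icc.exists_bound_of_continuousOn (hA.mono hsub)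
  have := ODE_solution_unique_of_mem_Ioo (v := fun t x => A t x) (s := fun _ => univ)
    (K := C.toNNReal) (f := L) (g := fun _ => 0) (t₀ := t) (a := a') (b := b')
    (fun σ hσ => by
      refine ((A σ).lipschitz.weaken ?_).lipschitzOnWith
      rw [← NNReal.coe_le_coe]
      exact (hC σ (Ioo_subset_Icc_self hσ)).trans (Real.le_coe_toNNReal C))
    ⟨(lt_min_iff.1 ha').1, (max_lt_iff.1 hb).1⟩
    (fun σ hσ => ⟨hL σ (hsub (Ioo_subset_Icc_self hσ)), trivial⟩)
    (fun σ _ => ⟨by simpa using hasDerivAt_const σ (0 : E), trivial⟩) h0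
  exact this ⟨(lt_min_iff.1 ha').2, (max_lt_iff.1 hb).2⟩

/-- A smooth family of geodesics `τ ↦ P (s, τ)` in a chart, with velocities `Q`. -/
structure IsGeodesicVariation (G : E → E →L[ℝ] E →L[ℝ] ℝ) (U : Set E) (S : Set F) (a b : ℝ)
    (P Q : F × ℝ → E) : Prop where
  isOpen : IsOpen S
  contDiffOn_fst : ContDiffOn ℝ ∞ P (S ×ˢ Ioo a b)
  contDiffOn_snd : ContDiffOn ℝ ∞ Q (S ×ˢ Ioo a b)
  mem : ∀ s ∈ S, ∀ τ ∈ Ioo a b, P (s, τ) ∈ U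
  hasDerivAt_fst : ∀ s ∈ S, ∀ τ ∈ Ioo a b, HasDerivAt (fun σ => P (s, σ)) (Q (s, τ)) τ
  hasDerivAt_snd : ∀ s ∈ S, ∀ τ ∈ Ioo a b, HasDerivAt (fun σ => Q (s, σ))
    (-christoffelMap G (P (s, τ)) (Q (s, τ)) (Q (s, τ))) τ

/-- The infinitesimal condition satisfied at the point `s` by a family of null geodesics, with
positions `Y` and velocities `W` at time `t`, that issue from one point at time `0`. -/
structure IsConical (G : E → E →L[ℝ] E →L[ℝ] ℝ) (Y W : F → E) (s : F) (t : ℝ) : Prop where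
  contDiffAt_fst : ContDiffAt ℝ ∞ Y s
  contDiffAt_snd : ContDiffAt ℝ ∞ W s
  null : ∀ᶠ z in nhds s, G (Y z) (W z) (W z) = 0
  ne_zero : W s ≠ 0
  focal : ∀ X, fderiv ℝ Y s X = t • covDeriv G Y W s X
  injective : ∀ X, covDeriv G Y W s X = 0 → X = 0

namespace IsGeodesicVariation

variable {S : Set F} {a b : ℝ} {P Q : F × ℝ → E}

theorem contDiffAt_fst (h : IsGeodesicVariation G U S a b P Q) {s : F} (hs : s ∈ S) {τ : ℝ}
    (hτ : τ ∈ Ioo a b) : ContDiffAt ℝ ∞ P (s, τ) :=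
  h.contDiffOn_fst.contDiffAt ((h.isOpen.prod isOpen_Ioo).mem_nhds ⟨hs, hτ⟩)

theorem contDiffAt_snd (h : IsGeodesicVariation G U S a b P Q) {s : F} (hs : s ∈ S) {τ : ℝ}
    (hτ : τ ∈ Ioo a b) : ContDiffAt ℝ ∞ Q (s, τ) :=
  h.contDiffOn_snd.contDiffAt ((h.isOpen.prod isOpen_Ioo).mem_nhds ⟨hs, hτ⟩)

theorem _root_.HasFDerivAt.hasDerivAt_slice {V : F × ℝ → E} {V' : F × ℝ →L[ℝ] E} {s : F} {τ : ℝ}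
    (h : HasFDerivAt V V' (s, τ)) : HasDerivAt (fun σ => V (s, σ)) (V' (0, 1)) τ := by
  have h1 : HasDerivAt (fun σ : ℝ => (s, σ)) ((0 : F), (1 : ℝ)) τ :=
    (hasDerivAt_const τ s).prodMk (hasDerivAt_id τ)
  exact h.comp_hasDerivAt τ h1

theorem fderiv_fst (h : IsGeodesicVariation G U S a b P Q) {s : F} (hs : s ∈ S) {τ : ℝ}
    (hτ : τ ∈ Ioo a b) : fderiv ℝ P (s, τ) (0, 1) = Q (s, τ) :=
  (h.contDiffAt_fst hs hτ).hasFDerivAt_fderiv'.hasDerivAt_slice.unique (h.hasDerivAt_fst s hs τ hτ)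

theorem covDeriv_snd (h : IsGeodesicVariation G U S a b P Q) {s : F} (hs : s ∈ S) {τ : ℝ}
    (hτ : τ ∈ Ioo a b) : covDeriv G P Q (s, τ) (0, 1) = 0 := by
  rw [covDeriv, h.fderiv_fst hs hτ, (h.contDiffAt_snd hs hτ).hasFDerivAt_fderiv'.hasDerivAt_slice
    |>.unique (h.hasDerivAt_snd s hs τ hτ), neg_add_cancel]

/-- The time derivative of a field, in terms of its covariant derivative. -/
theorem hasDerivAt_field (h : IsGeodesicVariation G U S a b P Q) {s : F} (hs : s ∈ S) {τ : ℝ}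
    (hτ : τ ∈ Ioo a b) {V : F × ℝ → E} (hV : ContDiffAt ℝ ∞ V (s, τ)) :
    HasDerivAt (fun σ => V (s, σ))
      (covDeriv G P V (s, τ) (0, 1) - christoffelMap G (P (s, τ)) (Q (s, τ)) (V (s, τ))) τ := by
  rw [covDeriv, h.fderiv_fst hs hτ, add_sub_cancel_right]
  exact hV.hasFDerivAt_fderiv'.hasDerivAt_slice

theorem continuousOn_coeff [CompleteSpace E] (hG : IsMetricOn G U)
    (h : IsGeodesicVariation G U S a b P Q) {s : F} (hs : s ∈ S) :
    ContinuousOn (fun τ => -christoffelMap G (P (s, τ)) (Q (s, τ))) (Ioo a b) := by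
  intro τ hτ
  have h1 : ContinuousAt (fun σ => P (s, σ)) τ := (h.hasDerivAt_fst s hs τ hτ).continuousAt
  have h2 : ContinuousAt (fun σ => Q (s, σ)) τ := (h.hasDerivAt_snd s hs τ hτ).continuousAt
  have h3 : ContinuousAt (fun σ => christoffelMap G (P (s, σ))) τ :=
    ContinuousAt.comp (f := fun σ => P (s, σ))
      (hG.contDiffAt_christoffelMap (h.mem s hs τ hτ)).continuousAt h1
  exact (h3.clm_apply h2).neg.continuousWithinAt

/-- A field which is parallel along a geodesic and vanishes once vanishes identically. -/
theorem eq_zero_of_parallel [CompleteSpace E] (hG : IsMetricOn G U)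
    (h : IsGeodesicVariation G U S a b P Q) {s : F} (hs : s ∈ S) {L : ℝ → E}
    (hL : ∀ τ ∈ Ioo a b, HasDerivAt L (-christoffelMap G (P (s, τ)) (Q (s, τ)) (L τ)) τ)
    {t : ℝ} (ht : t ∈ Ioo a b) (h0 : L t = 0) {τ : ℝ} (hτ : τ ∈ Ioo a b) : L τ = 0 :=
  eq_zero_of_linear_ode (h.continuousOn_coeff hG hs) (fun σ hσ => hL σ hσ) ht h0 hτ

/-- The velocity is parallel along each geodesic, so only one term of the product rule survives. -/
theorem hasDerivAt_apply (hG : IsMetricOn G U)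
    (h : IsGeodesicVariation G U S a b P Q) {s : F} (hs : s ∈ S) {τ : ℝ} (hτ : τ ∈ Ioo a b)
    {V : F × ℝ → E} (hV : ContDiffAt ℝ ∞ V (s, τ)) :
    HasDerivAt (fun σ => G (P (s, σ)) (V (s, σ)) (Q (s, σ)))
      (G (P (s, τ)) (covDeriv G P V (s, τ) (0, 1)) (Q (s, τ))) τ := by
  have h1 := hG.hasFDerivAt_apply (h.mem s hs τ hτ) (h.contDiffAt_fst hs hτ) hV
    (h.contDiffAt_snd hs hτ) (0, 1)
  rw [h.covDeriv_snd hs hτ, map_zero, add_zero] at h1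
  rw [← h1]
  have hd : DifferentiableAt ℝ (fun z => G (P z) (V z) (Q z)) (s, τ) :=
    ((((hG.contDiffAt (h.mem s hs τ hτ)).comp (s, τ) (h.contDiffAt_fst hs hτ)).clm_apply
      hV).clm_apply (h.contDiffAt_snd hs hτ)).differentiableAt (by simp)
  have h2 : HasDerivAt (fun σ : ℝ => (s, σ)) ((0 : F), (1 : ℝ)) τ :=
    (hasDerivAt_const τ s).prodMk (hasDerivAt_id τ)
  exact hd.hasFDerivAt.comp_hasDerivAt τ h2

theorem eq_zero_of_hasDerivAt_zero {f : ℝ → ℝ} (hf : ∀ τ ∈ Ioo a b, HasDerivAt f 0 τ)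
    {t : ℝ} (ht : t ∈ Ioo a b) (h0 : f t = 0) {τ : ℝ} (hτ : τ ∈ Ioo a b) : f τ = 0 :=
  eq_zero_of_linear_ode (A := fun _ => 0) continuousOn_const (fun σ hσ => by simpa using hf σ hσ)
    ht h0 hτ

theorem fderiv_slice {V : F × ℝ → E} {s : F} {τ : ℝ} (hV : DifferentiableAt ℝ V (s, τ)) (X : F) :
    fderiv ℝ (fun z => V (z, τ)) s X = fderiv ℝ V (s, τ) (X, 0) := by
  have h1 : HasFDerivAt (fun z : F => (z, τ)) (ContinuousLinearMap.inl ℝ F ℝ) s :=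
    (hasFDerivAt_id s).prodMk (hasFDerivAt_const τ s)
  have h2 : HasFDerivAt (fun z => V (z, τ)) _ s := hV.hasFDerivAt.comp s h1
  rw [h2.fderiv]
  simp

theorem covDeriv_slice (h : IsGeodesicVariation G U S a b P Q) {s : F} (hs : s ∈ S) {τ : ℝ}
    (hτ : τ ∈ Ioo a b) (X : F) :
    covDeriv G (fun z => P (z, τ)) (fun z => Q (z, τ)) s X = covDeriv G P Q (s, τ) (X, 0) := by
  simp only [covDeriv, fderiv_slice ((h.contDiffAt_fst hs hτ).differentiableAt (by simp)),
    fderiv_slice ((h.contDiffAt_snd hs hτ).differentiableAt (by simp))]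

/-- The covariant time derivative of the variation field. -/
theorem covDeriv_variationField (hG : IsMetricOn G U) (h : IsGeodesicVariation G U S a b P Q)
    {s : F} (hs : s ∈ S) {τ : ℝ} (hτ : τ ∈ Ioo a b) (X : F) :
    covDeriv G P (fun p => fderiv ℝ P p (X, 0)) (s, τ) (0, 1) = covDeriv G P Q (s, τ) (X, 0) := by
  have hP := h.contDiffAt_fst hs hτ
  have h1 : ∀ v : F × ℝ, fderiv ℝ (fun p => fderiv ℝ P p v) (s, τ)
      = (fderiv ℝ (fderiv ℝ P) (s, τ)).flip v := fun v => by
    have := hP.hasFDerivAt_fderiv.clm_apply (hasFDerivAt_const v (s, τ))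
    rw [this.fderiv]
    exact ContinuousLinearMap.ext fun q => by simp
  have h2 : Q =ᶠ[nhds (s, τ)] fun p => fderiv ℝ P p (0, 1) := by
    filter_upwards [(h.isOpen.prod isOpen_Ioo).mem_nhds ⟨hs, hτ⟩] with p hp
    exact (h.fderiv_fst hp.1 hp.2).symm
  -- With `Q = ∂_τ P`, both sides are `∂_τ ∂_X P` plus a Christoffel term; symmetry of second
  -- derivatives and of the Christoffel symbols finishes.
  rw [covDeriv, covDeriv, h2.fderiv_eq, h1, h1, h.fderiv_fst hs hτ,
    hG.christoffelMap_symm (h.mem s hs τ hτ)]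
  simp only [ContinuousLinearMap.flip_apply]
  rw [hP.fderiv_fderiv_symm]

/-- In constant curvature, the conical condition propagates along null geodesics. -/
theorem isConical [CompleteSpace E] (hG : IsMetricOn G U) {K : ℝ}
    (hK : ∀ y ∈ U, ∀ u v w, curvatureMap G y u v w = K • (G y v w • u - G y u w • v))
    (h : IsGeodesicVariation G U S a b P Q) {s : F} (hs : s ∈ S) {t t' : ℝ}
    (ht : t ∈ Ioo a b) (ht' : t' ∈ Ioo a b)
    (hc : IsConical G (fun z => P (z, t)) (fun z => Q (z, t)) s t) :
    IsConical G (fun z => P (z, t')) (fun z => Q (z, t')) s t' := by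
  have hnull : ∀ᶠ z in nhds s, ∀ τ ∈ Ioo a b, G (P (z, τ)) (Q (z, τ)) (Q (z, τ)) = 0 := by
    filter_upwards [hc.null, h.isOpen.mem_nhds hs] with z hz hzS τ hτ
    refine eq_zero_of_hasDerivAt_zero (f := fun τ => G (P (z, τ)) (Q (z, τ)) (Q (z, τ)))
      (fun σ hσ => ?_) ht hz hτ
    have := h.hasDerivAt_apply hG hzS hσ (h.contDiffAt_snd hzS hσ)
    rwa [h.covDeriv_snd hzS hσ, map_zero, zero_apply] at this
  -- Differentiating `g(Q, Q) = 0` in the parameter gives `g(∇_X Q, Q) = 0`.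
  have horth' : ∀ τ ∈ Ioo a b, ∀ X : F,
      G (P (s, τ)) (covDeriv G P Q (s, τ) (X, 0)) (Q (s, τ)) = 0 := by
    intro τ hτ X
    have hP := h.contDiffAt_fst hs hτ
    have hQ := h.contDiffAt_snd hs hτ
    have hι : ContDiffAt ℝ ∞ (fun z : F => (z, τ)) s := contDiffAt_id.prodMk contDiffAt_const
    have h1 := hG.hasFDerivAt_apply (u := fun z => P (z, τ)) (V := fun z => Q (z, τ))
      (W := fun z => Q (z, τ)) (h.mem s hs τ hτ) (hP.comp s hι) (hQ.comp s hι) (hQ.comp s hι) X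
    have h2 : (fun z => G (P (z, τ)) (Q (z, τ)) (Q (z, τ))) =ᶠ[nhds s] fun _ => 0 :=
      hnull.mono fun z hz => hz τ hτ
    rw [h2.fderiv_eq, fderiv_fun_const, h.covDeriv_slice hs hτ,
      hG.symm _ (h.mem s hs τ hτ) (Q (s, τ))] at h1
    simp only [Pi.zero_apply, zero_apply] at h1
    linarith
  have hJ : ∀ τ ∈ Ioo a b, ∀ X : F, ContDiffAt ℝ ∞ (fun p => fderiv ℝ P p (X, 0)) (s, τ) :=
    fun τ hτ X => ((h.contDiffAt_fst hs hτ).fderiv_right (m := ∞) (by simp)).clm_apply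
      contDiffAt_const
  have hfocal : ∀ X : F, fderiv ℝ P (s, t) (X, 0) = t • covDeriv G P Q (s, t) (X, 0) := by
    intro X
    rw [← h.covDeriv_slice hs ht, ← fderiv_slice ((h.contDiffAt_fst hs ht).differentiableAt
      (by simp))]
    exact hc.focal X
  -- Gauss lemma: `g(∂_X P, Q)` has time derivative `g(∇_X Q, Q) = 0`, and it vanishes at time `t`
  -- by the focal condition.
  have horth : ∀ X : F, ∀ τ ∈ Ioo a b,
      G (P (s, τ)) (fderiv ℝ P (s, τ) (X, 0)) (Q (s, τ)) = 0 := by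
    intro X τ hτ
    refine eq_zero_of_hasDerivAt_zero
      (f := fun τ => G (P (s, τ)) (fderiv ℝ P (s, τ) (X, 0)) (Q (s, τ))) (fun σ hσ => ?_) ht ?_ hτ
    · have := h.hasDerivAt_apply hG hs hσ (hJ σ hσ X)
      rwa [h.covDeriv_variationField hG hs hσ, horth' σ hσ] at this
    · simp only [hfocal, map_smul, smul_apply, horth' t ht X, smul_zero]
  -- The only use of constant curvature here: both terms of `R(Q, ∂_X P) Q` contain a vanishing
  -- scalar product, so `∇_X Q` is parallel in time.
  have hJ' : ∀ X : F, ∀ τ ∈ Ioo a b, HasDerivAt (fun σ => covDeriv G P Q (s, σ) (X, 0))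
      (-christoffelMap G (P (s, τ)) (Q (s, τ)) (covDeriv G P Q (s, τ) (X, 0))) τ := by
    intro X τ hτ
    have hP := h.contDiffAt_fst hs hτ
    have hQ := h.contDiffAt_snd hs hτ
    have hm := h.mem s hs τ hτ
    have h1 := h.hasDerivAt_field hs hτ (hG.contDiffAt_covDeriv hm hP hQ (X, 0))
    have h2 := hG.covDeriv_covDeriv_sub hm hP hQ (0, 1) (X, 0)
    have h3 : (fun z => covDeriv G P Q z (0, 1)) =ᶠ[nhds (s, τ)] fun _ => 0 := by
      filter_upwards [(h.isOpen.prod isOpen_Ioo).mem_nhds ⟨hs, hτ⟩] with p hp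
      exact h.covDeriv_snd hp.1 hp.2
    have h4 : covDeriv G P (fun z => covDeriv G P Q z (0, 1)) (s, τ) (X, 0) = 0 := by
      rw [covDeriv, h3.fderiv_eq, h.covDeriv_snd hs hτ]
      simp
    rw [h4, sub_zero, hK _ hm, h.fderiv_fst hs hτ, horth X τ hτ, hnull.self_of_nhds τ hτ,
      zero_smul, zero_smul, sub_zero, smul_zero] at h2
    rwa [h2, zero_sub] at h1
  have hι' : ContDiffAt ℝ ∞ (fun z : F => (z, t')) s := contDiffAt_id.prodMk contDiffAt_const
  refine ⟨(h.contDiffAt_fst hs ht').comp s hι', (h.contDiffAt_snd hs ht').comp s hι',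
    hnull.mono fun z hz => hz t' ht', fun h0 => hc.ne_zero ?_, fun X => ?_, fun X hX => ?_⟩
  · exact h.eq_zero_of_parallel hG hs (L := fun σ => Q (s, σ)) (h.hasDerivAt_snd s hs) ht' h0 ht
  · rw [h.covDeriv_slice hs ht', fderiv_slice ((h.contDiffAt_fst hs ht').differentiableAt
      (by simp)), ← sub_eq_zero]
    -- The covariant time derivative of `∂_X P - σ • ∇_X Q` is `∇_X Q - ∇_X Q = 0`.
    refine h.eq_zero_of_parallel hG hs
      (L := fun σ => fderiv ℝ P (s, σ) (X, 0) - σ • covDeriv G P Q (s, σ) (X, 0))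
      (fun τ hτ => ?_) ht (sub_eq_zero.2 (hfocal X)) ht'
    have h1 := h.hasDerivAt_field hs hτ (hJ τ hτ X)
    rw [h.covDeriv_variationField hG hs hτ] at h1
    have h2 := h1.sub ((hasDerivAt_id τ).smul (hJ' X τ hτ))
    refine h2.congr_deriv ?_
    simp only [id, map_sub, map_smul, one_smul, smul_neg]
    abel
  · refine hc.injective X ?_
    rw [h.covDeriv_slice hs ht]
    rw [h.covDeriv_slice hs ht'] at hX
    exact h.eq_zero_of_parallel hG hs (L := fun σ => covDeriv G P Q (s, σ) (X, 0)) (hJ' X) ht' hX ht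

end IsGeodesicVariation

/-- The conical condition does not depend on the chart. -/
theorem IsConical.comp_isometry {G' : E → E →L[ℝ] E →L[ℝ] ℝ} {U' : Set E} {ψ : E → E} {Y W : F → E}
    {s : F} {t : ℝ} (hc : IsConical G Y W s t) (h : IsIsometryAt G G' ψ (Y s))
    (hG : IsMetricOn G U) (hG' : IsMetricOn G' U') (hs : Y s ∈ U) (hs' : ψ (Y s) ∈ U') :
    IsConical G' (fun z => ψ (Y z)) (fun z => fderiv ℝ ψ (Y z) (W z)) s t := by
  have hY := hc.contDiffAt_fst
  have hW := hc.contDiffAt_snd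
  have hd : fderiv ℝ (fun z => ψ (Y z)) s = (fderiv ℝ ψ (Y s)).comp (fderiv ℝ Y s) :=
    fderiv_comp s (h.contDiffAt.differentiableAt (by simp)) (hY.differentiableAt (by simp))
  refine ⟨h.contDiffAt.comp s hY, ?_, ?_, ?_, fun X => ?_, fun X hX => ?_⟩
  · exact ContDiffAt.clm_apply (((h.contDiffAt.fderiv_right (m := ∞) (by simp)).comp s hY)) hW
  · filter_upwards [hc.null, hY.continuousAt.eventually h.pullback] with z hz hz'
    rw [← hz', hz]
  · exact fun h0 => hc.ne_zero (h.bijective.1 (h0.trans (map_zero _).symm))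
  · rw [h.covDeriv_comp hG hG' hs hs' hY hW, hd, ContinuousLinearMap.comp_apply, hc.focal, map_smul]
  · rw [h.covDeriv_comp hG hG' hs hs' hY hW] at hX
    exact hc.injective X (h.bijective.1 (hX.trans (map_zero _).symm))

end Variation

/-! ### Transition maps between preferred charts. -/

section Transition

variable {E : Type*} [NormedAddCommGroup E] [NormedSpace ℝ E]
  {M : Type*} [TopologicalSpace M] [ChartedSpace E M]

/-- The transition map from the preferred chart at `c` to the preferred chart at `c'`. -/
def transition (E : Type*) [NormedAddCommGroup E] [NormedSpace ℝ E]
    {M : Type*} [TopologicalSpace M] [ChartedSpace E M] (c c' : M) (y : E) : E :=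
  extChartAt 𝓘(ℝ, E) c' ((extChartAt 𝓘(ℝ, E) c).symm y)

theorem eventually_symm_mem_source {c c' : M} {y : E} (hy : y ∈ (extChartAt 𝓘(ℝ, E) c).target)
    (hy' : (extChartAt 𝓘(ℝ, E) c).symm y ∈ (extChartAt 𝓘(ℝ, E) c').source) :
    ∀ᶠ z in nhds y, z ∈ (extChartAt 𝓘(ℝ, E) c).target ∧
      (extChartAt 𝓘(ℝ, E) c).symm z ∈ (extChartAt 𝓘(ℝ, E) c').source :=
  ((isOpen_extChartAt_target c).eventually_mem hy).and
    ((continuousAt_extChartAt_symm'' hy).eventually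
      ((isOpen_extChartAt_source (I := 𝓘(ℝ, E)) c').eventually_mem hy'))

theorem contDiffAt_transition [IsManifold 𝓘(ℝ, E) ∞ M] {c c' : M} {y : E}
    (hy : y ∈ (extChartAt 𝓘(ℝ, E) c).target)
    (hy' : (extChartAt 𝓘(ℝ, E) c).symm y ∈ (extChartAt 𝓘(ℝ, E) c').source) :
    ContDiffAt ℝ ∞ (transition E c c') y := by
  have h := contDiffOn_ext_coord_change (I := 𝓘(ℝ, E)) (n := ∞) c' c
  refine h.contDiffAt ?_
  filter_upwards [eventually_symm_mem_source hy hy'] with z hz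
  rw [PartialEquiv.trans_source]
  exact hz

theorem symm_transition {c c' : M} {y : E}
    (hy' : (extChartAt 𝓘(ℝ, E) c).symm y ∈ (extChartAt 𝓘(ℝ, E) c').source) :
    (extChartAt 𝓘(ℝ, E) c').symm (transition E c c' y) = (extChartAt 𝓘(ℝ, E) c).symm y :=
  (extChartAt 𝓘(ℝ, E) c').left_inv hy'

theorem transition_mem_target {c c' : M} {y : E}
    (hy' : (extChartAt 𝓘(ℝ, E) c).symm y ∈ (extChartAt 𝓘(ℝ, E) c').source) :
    transition E c c' y ∈ (extChartAt 𝓘(ℝ, E) c').target :=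
  (extChartAt 𝓘(ℝ, E) c').map_source hy'

theorem fderiv_transition_comp [IsManifold 𝓘(ℝ, E) ∞ M] {c c' c'' : M} {y : E}
    (hy : y ∈ (extChartAt 𝓘(ℝ, E) c).target)
    (hy' : (extChartAt 𝓘(ℝ, E) c).symm y ∈ (extChartAt 𝓘(ℝ, E) c').source)
    (hy'' : (extChartAt 𝓘(ℝ, E) c).symm y ∈ (extChartAt 𝓘(ℝ, E) c'').source) (v : E) :
    fderiv ℝ (transition E c' c'') (transition E c c' y) (fderiv ℝ (transition E c c') y v)
      = fderiv ℝ (transition E c c'') y v := by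
  have h1 : transition E c c'' =ᶠ[nhds y] fun z => transition E c' c'' (transition E c c' z) := by
    filter_upwards [eventually_symm_mem_source hy hy'] with z hz
    simp only [transition, (extChartAt 𝓘(ℝ, E) c').left_inv hz.2]
  have h2 : ContDiffAt ℝ ∞ (transition E c' c'') (transition E c c' y) :=
    contDiffAt_transition (transition_mem_target hy') (by rwa [symm_transition hy'])
  have h3 : HasFDerivAt (fun z => transition E c' c'' (transition E c c' z)) _ y :=
    HasFDerivAt.comp (g := transition E c' c'') y h2.hasFDerivAt_fderiv'
      (contDiffAt_transition hy hy').hasFDerivAt_fderiv'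
  rw [h1.fderiv_eq, h3.fderiv]
  rfl

theorem fderiv_transition_self {c : M} {y : E} (hy : y ∈ (extChartAt 𝓘(ℝ, E) c).target) :
    fderiv ℝ (transition E c c) y = ContinuousLinearMap.id ℝ E := by
  have h : transition E c c =ᶠ[nhds y] id := by
    filter_upwards [(isOpen_extChartAt_target (I := 𝓘(ℝ, E)) c).mem_nhds hy] with z hz
    exact (extChartAt 𝓘(ℝ, E) c).right_inv hz
  rw [h.fderiv_eq, fderiv_id]

theorem fderiv_transition_bijective [IsManifold 𝓘(ℝ, E) ∞ M] {c c' : M} {y : E}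
    (hy : y ∈ (extChartAt 𝓘(ℝ, E) c).target)
    (hy' : (extChartAt 𝓘(ℝ, E) c).symm y ∈ (extChartAt 𝓘(ℝ, E) c').source) :
    Function.Bijective (fderiv ℝ (transition E c c') y) := by
  have hc : (extChartAt 𝓘(ℝ, E) c).symm y ∈ (extChartAt 𝓘(ℝ, E) c).source :=
    (extChartAt 𝓘(ℝ, E) c).map_target hy
  have hback : transition E c' c (transition E c c' y) = y := by
    rw [transition, symm_transition hy', (extChartAt 𝓘(ℝ, E) c).right_inv hy]
  refine Function.bijective_iff_has_inverse.2
    ⟨fderiv ℝ (transition E c' c) (transition E c c' y), fun v => ?_, fun v => ?_⟩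
  · rw [fderiv_transition_comp hy hy' hc, fderiv_transition_self hy]
    rfl
  · have h := fderiv_transition_comp (c := c') (c' := c) (c'' := c')
      (transition_mem_target hy') (by rwa [symm_transition hy']) (by rwa [symm_transition hy']) v
    rw [hback] at h
    rw [h, fderiv_transition_self (transition_mem_target hy')]
    rfl

/-- The tangent space at a point is identified with `E` through the preferred chart at that point,
so in coordinates the inverse chart becomes the transition to the preferred chart of the image
point. -/
theorem mfderiv_extChartAt_symm_eq [IsManifold 𝓘(ℝ, E) ∞ M] {c : M} {y : E}
    (hy : y ∈ (extChartAt 𝓘(ℝ, E) c).target) :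
    (mfderiv 𝓘(ℝ, E) 𝓘(ℝ, E) (extChartAt 𝓘(ℝ, E) c).symm y : E →L[ℝ] E)
      = fderiv ℝ (transition E c ((extChartAt 𝓘(ℝ, E) c).symm y)) y := by
  have h : MDifferentiableAt 𝓘(ℝ, E) 𝓘(ℝ, E) (extChartAt 𝓘(ℝ, E) c).symm y :=
    ((contMDiffOn_extChartAt_symm (I := 𝓘(ℝ, E)) (n := ∞) c).contMDiffAt
      ((isOpen_extChartAt_target c).mem_nhds hy)).mdifferentiableAt (by simp)
  have h2 : (mfderiv 𝓘(ℝ, E) 𝓘(ℝ, E) (extChartAt 𝓘(ℝ, E) c).symm y : E →L[ℝ] E)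
      = fderivWithin ℝ (transition E c ((extChartAt 𝓘(ℝ, E) c).symm y)) (range (id : E → E)) y :=
    h.mfderiv
  rw [h2, range_id, fderivWithin_univ]

end Transition

/-! ### Algebra of Lorentzian forms, and the metric read in charts. -/

section Metric

variable {E : Type*} [NormedAddCommGroup E] [NormedSpace ℝ E]
  {M : Type*} [TopologicalSpace M] [ChartedSpace E M]

/-- A symmetric bilinear form of Lorentzian signature. -/
structure IsLorentzForm (B : E →L[ℝ] E →L[ℝ] ℝ) : Prop where
  symm : ∀ v w, B v w = B w v
  signature : ∃ τ, B τ τ < 0 ∧ ∀ v, B τ v = 0 → v ≠ 0 → 0 < B v v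

/-- Orthogonal null vectors are proportional. -/
theorem IsLorentzForm.exists_smul_of_null {B : E →L[ℝ] E →L[ℝ] ℝ} (hB : IsLorentzForm B) {v w : E}
    (hv : v ≠ 0) (hvv : B v v = 0) (hvw : B v w = 0) (hww : B w w = 0) : ∃ k : ℝ, w = k • v := by
  obtain ⟨τ, -, hpos⟩ := hB.signature
  have hτv : B τ v ≠ 0 := fun h => (hpos v h hv).ne' hvv
  refine ⟨B τ w / B τ v, ?_⟩
  by_contra hne
  -- The combination of `v` and `w` orthogonal to the timelike vector is null, whereas the form is
  -- positive definite on that complement.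
  have h1 := hpos (w - (B τ w / B τ v) • v) (by
    rw [map_sub, map_smul, smul_eq_mul, div_mul_cancel₀ _ hτv, sub_self]) (sub_ne_zero.2 hne)
  simp [hvv, hvw, hww, hB.symm w v] at h1

/-- A vector in the kernel would be orthogonal to the timelike vector and null, hence zero; finite
dimension upgrades injectivity to invertibility. -/
theorem IsLorentzForm.isInvertible [FiniteDimensional ℝ E] {B : E →L[ℝ] E →L[ℝ] ℝ}
    (hB : IsLorentzForm B) : B.IsInvertible := by
  obtain ⟨τ, hτ, hpos⟩ := hB.signature
  have hinj : Function.Injective B := by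
    rw [injective_iff_map_eq_zero]
    intro v hv
    by_contra hne
    have h1 : B τ v = 0 := by rw [hB.symm, hv, zero_apply]
    have h2 := hpos v h1 hne
    rw [hv, zero_apply] at h2
    exact lt_irrefl _ h2
  have hfin : finrank ℝ E = finrank ℝ (E →L[ℝ] ℝ) := by
    rw [← (LinearMap.toContinuousLinearMap (𝕜 := ℝ) (E := E) (F' := ℝ)).finrank_eq]
    exact (Subspace.dual_finrank_eq).symm
  have : FiniteDimensional ℝ (E →L[ℝ] ℝ) :=
    (LinearMap.toContinuousLinearMap (𝕜 := ℝ) (E := E) (F' := ℝ)).finiteDimensional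
  refine ⟨(LinearEquiv.ofInjectiveOfFinrankEq (B : E →ₗ[ℝ] E →L[ℝ] ℝ) hinj
    hfin).toContinuousLinearEquiv, ?_⟩
  ext v w
  rfl

theorem IsLorentzForm.comp {B B' : E →L[ℝ] E →L[ℝ] ℝ} (hB : IsLorentzForm B) {D : E →L[ℝ] E}
    (hD : Function.Bijective D) (h : ∀ v w, B' v w = B (D v) (D w)) : IsLorentzForm B' := by
  obtain ⟨τ, hτ, hpos⟩ := hB.signature
  obtain ⟨σ, rfl⟩ := hD.2 τ
  refine ⟨fun v w => by rw [h, h, hB.symm], σ, by rwa [h], fun v hv hne => ?_⟩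
  rw [h] at hv ⊢
  exact hpos _ hv fun h0 => hne (hD.1 (h0.trans (map_zero D).symm))

namespace LorentzianMetric

variable (g : LorentzianMetric E M)

/-- The scalar product at a point, as a form on the model space. -/
def formAt (x : M) : E →L[ℝ] E →L[ℝ] ℝ := g.form x

theorem isLorentzForm_formAt (x : M) : IsLorentzForm (g.formAt x) :=
  ⟨g.symm x, g.signature x⟩

variable [IsManifold 𝓘(ℝ, E) ∞ M]

theorem coord_apply {c : M} {y : E} (hy : y ∈ (extChartAt 𝓘(ℝ, E) c).target) (v w : E) :
    g.coord c y v w = g.formAt ((extChartAt 𝓘(ℝ, E) c).symm y)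
      (fderiv ℝ (transition E c ((extChartAt 𝓘(ℝ, E) c).symm y)) y v)
      (fderiv ℝ (transition E c ((extChartAt 𝓘(ℝ, E) c).symm y)) y w) := by
  rw [← mfderiv_extChartAt_symm_eq hy]
  rfl

/-- This links the metric on fibres with its chart expression: at the base point of its own chart
the transition map has derivative the identity. -/
theorem coord_self (x : M) : g.coord x (extChartAt 𝓘(ℝ, E) x x) = g.formAt x := by
  ext v w
  have hx : (extChartAt 𝓘(ℝ, E) x).symm (extChartAt 𝓘(ℝ, E) x x) = x := extChartAt_to_inv x
  rw [g.coord_apply (mem_extChartAt_target x), hx,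
    fderiv_transition_self (mem_extChartAt_target x)]
  rfl

theorem isLorentzForm_coord {c : M} {y : E} (hy : y ∈ (extChartAt 𝓘(ℝ, E) c).target) :
    IsLorentzForm (g.coord c y) :=
  (g.isLorentzForm_formAt _).comp (fderiv_transition_bijective hy (mem_extChartAt_source _))
    (g.coord_apply hy)

theorem isMetricOn_coord [FiniteDimensional ℝ E] (c : M) :
    IsMetricOn (g.coord c) (extChartAt 𝓘(ℝ, E) c).target where
  isOpen := isOpen_extChartAt_target c
  contDiffOn := g.smooth c
  symm := fun _ hy => (g.isLorentzForm_coord hy).symm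
  isInvertible := fun _ hy => (g.isLorentzForm_coord hy).isInvertible

theorem coord_transition {c c' : M} {y : E} (hy : y ∈ (extChartAt 𝓘(ℝ, E) c).target)
    (hy' : (extChartAt 𝓘(ℝ, E) c).symm y ∈ (extChartAt 𝓘(ℝ, E) c').source) (v w : E) :
    g.coord c y v w = g.coord c' (transition E c c' y) (fderiv ℝ (transition E c c') y v)
      (fderiv ℝ (transition E c c') y w) := by
  rw [g.coord_apply hy, g.coord_apply (transition_mem_target hy'), symm_transition hy',
    fderiv_transition_comp hy hy' (mem_extChartAt_source _),
    fderiv_transition_comp hy hy' (mem_extChartAt_source _)]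

theorem isIsometryAt_transition {c c' : M} {y : E} (hy : y ∈ (extChartAt 𝓘(ℝ, E) c).target)
    (hy' : (extChartAt 𝓘(ℝ, E) c).symm y ∈ (extChartAt 𝓘(ℝ, E) c').source) :
    IsIsometryAt (g.coord c) (g.coord c') (transition E c c') y where
  contDiffAt := contDiffAt_transition hy hy'
  bijective := fderiv_transition_bijective hy hy'
  pullback := (eventually_symm_mem_source hy hy').mono fun _ hz => g.coord_transition hz.1 hz.2

/-- `curvature` differentiates the symbols with two arguments fixed, `curvatureMap` the bilinear map
as a whole; smoothness of the symbols reconciles them. -/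
theorem curvatureMap_eq [FiniteDimensional ℝ E] {K : ℝ} (hK : g.HasConstantCurvature K) {c : M}
    {y : E} (hy : y ∈ (extChartAt 𝓘(ℝ, E) c).target) (u v w : E) :
    curvatureMap (g.coord c) y u v w = K • (g.coord c y v w • u - g.coord c y u w • v) := by
  rw [← hK c y hy]
  have h : ∀ a b : E, HasFDerivAt (fun z => g.christoffel c z a b)
      (((fderiv ℝ (christoffelMap (g.coord c)) y).flip a).flip b) y := fun a b => by
    have := ((((g.isMetricOn_coord c).contDiffAt_christoffelMap hy).hasFDerivAt_fderiv'.clm_apply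
      (hasFDerivAt_const a y)).clm_apply (hasFDerivAt_const b y))
    refine this.congr_fderiv (ContinuousLinearMap.ext fun q => by simp)
  rw [curvature, (h v w).fderiv, (h u w).fderiv]
  rfl

end LorentzianMetric

end Metric

/-! ### Geodesics on the manifold and propagation of the conical condition over `[0, 1]`. -/

section Geodesics

variable {E : Type*} [NormedAddCommGroup E] [NormedSpace ℝ E]
  {M : Type*} [TopologicalSpace M] [ChartedSpace E M]

/-- The vector field on the tangent bundle of a chart whose integral curves are the geodesics. -/
def geodesicField (G : E → E →L[ℝ] E →L[ℝ] ℝ) (p : E × E) : E × E :=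
  (p.2, -christoffelMap G p.1 p.2 p.2)

theorem IsMetricOn.contDiffOn_geodesicField [CompleteSpace E] {G : E → E →L[ℝ] E →L[ℝ] ℝ}
    {U : Set E} (hG : IsMetricOn G U) : ContDiffOn ℝ ∞ (geodesicField G) (U ×ˢ univ) := by
  have h : ContDiffOn ℝ ∞ (fun p : E × E => christoffelMap G p.1) (U ×ˢ univ) :=
    hG.contDiffOn_christoffelMap.comp contDiffOn_fst fun p hp => hp.1
  exact contDiffOn_snd.prodMk ((h.clm_apply contDiffOn_snd).clm_apply contDiffOn_snd).neg

/-- Position and velocity of a curve in the preferred chart at `c`. -/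
def chartState (E : Type*) [NormedAddCommGroup E] [NormedSpace ℝ E]
    {M : Type*} [TopologicalSpace M] [ChartedSpace E M] (c : M) (γ : ℝ → M) (t : ℝ) : E × E :=
  (extChartAt 𝓘(ℝ, E) c (γ t), deriv (extChartAt 𝓘(ℝ, E) c ∘ γ) t)

namespace LorentzianMetric.IsGeodesicOn

variable {g : LorentzianMetric E M} {γ : ℝ → M} {I : Set ℝ} {c c' : M} {t : ℝ}

theorem continuousAt (h : g.IsGeodesicOn γ I) (hI : IsOpen I) (ht : t ∈ I) : ContinuousAt γ t :=
  (h.1.contMDiffAt (hI.mem_nhds ht)).continuousAt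

theorem eventually_mem_source (h : g.IsGeodesicOn γ I) (hI : IsOpen I) (ht : t ∈ I)
    (hc : γ t ∈ (extChartAt 𝓘(ℝ, E) c).source) :
    ∀ᶠ τ in nhds t, τ ∈ I ∧ γ τ ∈ (extChartAt 𝓘(ℝ, E) c).source :=
  (hI.eventually_mem ht).and ((h.continuousAt hI ht).eventually
    ((isOpen_extChartAt_source (I := 𝓘(ℝ, E)) c).eventually_mem hc))

variable [IsManifold 𝓘(ℝ, E) ∞ M]

theorem contDiffAt (h : g.IsGeodesicOn γ I) (hI : IsOpen I) (ht : t ∈ I)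
    (hc : γ t ∈ (extChartAt 𝓘(ℝ, E) c).source) :
    ContDiffAt ℝ ∞ (extChartAt 𝓘(ℝ, E) c ∘ γ) t := by
  rw [← contMDiffAt_iff_contDiffAt]
  refine ContMDiffAt.comp t (contMDiffAt_extChartAt' ?_) (h.1.contMDiffAt (hI.mem_nhds ht))
  rwa [← extChartAt_source 𝓘(ℝ, E)]

theorem hasDerivAt_chart (h : g.IsGeodesicOn γ I) (hI : IsOpen I) (ht : t ∈ I)
    (hc : γ t ∈ (extChartAt 𝓘(ℝ, E) c).source) :
    HasDerivAt (extChartAt 𝓘(ℝ, E) c ∘ γ) (deriv (extChartAt 𝓘(ℝ, E) c ∘ γ) t) t :=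
  ((h.contDiffAt hI ht hc).differentiableAt (by simp)).hasDerivAt

theorem hasDerivAt_chartState (h : g.IsGeodesicOn γ I) (hI : IsOpen I) (ht : t ∈ I)
    (hc : γ t ∈ (extChartAt 𝓘(ℝ, E) c).source) :
    HasDerivAt (chartState E c γ) (geodesicField (g.coord c) (chartState E c γ t)) t := by
  have h1 : HasDerivAt (deriv (extChartAt 𝓘(ℝ, E) c ∘ γ))
      (deriv (deriv (extChartAt 𝓘(ℝ, E) c ∘ γ)) t) t := by
    have := (h.contDiffAt hI ht hc).fderiv_right (m := ∞) (by simp)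
    exact ((this.clm_apply (contDiffAt_const (c := (1 : ℝ)))).differentiableAt (by simp)).hasDerivAt
  rw [eq_neg_of_add_eq_zero_left (h.2 t ht c hc)] at h1
  exact (h.hasDerivAt_chart hI ht hc).prodMk h1

theorem deriv_chart_change (h : g.IsGeodesicOn γ I) (hI : IsOpen I) (ht : t ∈ I)
    (hc : γ t ∈ (extChartAt 𝓘(ℝ, E) c).source) (hc' : γ t ∈ (extChartAt 𝓘(ℝ, E) c').source) :
    deriv (extChartAt 𝓘(ℝ, E) c' ∘ γ) t
      = fderiv ℝ (transition E c c') (extChartAt 𝓘(ℝ, E) c (γ t))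
        (deriv (extChartAt 𝓘(ℝ, E) c ∘ γ) t) := by
  have h1 : extChartAt 𝓘(ℝ, E) c' ∘ γ
      =ᶠ[nhds t] transition E c c' ∘ (extChartAt 𝓘(ℝ, E) c ∘ γ) := by
    filter_upwards [h.eventually_mem_source hI ht hc] with τ hτ
    simp only [transition, Function.comp_apply, (extChartAt 𝓘(ℝ, E) c).left_inv hτ.2]
  have h2 : ContDiffAt ℝ ∞ (transition E c c') (extChartAt 𝓘(ℝ, E) c (γ t)) :=
    contDiffAt_transition ((extChartAt 𝓘(ℝ, E) c).map_source hc)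
      (by rwa [(extChartAt 𝓘(ℝ, E) c).left_inv hc])
  rw [h1.deriv_eq]
  exact (h2.hasFDerivAt_fderiv'.comp_hasDerivAt t (h.hasDerivAt_chart hI ht hc)).deriv

/-- A geodesic agrees with a solution of the geodesic equation in a chart, as long as the latter
exists. -/
theorem chartState_eq [FiniteDimensional ℝ E] [T2Space M] (h : g.IsGeodesicOn γ I) (hI : IsOpen I)
    {J : Set ℝ} (hJ : IsOpen J) (hJc : IsPreconnected J) (hJI : J ⊆ I) {β : ℝ → E × E}
    (hβ : ∀ τ ∈ J, HasDerivAt β (geodesicField (g.coord c) (β τ)) τ)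
    (hβc : ∀ τ ∈ J, (β τ).1 ∈ (extChartAt 𝓘(ℝ, E) c).target) (ht : t ∈ J)
    (hc : γ t ∈ (extChartAt 𝓘(ℝ, E) c).source) (h0 : chartState E c γ t = β t) :
    ∀ τ ∈ J, γ τ ∈ (extChartAt 𝓘(ℝ, E) c).source ∧ chartState E c γ τ = β τ := by
  -- Open–closed argument in the connected set `J`: openness is local uniqueness for the ODE.
  let A : Set ℝ := {τ | τ ∈ J ∧ γ τ ∈ (extChartAt 𝓘(ℝ, E) c).source ∧ chartState E c γ τ = β τ}
  have hopen : IsOpen A := by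
    rw [isOpen_iff_mem_nhds]
    rintro τ ⟨hτ, hτc, hτβ⟩
    have hreg := ((g.isMetricOn_coord c).contDiffOn_geodesicField.contDiffAt (x := β τ)
      (((g.isMetricOn_coord c).isOpen.prod isOpen_univ).mem_nhds ⟨hβc τ hτ, trivial⟩))
    obtain ⟨L, s, hs, hL⟩ := (hreg.of_le (by simp : (1 : WithTop ℕ∞) ≤ ∞)).exists_lipschitzOnWith
    have hsrc := h.eventually_mem_source hI (hJI hτ) hτc
    have h1 : ∀ᶠ σ in nhds τ, HasDerivAt (chartState E c γ)
        (geodesicField (g.coord c) (chartState E c γ σ)) σ ∧ chartState E c γ σ ∈ s :=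
      (hsrc.mono fun σ hσ => h.hasDerivAt_chartState hI hσ.1 hσ.2).and
        ((h.hasDerivAt_chartState hI (hJI hτ) hτc).continuousAt.eventually (hτβ.symm ▸ hs))
    have h2 : ∀ᶠ σ in nhds τ, HasDerivAt β (geodesicField (g.coord c) (β σ)) σ ∧ β σ ∈ s :=
      ((hJ.eventually_mem hτ).mono hβ).and ((hβ τ hτ).continuousAt.eventually hs)
    have h3 := ODE_solution_unique_of_eventually
      (v := fun _ => geodesicField (g.coord c)) (s := fun _ => s)
      (Filter.Eventually.of_forall fun _ => hL) h1 h2 hτβ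
    filter_upwards [hsrc, hJ.mem_nhds hτ, h3] with σ hσ hσJ hσe
    exact ⟨hσJ, hσ.2, hσe⟩
  have hclosed : closure A ∩ J ⊆ A := by
    rintro τ ⟨hτ, hτJ⟩
    have hne : (nhdsWithin τ A).NeBot := mem_closure_iff_nhdsWithin_neBot.1 hτ
    have hγ : Filter.Tendsto γ (nhdsWithin τ A) (nhds (γ τ)) :=
      (h.continuousAt hI (hJI hτJ)).mono_left nhdsWithin_le_nhds
    have hβτ : Filter.Tendsto β (nhdsWithin τ A) (nhds (β τ)) :=
      (hβ τ hτJ).continuousAt.mono_left nhdsWithin_le_nhds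
    have hsymm : Filter.Tendsto (fun σ => (extChartAt 𝓘(ℝ, E) c).symm (β σ).1) (nhdsWithin τ A)
        (nhds ((extChartAt 𝓘(ℝ, E) c).symm (β τ).1)) :=
      (continuousAt_extChartAt_symm'' (hβc τ hτJ)).tendsto.comp
        ((continuous_fst.tendsto _).comp hβτ)
    have hγ' : Filter.Tendsto γ (nhdsWithin τ A)
        (nhds ((extChartAt 𝓘(ℝ, E) c).symm (β τ).1)) := by
      refine hsymm.congr' ?_
      filter_upwards [self_mem_nhdsWithin] with σ hσ
      rw [← hσ.2.2]
      exact (extChartAt 𝓘(ℝ, E) c).left_inv hσ.2.1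
    -- A geodesic could leave the chart at a limit time. Since `M` is Hausdorff, `γ τ` must equal
    -- the limit of the chart solution, which lies in the chart.
    have hτc : γ τ ∈ (extChartAt 𝓘(ℝ, E) c).source := by
      rw [tendsto_nhds_unique hγ hγ']
      exact (extChartAt 𝓘(ℝ, E) c).map_target (hβc τ hτJ)
    refine ⟨hτJ, hτc, ?_⟩
    have h1 : Filter.Tendsto (chartState E c γ) (nhdsWithin τ A) (nhds (chartState E c γ τ)) :=
      (h.hasDerivAt_chartState hI (hJI hτJ) hτc).continuousAt.mono_left nhdsWithin_le_nhds
    refine tendsto_nhds_unique (h1.congr' ?_) hβτ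
    filter_upwards [self_mem_nhdsWithin] with σ hσ using hσ.2.2
  intro τ hτ
  exact (hJc.subset_of_closure_inter_subset hopen ⟨t, ht, ht, hc, h0⟩ hclosed hτ).2

end LorentzianMetric.IsGeodesicOn

variable {F : Type*} [NormedAddCommGroup F] [NormedSpace ℝ F]

theorem covDeriv_congr {G : E → E →L[ℝ] E →L[ℝ] ℝ} {u u' W W' : F → E} {s : F}
    (hu : u =ᶠ[nhds s] u') (hW : W =ᶠ[nhds s] W') (X : F) :
    covDeriv G u W s X = covDeriv G u' W' s X := by
  rw [covDeriv, covDeriv, hu.fderiv_eq, hW.fderiv_eq, hu.self_of_nhds, hW.self_of_nhds]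

theorem IsConical.congr {G : E → E →L[ℝ] E →L[ℝ] ℝ} {Y Y' W W' : F → E} {s : F} {t : ℝ}
    (h : IsConical G Y W s t) (hY : Y' =ᶠ[nhds s] Y) (hW : W' =ᶠ[nhds s] W) :
    IsConical G Y' W' s t where
  contDiffAt_fst := h.contDiffAt_fst.congr_of_eventuallyEq hY
  contDiffAt_snd := h.contDiffAt_snd.congr_of_eventuallyEq hW
  null := by
    filter_upwards [h.null, hY, hW] with z hz hzY hzW
    rw [hzY, hzW, hz]
  ne_zero := by rw [hW.self_of_nhds]; exact h.ne_zero
  focal := fun X => by rw [hY.fderiv_eq, covDeriv_congr hY hW, h.focal]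
  injective := fun X hX => h.injective X (by rwa [covDeriv_congr hY hW] at hX)

/-- The conical condition at time `t` for the family of curves `γ`, near the parameter `s`, in the
preferred chart at `c`. -/
def IsConicalAt (g : LorentzianMetric E M) (γ : F → ℝ → M) (c : M) (s : F) (t : ℝ) : Prop :=
  ∀ᶠ z in nhds s, γ z t ∈ (extChartAt 𝓘(ℝ, E) c).source ∧
    IsConical (g.coord c) (fun z => extChartAt 𝓘(ℝ, E) c (γ z t))
      (fun z => deriv (extChartAt 𝓘(ℝ, E) c ∘ γ z) t) z t

/-- Near `s` the curves of the family `γ` are geodesics on open neighbourhoods of `[0, 1]`. -/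
def IsGeodesicFamily (g : LorentzianMetric E M) (γ : F → ℝ → M) (s : F) : Prop :=
  ∀ᶠ z in nhds s, ∃ ε > 0, g.IsGeodesicOn (γ z) (Ioo (-ε) (1 + ε))

theorem IsConicalAt.continuousAt {g : LorentzianMetric E M} {γ : F → ℝ → M} {c : M} {s : F}
    {t : ℝ} (h : IsConicalAt g γ c s t) : ContinuousAt (fun z => γ z t) s := by
  have h1 : (fun z => γ z t) =ᶠ[nhds s]
      fun z => (extChartAt 𝓘(ℝ, E) c).symm (extChartAt 𝓘(ℝ, E) c (γ z t)) :=
    h.mono fun z hz => ((extChartAt 𝓘(ℝ, E) c).left_inv hz.1).symm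
  refine ContinuousAt.congr ?_ h1.symm
  exact ContinuousAt.comp (f := fun z => extChartAt 𝓘(ℝ, E) c (γ z t))
    (continuousAt_extChartAt_symm'' ((extChartAt 𝓘(ℝ, E) c).map_source h.self_of_nhds.1))
    h.self_of_nhds.2.contDiffAt_fst.continuousAt

variable [IsManifold 𝓘(ℝ, E) ∞ M] [FiniteDimensional ℝ E] {g : LorentzianMetric E M}
  {γ : F → ℝ → M} {s : F}

/-- Positions and velocities of the curves transform by the transition map and its derivative, and
the transition map is an isometry of the coordinate metrics. -/
theorem IsConicalAt.change_chart {c c' : M} {t : ℝ} (h : IsConicalAt g γ c s t)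
    (hγ : IsGeodesicFamily g γ s) (ht : t ∈ Icc (0 : ℝ) 1)
    (hc' : γ s t ∈ (extChartAt 𝓘(ℝ, E) c').source) : IsConicalAt g γ c' s t := by
  have h1 : ∀ᶠ z in nhds s, γ z t ∈ (extChartAt 𝓘(ℝ, E) c').source :=
    h.continuousAt.eventually ((isOpen_extChartAt_source (I := 𝓘(ℝ, E)) c').eventually_mem hc')
  have h2 : ∀ᶠ z in nhds s, extChartAt 𝓘(ℝ, E) c' (γ z t)
        = transition E c c' (extChartAt 𝓘(ℝ, E) c (γ z t)) ∧
      deriv (extChartAt 𝓘(ℝ, E) c' ∘ γ z) t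
        = fderiv ℝ (transition E c c') (extChartAt 𝓘(ℝ, E) c (γ z t))
          (deriv (extChartAt 𝓘(ℝ, E) c ∘ γ z) t) := by
    filter_upwards [h, hγ, h1] with z hz hzγ hz'
    obtain ⟨ε, hε, hg⟩ := hzγ
    refine ⟨by rw [transition, (extChartAt 𝓘(ℝ, E) c).left_inv hz.1],
      hg.deriv_chart_change isOpen_Ioo ⟨by linarith [ht.1], by linarith [ht.2]⟩ hz.1 hz'⟩
  filter_upwards [h, h1, h2.eventually_nhds] with z hz hz' hz2
  refine ⟨hz', ?_⟩
  have ht1 := (extChartAt 𝓘(ℝ, E) c).map_source hz.1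
  have ht2 : (extChartAt 𝓘(ℝ, E) c).symm (extChartAt 𝓘(ℝ, E) c (γ z t))
      ∈ (extChartAt 𝓘(ℝ, E) c').source := by rwa [(extChartAt 𝓘(ℝ, E) c).left_inv hz.1]
  exact (hz.2.comp_isometry (g.isIsometryAt_transition ht1 ht2) (g.isMetricOn_coord c)
    (g.isMetricOn_coord c') ht1 (transition_mem_target ht2)).congr
      (hz2.mono fun _ h => h.1) (hz2.mono fun _ h => h.2)

/-- Propagation inside one flow box around the state at `t₁`. The family is not assumed smooth in
`z`: smoothness at time `t` comes with the conical condition, and the smooth flow carries it to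
`t'`. -/
theorem IsGeodesicFamily.exists_isConicalAt_of_near [T2Space M] {K : ℝ}
    (hK : g.HasConstantCurvature K) (hγ : IsGeodesicFamily g γ s) {t₁ : ℝ}
    (ht₁ : t₁ ∈ Icc (0 : ℝ) 1) :
    ∃ δ > 0, ∀ t ∈ Icc (0 : ℝ) 1, ∀ t' ∈ Icc (0 : ℝ) 1, |t - t₁| < δ → |t' - t₁| < δ →
      γ s t ∈ (extChartAt 𝓘(ℝ, E) (γ s t₁)).source ∧
      (IsConicalAt g γ (γ s t₁) s t → IsConicalAt g γ (γ s t₁) s t') := by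
  set c := γ s t₁ with hc
  have hG := g.isMetricOn_coord c
  obtain ⟨ε, hε, hgs⟩ := hγ.self_of_nhds
  have ht₁I : t₁ ∈ Ioo (-ε) (1 + ε) := ⟨by linarith [ht₁.1], by linarith [ht₁.2]⟩
  have hc₁ : γ s t₁ ∈ (extChartAt 𝓘(ℝ, E) c).source := mem_extChartAt_source _
  obtain ⟨δ, hδ, r, hr, Φ, hΦ, hΦf⟩ := exists_contDiff_flow (hG.isOpen.prod isOpen_univ)
    hG.contDiffOn_geodesicField (z₀ := chartState E c (γ s) t₁)
    ⟨(extChartAt 𝓘(ℝ, E) c).map_source hc₁, trivial⟩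
  have hnear : ∀ᶠ t in nhds t₁, (t ∈ Ioo (-ε) (1 + ε) ∧
      γ s t ∈ (extChartAt 𝓘(ℝ, E) c).source) ∧
      chartState E c (γ s) t ∈ Metric.ball (chartState E c (γ s) t₁) r :=
    (hgs.eventually_mem_source isOpen_Ioo ht₁I hc₁).and
      ((hgs.hasDerivAt_chartState isOpen_Ioo ht₁I hc₁).continuousAt.eventually
        (Metric.ball_mem_nhds _ hr))
  obtain ⟨δ', hδ', hball⟩ := Metric.eventually_nhds_iff.1 hnear
  -- The flow is started at time `t` rather than `t₁`; the bound `δ / 2` keeps `|t' - t|` below `δ`.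
  refine ⟨min δ' (δ / 2), lt_min hδ' (half_pos hδ), fun t ht t' ht' htt htt' => ?_⟩
  have hst := hball (show dist t t₁ < δ' from htt.trans_le (min_le_left _ _))
  refine ⟨hst.1.2, fun hcon => ?_⟩
  have hself := hcon.self_of_nhds
  have hcont : ContinuousAt (fun z => chartState E c (γ z) t) s :=
    hself.2.contDiffAt_fst.continuousAt.prodMk hself.2.contDiffAt_snd.continuousAt
  obtain ⟨S, hSp, hSo, hsS⟩ := eventually_nhds_iff.1 ((hcon.and hγ).and
    (hcont.eventually (Metric.isOpen_ball.eventually_mem hst.2)))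
  have hstate : ContDiffOn ℝ ∞ (fun z => chartState E c (γ z) t) S := fun z hz =>
    ((hSp z hz).1.1.2.contDiffAt_fst.prodMk (hSp z hz).1.1.2.contDiffAt_snd).contDiffWithinAt
  let Ψ : F × ℝ → E × E := fun p => Φ (p.2 - t, chartState E c (γ p.1) t)
  have hΨ : ContDiffOn ℝ ∞ Ψ (S ×ˢ Ioo (t - δ) (t + δ)) := by
    refine hΦ.comp ((contDiffOn_snd.sub contDiffOn_const).prodMk
      (hstate.comp contDiffOn_fst fun p hp => hp.1)) fun p hp => ⟨?_, (hSp p.1 hp.1).2⟩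
    exact ⟨by linarith [hp.2.1], by linarith [hp.2.2]⟩
  have hΨf : ∀ z ∈ S, ∀ τ ∈ Ioo (t - δ) (t + δ), (Ψ (z, τ)).1 ∈ (extChartAt 𝓘(ℝ, E) c).target ∧
      HasDerivAt (fun σ => Ψ (z, σ)) (geodesicField (g.coord c) (Ψ (z, τ))) τ := by
    intro z hz τ hτ
    have := (hΦf _ (hSp z hz).2).2 (τ - t) ⟨by linarith [hτ.1], by linarith [hτ.2]⟩
    exact ⟨this.1.1, HasDerivAt.comp_sub_const τ t this.2⟩
  have hΨ0 : ∀ z ∈ S, Ψ (z, t) = chartState E c (γ z) t := fun z hz => by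
    simp only [Ψ, sub_self]
    exact (hΦf _ (hSp z hz).2).1
  have hvar : IsGeodesicVariation (g.coord c) (extChartAt 𝓘(ℝ, E) c).target S (t - δ) (t + δ)
      (fun p => (Ψ p).1) (fun p => (Ψ p).2) :=
    { isOpen := hSo
      contDiffOn_fst := hΨ.fst
      contDiffOn_snd := hΨ.snd
      mem := fun z hz τ hτ => (hΨf z hz τ hτ).1
      hasDerivAt_fst := fun z hz τ hτ => (hΨf z hz τ hτ).2.fst
      hasDerivAt_snd := fun z hz τ hτ => (hΨf z hz τ hτ).2.snd }
  have htδ : t ∈ Ioo (t - δ) (t + δ) := ⟨by linarith, by linarith⟩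
  have htδ' : t' ∈ Ioo (t - δ) (t + δ) := by
    have h1 := abs_lt.1 (htt.trans_le (min_le_right _ _))
    have h2 := abs_lt.1 (htt'.trans_le (min_le_right _ _))
    exact ⟨by linarith [h1.1, h1.2, h2.1, h2.2], by linarith [h1.1, h1.2, h2.1, h2.2]⟩
  have hagree : ∀ z ∈ S, γ z t' ∈ (extChartAt 𝓘(ℝ, E) c).source ∧
      chartState E c (γ z) t' = Ψ (z, t') := by
    intro z hz
    obtain ⟨η, hη, hgz⟩ := (hSp z hz).1.2
    have htI : ∀ {τ : ℝ}, τ ∈ Icc (0 : ℝ) 1 → τ ∈ Ioo (-η) (1 + η) := fun hτ =>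
      ⟨by linarith [hτ.1], by linarith [hτ.2]⟩
    -- The margin `η` depends on `z`, so the comparison takes place on the intersection with the
    -- interval where `γ z` is a geodesic.
    refine hgz.chartState_eq isOpen_Ioo (J := Ioo (t - δ) (t + δ) ∩ Ioo (-η) (1 + η))
      (β := fun σ => Ψ (z, σ)) (t := t)
      (isOpen_Ioo.inter isOpen_Ioo) ?_ inter_subset_right (fun τ hτ => (hΨf z hz τ hτ.1).2)
      (fun τ hτ => (hΨf z hz τ hτ.1).1) ⟨htδ, htI ht⟩ (hSp z hz).1.1.1 (hΨ0 z hz).symm t'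
      ⟨htδ', htI ht'⟩
    rw [Ioo_inter_Ioo]
    exact isPreconnected_Ioo
  have hSn : ∀ z ∈ S, ∀ᶠ w in nhds z, w ∈ S := fun z hz => hSo.eventually_mem hz
  filter_upwards [hSo.mem_nhds hsS] with z hz
  refine ⟨(hagree z hz).1, ?_⟩
  refine (hvar.isConical hG (fun y hy => g.curvatureMap_eq hK hy) hz htδ htδ' ?_).congr
    ((hSn z hz).mono fun w hw => congrArg Prod.fst (hagree w hw).2)
    ((hSn z hz).mono fun w hw => congrArg Prod.snd (hagree w hw).2)
  exact (hSp z hz).1.1.2.congr ((hSn z hz).mono fun w hw => congrArg Prod.fst (hΨ0 w hw))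
    ((hSn z hz).mono fun w hw => congrArg Prod.snd (hΨ0 w hw))

/-- In constant curvature the conical condition holds at all times if it holds once. -/
theorem IsGeodesicFamily.isConicalAt [T2Space M] {K : ℝ}
    (hK : g.HasConstantCurvature K) (hγ : IsGeodesicFamily g γ s) {t t' : ℝ}
    (ht : t ∈ Icc (0 : ℝ) 1) (ht' : t' ∈ Icc (0 : ℝ) 1) (h : IsConicalAt g γ (γ s t) s t) :
    IsConicalAt g γ (γ s t') s t' := by
  let p : Icc (0 : ℝ) 1 → Prop := fun τ => IsConicalAt g γ (γ s τ) s τ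
  -- The truth value of the condition is a locally constant function on the connected interval `[0,
  -- 1]`.
  have hp : IsLocallyConstant p := by
    refine (IsLocallyConstant.iff_eventually_eq p).2 fun t₁ => ?_
    obtain ⟨δ, hδ, hnear⟩ := hγ.exists_isConicalAt_of_near hK t₁.2
    filter_upwards [Metric.ball_mem_nhds t₁ hδ] with τ hτ
    have hτ' : |(τ : ℝ) - t₁| < δ := hτ
    have h1 : |(t₁ : ℝ) - t₁| < δ := by simpa using hδ
    have hsrc := (hnear τ τ.2 t₁ t₁.2 hτ' h1).1
    refine propext ⟨fun h => ?_, fun h => ?_⟩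
    · exact (hnear τ τ.2 t₁ t₁.2 hτ' h1).2 (IsConicalAt.change_chart h hγ τ.2 hsrc)
    · exact IsConicalAt.change_chart ((hnear t₁ t₁.2 τ τ.2 h1 hτ').2 h) hγ τ.2
        (mem_extChartAt_source _)
  exact (hp.apply_eq_of_preconnectedSpace ⟨t, ht⟩ ⟨t', ht'⟩).mp h

end Geodesics

/-! ### Lightlike hypersurfaces in coordinates: normal fields and umbilicity. -/

section Hypersurface

variable {E : Type*} [NormedAddCommGroup E] [NormedSpace ℝ E]
  {F : Type*} [NormedAddCommGroup F] [NormedSpace ℝ F]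
  {G : E → E →L[ℝ] E →L[ℝ] ℝ} {U : Set E} {u : F → E} {s : F}

theorem IsLorentzForm.apply_ne_zero [FiniteDimensional ℝ E] {B : E →L[ℝ] E →L[ℝ] ℝ}
    (hB : IsLorentzForm B) {w : E}
    (hw : w ≠ 0) : B w ≠ 0 := by
  intro h
  obtain ⟨e, he⟩ := hB.isInvertible
  refine hw (e.injective ?_)
  change (e : E →L[ℝ] E →L[ℝ] ℝ) w = (e : E →L[ℝ] E →L[ℝ] ℝ) 0
  rw [he, h, map_zero]

/-- A hyperplane contained in the orthogonal complement of a nonzero vector is equal to it. -/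
theorem IsLorentzForm.exists_eq_of_orthogonal [FiniteDimensional ℝ E] {B : E →L[ℝ] E →L[ℝ] ℝ}
    (hB : IsLorentzForm B)
    (hdim : finrank ℝ F + 1 = finrank ℝ E) {D : F →L[ℝ] E} (hD : Function.Injective D) {w : E}
    (hw : w ≠ 0) (h : ∀ X, B w (D X) = 0) {v : E} (hv : B w v = 0) : ∃ X, D X = v := by
  have hne : ((B w : E →L[ℝ] ℝ) : Module.Dual ℝ E) ≠ 0 := fun h0 =>
    hB.apply_ne_zero hw (ContinuousLinearMap.coe_injective h0)
  have h1 := Module.Dual.finrank_ker_add_one_of_ne_zero hne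
  have h2 : finrank ℝ (LinearMap.range (D : F →ₗ[ℝ] E)) = finrank ℝ F :=
    LinearMap.finrank_range_of_inj hD
  have h3 : LinearMap.range (D : F →ₗ[ℝ] E) = LinearMap.ker ((B w : E →L[ℝ] ℝ) : E →ₗ[ℝ] ℝ) := by
    refine Submodule.eq_of_le_of_finrank_eq ?_ (by rw [h2]; omega)
    rintro _ ⟨X, rfl⟩
    exact h X
  have h4 : v ∈ LinearMap.range (D : F →ₗ[ℝ] E) := by rw [h3]; exact hv
  exact h4

theorem covDeriv_fderiv (hu : ContDiffAt ℝ ∞ u s) (X Y : F) :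
    covDeriv G u (fun z => fderiv ℝ u z Y) s X = covHessian G u s X Y := by
  have h := hu.hasFDerivAt_fderiv.clm_apply (hasFDerivAt_const Y s)
  rw [covDeriv, h.fderiv, covHessian]
  simp

theorem covDeriv_add_smul {V W : F → E} {a : F → ℝ} (hV : DifferentiableAt ℝ V s)
    (hW : DifferentiableAt ℝ W s) (ha : DifferentiableAt ℝ a s) (X : F) :
    covDeriv G u (fun z => V z + a z • W z) s X
      = covDeriv G u V s X + (fderiv ℝ a s X • W s + a s • covDeriv G u W s X) := by
  have h := hV.hasFDerivAt.add (ha.hasFDerivAt.smul hW.hasFDerivAt)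
  have h' : fderiv ℝ (fun z => V z + a z • W z) s = _ := HasFDerivAt.fderiv h
  rw [covDeriv, h', covDeriv, covDeriv]
  simp
  abel

/-- Differentiating the orthogonality of a normal field expresses the second fundamental form
by the covariant derivative of that field. -/
theorem IsMetricOn.apply_covHessian (hG : IsMetricOn G U) (hs : u s ∈ U)
    (hu : ContDiffAt ℝ ∞ u s) {W : F → E} (hW : ContDiffAt ℝ ∞ W s)
    (h : ∀ᶠ z in nhds s, ∀ X, G (u z) (fderiv ℝ u z X) (W z) = 0) (X Y : F) :
    -G (u s) (covHessian G u s X Y) (W s) = G (u s) (fderiv ℝ u s Y) (covDeriv G u W s X) := by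
  have h1 := hG.hasFDerivAt_apply (V := fun z => fderiv ℝ u z Y) hs hu
    ((hu.fderiv_right (m := ∞) (by simp)).clm_apply contDiffAt_const) hW X
  have h2 : (fun z => G (u z) (fderiv ℝ u z Y) (W z)) =ᶠ[nhds s] fun _ => 0 :=
    h.mono fun z hz => hz Y
  rw [h2.fderiv_eq, fderiv_fun_const, covDeriv_fderiv hu] at h1
  simp only [Pi.zero_apply, zero_apply] at h1
  linarith

/-- Differentiating the nullity of a field. -/
theorem IsMetricOn.apply_covDeriv_of_null (hG : IsMetricOn G U) (hs : u s ∈ U)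
    (hu : ContDiffAt ℝ ∞ u s) {W : F → E} (hW : ContDiffAt ℝ ∞ W s)
    (h : ∀ᶠ z in nhds s, G (u z) (W z) (W z) = 0) (X : F) :
    G (u s) (covDeriv G u W s X) (W s) = 0 := by
  have h1 := hG.hasFDerivAt_apply hs hu hW hW X
  have h2 : (fun z => G (u z) (W z) (W z)) =ᶠ[nhds s] fun _ => 0 := h
  rw [h2.fderiv_eq, fderiv_fun_const, hG.symm _ hs (W s)] at h1
  simp only [Pi.zero_apply, zero_apply] at h1
  linarith

section Cone

variable {W : F → E}

theorem IsConical.fderiv_eq (h : IsConical G u W s 1) (X : F) :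
    fderiv ℝ u s X = covDeriv G u W s X := by
  rw [h.focal, one_smul]

theorem IsConical.fderiv_injective (h : IsConical G u W s 1) :
    Function.Injective (fderiv ℝ u s) :=
  (injective_iff_map_eq_zero _).2 fun X hX => h.injective X (by rwa [h.fderiv_eq] at hX)

theorem IsConical.orthogonal (hG : IsMetricOn G U) (h : IsConical G u W s 1) (hs : u s ∈ U)
    (X : F) : G (u s) (fderiv ℝ u s X) (W s) = 0 := by
  rw [h.fderiv_eq]
  exact hG.apply_covDeriv_of_null hs h.contDiffAt_fst h.contDiffAt_snd h.null X

theorem IsConical.exists_fderiv_eq [FiniteDimensional ℝ E] (hG : IsMetricOn G U)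
    (hL : IsLorentzForm (G (u s)))
    (hdim : finrank ℝ F + 1 = finrank ℝ E) (h : IsConical G u W s 1) (hs : u s ∈ U) :
    ∃ m, m ≠ 0 ∧ fderiv ℝ u s m = W s := by
  obtain ⟨m, hm⟩ := hL.exists_eq_of_orthogonal hdim h.fderiv_injective h.ne_zero
    (fun X => by rw [hL.symm, h.orthogonal hG hs]) h.null.self_of_nhds
  refine ⟨m, fun h0 => h.ne_zero ?_, hm⟩
  rw [← hm, h0, map_zero]

/-- A light cone is totally umbilical. -/
theorem IsConical.umbilical [FiniteDimensional ℝ E] (hG : IsMetricOn G U)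
    (hL : IsLorentzForm (G (u s)))
    (hdim : finrank ℝ F + 1 = finrank ℝ E)
    (h : ∀ᶠ z in nhds s, u z ∈ U ∧ IsConical G u W z 1) {N : F} (hN : N ≠ 0)
    (hNr : ∀ X, G (u s) (fderiv ℝ u s N) (fderiv ℝ u s X) = 0) :
    ∃ l : ℝ, l ≠ 0 ∧ ∀ X Y, -G (u s) (covHessian G u s X Y) (fderiv ℝ u s N)
      = l * G (u s) (fderiv ℝ u s X) (fderiv ℝ u s Y) := by
  obtain ⟨hs, hc⟩ := h.self_of_nhds
  obtain ⟨m, -, hm⟩ := hc.exists_fderiv_eq hG hL hdim hs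
  -- `W` is itself tangent to the hypersurface and the image of `N` is null and orthogonal to it, so
  -- they are proportional. The ratio `k` is the umbilicity factor, since the factor of `W` is `1`.
  obtain ⟨k, hk⟩ := hL.exists_smul_of_null hc.ne_zero hc.null.self_of_nhds
    (by rw [hL.symm, ← hm, hNr]) (hNr N)
  refine ⟨k, ?_, fun X Y => ?_⟩
  · rintro rfl
    rw [zero_smul] at hk
    exact hN (hc.fderiv_injective (hk.trans (map_zero _).symm))
  · have := hG.apply_covHessian hs hc.contDiffAt_fst hc.contDiffAt_snd
      (h.mono fun z hz => hz.2.orthogonal hG hz.1) X Y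
    rw [hk, map_smul, smul_eq_mul, ← mul_neg, this, ← hc.fderiv_eq, hL.symm (fderiv ℝ u s X)]

end Cone

/-- `N` is the radical vector for which the second fundamental form of the hypersurface `u` is
equal to the first one. -/
structure IsNormal (G : E → E →L[ℝ] E →L[ℝ] ℝ) (u : F → E) (s N : F) : Prop where
  ne_zero : N ≠ 0
  radical : ∀ X, G (u s) (fderiv ℝ u s N) (fderiv ℝ u s X) = 0
  second : ∀ X Y, -G (u s) (covHessian G u s X Y) (fderiv ℝ u s N)
    = G (u s) (fderiv ℝ u s X) (fderiv ℝ u s Y)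

/-- This is where the dimension bound enters: a direction independent of the normal and of any given
tangent vector. -/
theorem exists_notMem_span_pair [FiniteDimensional ℝ F] (hF : 3 ≤ finrank ℝ F) (N Y : F) :
    ∃ X, X ∉ Submodule.span ℝ {N, Y} := by
  classical
  by_contra! h
  have h1 : Submodule.span ℝ {N, Y} = ⊤ := (Submodule.eq_top_iff').2 h
  have h2 := finrank_span_finset_le_card (R := ℝ) ({N, Y} : Finset F)
  have h3 : Submodule.span ℝ (({N, Y} : Finset F) : Set F) = ⊤ := by simpa using h1
  rw [Set.finrank, h3, finrank_top] at h2
  have := Finset.card_le_two (a := N) (b := Y)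
  omega

namespace IsNormal

variable {N : F}

theorem fderiv_ne_zero (hN : IsNormal G u s N) (hu : Function.Injective (fderiv ℝ u s)) :
    fderiv ℝ u s N ≠ 0 := fun h0 => hN.ne_zero (hu (h0.trans (map_zero _).symm))

/-- The radical is the only null direction in the tangent hyperplane. -/
theorem exists_smul (hN : IsNormal G u s N) (hL : IsLorentzForm (G (u s)))
    (hu : Function.Injective (fderiv ℝ u s)) {X : F}
    (hX : G (u s) (fderiv ℝ u s X) (fderiv ℝ u s X) = 0) : ∃ k : ℝ, X = k • N := by
  obtain ⟨k, hk⟩ := hL.exists_smul_of_null (hN.fderiv_ne_zero hu) (hN.radical N) (hN.radical X) hX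
  exact ⟨k, hu (by rw [hk, map_smul])⟩

theorem exists_apply_ne_zero [FiniteDimensional ℝ F] (hF : 3 ≤ finrank ℝ F)
    (hN : IsNormal G u s N) (hL : IsLorentzForm (G (u s)))
    (hu : Function.Injective (fderiv ℝ u s)) :
    ∃ X, G (u s) (fderiv ℝ u s X) (fderiv ℝ u s X) ≠ 0 := by
  obtain ⟨X, hX⟩ := exists_notMem_span_pair hF N N
  refine ⟨X, fun h0 => hX ?_⟩
  obtain ⟨k, hk⟩ := hN.exists_smul hL hu h0
  exact Submodule.mem_span_pair.2 ⟨k, 0, by rw [hk, zero_smul, add_zero]⟩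

/-- The radical is a line, and scaling by `k` multiplies the second form by `k`; the first form is
not zero, which fixes `k = 1`. Uniqueness lets pointwise choices of normals be compared with a
smooth field. -/
theorem eq [FiniteDimensional ℝ F] (hF : 3 ≤ finrank ℝ F) (hL : IsLorentzForm (G (u s)))
    (hu : Function.Injective (fderiv ℝ u s)) {N' : F} (hN : IsNormal G u s N)
    (hN' : IsNormal G u s N') : N' = N := by
  obtain ⟨k, hk⟩ := hN.exists_smul hL hu (hN'.radical N')
  obtain ⟨X, hX⟩ := hN.exists_apply_ne_zero hF hL hu
  have h1 := hN'.second X X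
  rw [hk, map_smul, map_smul, smul_eq_mul, ← mul_neg, hN.second] at h1
  rw [hk, mul_right_cancel₀ hX (h1.trans (one_mul _).symm), one_smul]

theorem comp_isometry {G' : E → E →L[ℝ] E →L[ℝ] ℝ} {U' : Set E} {ψ : E → E}
    (hN : IsNormal G u s N) (h : IsIsometryAt G G' ψ (u s)) (hG : IsMetricOn G U)
    (hG' : IsMetricOn G' U') (hs : u s ∈ U) (hs' : ψ (u s) ∈ U') (hu : ContDiffAt ℝ ∞ u s) :
    IsNormal G' (fun z => ψ (u z)) s N := by
  have hd : fderiv ℝ (fun z => ψ (u z)) s = (fderiv ℝ ψ (u s)).comp (fderiv ℝ u s) :=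
    fderiv_comp s (h.contDiffAt.differentiableAt (by simp)) (hu.differentiableAt (by simp))
  have hp := h.pullback.self_of_nhds
  refine ⟨hN.ne_zero, fun X => ?_, fun X Y => ?_⟩
  · rw [hd, ContinuousLinearMap.comp_apply, ContinuousLinearMap.comp_apply, ← hp, hN.radical]
  · rw [h.covHessian_comp hG hG' hs hs' hu, hd, ContinuousLinearMap.comp_apply,
      ContinuousLinearMap.comp_apply, ContinuousLinearMap.comp_apply, ← hp, ← hp, hN.second]

theorem comp_right (hG : IsMetricOn G U) {θ : F → F} {N : F}
    (hN : IsNormal G u (θ s) (fderiv ℝ θ s N)) (hs : u (θ s) ∈ U)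
    (hu : ContDiffAt ℝ ∞ u (θ s)) (hθ : ContDiffAt ℝ ∞ θ s) :
    IsNormal G (fun z => u (θ z)) s N := by
  have hd : fderiv ℝ (fun z => u (θ z)) s = (fderiv ℝ u (θ s)).comp (fderiv ℝ θ s) :=
    fderiv_comp s (hu.differentiableAt (by simp)) (hθ.differentiableAt (by simp))
  refine ⟨fun h0 => hN.ne_zero (by rw [h0, map_zero]), fun X => ?_, fun X Y => ?_⟩
  · rw [hd, ContinuousLinearMap.comp_apply, ContinuousLinearMap.comp_apply, hN.radical]
  · rw [covHessian_comp_right hu hθ, hd, ContinuousLinearMap.comp_apply,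
      ContinuousLinearMap.comp_apply, ContinuousLinearMap.comp_apply, map_add, add_apply,
      hG.symm _ hs (fderiv ℝ u (θ s) (fderiv ℝ (fderiv ℝ θ) s X Y)), hN.radical, add_zero,
      hN.second]

end IsNormal

/-- The normal vectors of a family depend smoothly on the point. -/
theorem exists_contDiffAt_isNormal [FiniteDimensional ℝ E] [FiniteDimensional ℝ F]
    (hF : 3 ≤ finrank ℝ F)
    (hG : IsMetricOn G U) (hL : ∀ y ∈ U, IsLorentzForm (G y))
    (h : ∀ᶠ z in nhds s, u z ∈ U ∧ ContDiffAt ℝ ∞ u z ∧ Function.Injective (fderiv ℝ u z) ∧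
      ∃ N, IsNormal G u z N) :
    ∃ m : F → F, ∀ᶠ z in nhds s, ContDiffAt ℝ ∞ m z ∧ IsNormal G u z (m z) := by
  obtain ⟨hs, hus, hinj, n₀, hn₀⟩ := h.self_of_nhds
  obtain ⟨ℓ, hℓ⟩ := SeparatingDual.exists_eq_one (R := ℝ) hn₀.ne_zero
  obtain ⟨X₀, hX₀⟩ := hn₀.exists_apply_ne_zero hF (hL _ hs) hinj
  -- Adding `ℓ ⊗ ℓ` makes the degenerate first form invertible. A radical vector `N` satisfies `A z
  -- N = ℓ N • ℓ`, so the smooth field `(A z).inverse ℓ` spans the radical.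
  let A : F → F →L[ℝ] F →L[ℝ] ℝ := fun z =>
    (G (u z)).bilinearComp (fderiv ℝ u z) (fderiv ℝ u z) + ℓ.smulRight ℓ
  have hA : ∀ z X Y, A z X Y = G (u z) (fderiv ℝ u z X) (fderiv ℝ u z Y) + ℓ X * ℓ Y :=
    fun z X Y => rfl
  have hdu : ∀ {z}, ContDiffAt ℝ ∞ u z → ContDiffAt ℝ ∞ (fderiv ℝ u) z := fun hz =>
    hz.fderiv_right (m := ∞) (by simp)
  have hAsmooth : ∀ {z}, u z ∈ U → ContDiffAt ℝ ∞ u z → ContDiffAt ℝ ∞ A z := by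
    intro z hz huz
    have h1 : ContDiffAt ℝ ∞ (fun z => (G (u z)).comp (fderiv ℝ u z)) z :=
      ((hG.contDiffAt hz).comp z huz).clm_comp (hdu huz)
    have h2 : ContDiffAt ℝ ∞ (fun z => ((G (u z)).comp (fderiv ℝ u z)).flip) z :=
      (ContinuousLinearMap.flipₗᵢ ℝ F E ℝ).toContinuousLinearEquiv.contDiff.contDiffAt.comp z h1
    have h3 : ContDiffAt ℝ ∞ (fun z => (((G (u z)).comp (fderiv ℝ u z)).flip.comp
        (fderiv ℝ u z)).flip) z :=
      (ContinuousLinearMap.flipₗᵢ ℝ F F ℝ).toContinuousLinearEquiv.contDiff.contDiffAt.comp z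
        (h2.clm_comp (hdu huz))
    exact h3.add contDiffAt_const
  have hAs : (A s).IsInvertible := by
    have hinjA : Function.Injective (A s) := by
      rw [injective_iff_map_eq_zero]
      intro X hX
      have h1 : ℓ X = 0 := by
        have := congrArg (fun B : F →L[ℝ] ℝ => B n₀) hX
        simpa [hA, (hL _ hs).symm _ (fderiv ℝ u s n₀), hn₀.radical, hℓ] using this
      have h2 : G (u s) (fderiv ℝ u s X) (fderiv ℝ u s X) = 0 := by
        have := congrArg (fun B : F →L[ℝ] ℝ => B X) hX
        simpa [hA, h1] using this
      obtain ⟨k, rfl⟩ := hn₀.exists_smul (hL _ hs) hinj h2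
      rw [map_smul, hℓ, smul_eq_mul, mul_one] at h1
      rw [h1, zero_smul]
    have hfin : finrank ℝ F = finrank ℝ (F →L[ℝ] ℝ) := by
      rw [← (LinearMap.toContinuousLinearMap (𝕜 := ℝ) (E := F) (F' := ℝ)).finrank_eq]
      exact (Subspace.dual_finrank_eq).symm
    have : FiniteDimensional ℝ (F →L[ℝ] ℝ) :=
      (LinearMap.toContinuousLinearMap (𝕜 := ℝ) (E := F) (F' := ℝ)).finiteDimensional
    refine ⟨(LinearEquiv.ofInjectiveOfFinrankEq (A s : F →ₗ[ℝ] F →L[ℝ] ℝ) hinjA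
      hfin).toContinuousLinearEquiv, ?_⟩
    ext v w
    rfl
  have hAev : ∀ᶠ z in nhds s, (A z).IsInvertible := by
    obtain ⟨e, he⟩ := hAs
    have := (hAsmooth hs hus).continuousAt.preimage_mem_nhds
      (he ▸ ContinuousLinearEquiv.nhds e)
    filter_upwards [this] with z ⟨e', he'⟩
    exact ⟨e', he'⟩
  have hX₀smooth : ∀ {z}, u z ∈ U → ContDiffAt ℝ ∞ u z →
      ContDiffAt ℝ ∞ (fun z => G (u z) (fderiv ℝ u z X₀) (fderiv ℝ u z X₀)) z := fun hz huz =>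
    ((((hG.contDiffAt hz).comp _ huz).clm_apply ((hdu huz).clm_apply contDiffAt_const)).clm_apply
      ((hdu huz).clm_apply contDiffAt_const))
  have hX₀ev : ∀ᶠ z in nhds s, G (u z) (fderiv ℝ u z X₀) (fderiv ℝ u z X₀) ≠ 0 :=
    (hX₀smooth hs hus).continuousAt.eventually_ne hX₀
  let n : F → F := fun z => (A z).inverse ℓ
  -- The umbilicity factor of `n z`, measured on the non-null vector `X₀`; division by it normalizes
  -- the field.
  let μ : F → ℝ := fun z => -G (u z) (covHessian G u z X₀ X₀) (fderiv ℝ u z (n z))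
    / G (u z) (fderiv ℝ u z X₀) (fderiv ℝ u z X₀)
  refine ⟨fun z => (μ z)⁻¹ • n z, ?_⟩
  filter_upwards [h, hAev, hX₀ev] with z hz hAz hXz
  obtain ⟨hzU, huz, hinjz, N, hN⟩ := hz
  have hAN : N = ℓ N • n z := by
    obtain ⟨e, he⟩ := hAz
    have h1 : A z N = ℓ N • ℓ := by
      ext Y
      simp [hA, hN.radical]
    have h2 : (A z).inverse (A z N) = N := by
      rw [← he, ContinuousLinearMap.inverse_equiv]
      exact e.symm_apply_apply N
    rw [h1, map_smul] at h2
    exact h2.symm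
  have hℓN : ℓ N ≠ 0 := fun h0 => hN.ne_zero (by rw [hAN, h0, zero_smul])
  have hn : n z = (ℓ N)⁻¹ • N := by
    rw [eq_inv_smul_iff₀ hℓN, ← hAN]
  have hμ : μ z = (ℓ N)⁻¹ := by
    have := hN.second X₀ X₀
    simp only [μ, hn, map_smul, smul_eq_mul]
    rw [div_eq_iff hXz, ← this]
    ring
  have hm : (μ z)⁻¹ • n z = N := by
    rw [hμ, inv_inv, ← hAN]
  refine ⟨?_, by rw [hm]; exact hN⟩
  have hns : ContDiffAt ℝ ∞ n z :=
    (hAz.contDiffAt_map_inverse.comp z (hAsmooth hzU huz)).clm_apply contDiffAt_const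
  have hhs : ContDiffAt ℝ ∞ (fun z => covHessian G u z X₀ X₀) z := by
    have h1 : ContDiffAt ℝ ∞ (fun z => christoffelMap G (u z)) z :=
      (hG.contDiffAt_christoffelMap hzU).comp z huz
    exact (((hdu huz).fderiv_right (m := ∞) (by simp)).clm_apply contDiffAt_const |>.clm_apply
      contDiffAt_const).add ((h1.clm_apply ((hdu huz).clm_apply contDiffAt_const)).clm_apply
        ((hdu huz).clm_apply contDiffAt_const))
  have hμs : ContDiffAt ℝ ∞ μ z :=
    ((((hG.contDiffAt hzU).comp z huz).clm_apply hhs).clm_apply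
      ((hdu huz).clm_apply hns)).neg.div (hX₀smooth hzU huz) hXz
  exact (hμs.inv (by rw [hμ]; exact inv_ne_zero hℓN)).smul hns

/-- In constant curvature, the covariant derivative of the normalized normal field of a totally
umbilical lightlike hypersurface is the identity. -/
theorem covDeriv_normal [FiniteDimensional ℝ E] [FiniteDimensional ℝ F]
    (hF : 3 ≤ finrank ℝ F)
    (hdim : finrank ℝ F + 1 = finrank ℝ E)
    (hG : IsMetricOn G U) (hL : ∀ y ∈ U, IsLorentzForm (G y)) {K : ℝ}
    (hK : ∀ y ∈ U, ∀ u v w, curvatureMap G y u v w = K • (G y v w • u - G y u w • v))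
    {m : F → F}
    (h : ∀ᶠ z in nhds s, u z ∈ U ∧ ContDiffAt ℝ ∞ u z ∧ Function.Injective (fderiv ℝ u z) ∧
      ContDiffAt ℝ ∞ m z ∧ IsNormal G u z (m z)) (Y : F) :
    covDeriv G u (fun z => fderiv ℝ u z (m z)) s Y = fderiv ℝ u s Y := by
  obtain ⟨hs, hus, hinj, hms, hN⟩ := h.self_of_nhds
  set W : F → E := fun z => fderiv ℝ u z (m z) with hW
  have hWs : ∀ {z}, ContDiffAt ℝ ∞ u z → ContDiffAt ℝ ∞ m z → ContDiffAt ℝ ∞ W z :=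
    fun hu hm => (hu.fderiv_right (m := ∞) (by simp)).clm_apply hm
  have horth : ∀ᶠ z in nhds s, ∀ X, G (u z) (fderiv ℝ u z X) (W z) = 0 := by
    filter_upwards [h] with z hz X
    rw [hG.symm _ hz.1, hz.2.2.2.2.radical]
  -- `∇_X W - X` is orthogonal to the tangent hyperplane, hence to `W`. It is therefore tangent, so
  -- also null, and must be a multiple of `W`.
  have hprop : ∀ᶠ z in nhds s, ∀ X, ∃ k : ℝ, covDeriv G u W z X - fderiv ℝ u z X = k • W z := by
    filter_upwards [h, horth.eventually_nhds] with z ⟨hz, huz, hiz, hmz, hNz⟩ hoz X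
    have h1 : ∀ Y, G (u z) (fderiv ℝ u z Y) (covDeriv G u W z X - fderiv ℝ u z X) = 0 := by
      intro Y
      rw [map_sub, ← hG.apply_covHessian hz huz (hWs huz hmz) hoz, hNz.second, hG.symm _ hz,
        sub_self]
    have hWz : W z ≠ 0 := hNz.fderiv_ne_zero hiz
    obtain ⟨V, hV⟩ := (hL _ hz).exists_eq_of_orthogonal hdim hiz hWz
      (fun X => hNz.radical X) (h1 (m z))
    exact (hL _ hz).exists_smul_of_null hWz (hNz.radical (m z)) (h1 (m z)) (by
      conv_lhs => rw [← hV]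
      rw [hV]
      have := h1 V
      rwa [hV] at this)
  obtain ⟨θ, hθ⟩ := SeparatingDual.exists_eq_one (R := ℝ) (hN.fderiv_ne_zero hinj)
  have hθW : ∀ᶠ z in nhds s, θ (W z) ≠ 0 := by
    have : ContinuousAt (fun z => θ (W z)) s := θ.continuous.continuousAt.comp
      (hWs hus hms).continuousAt
    exact this.eventually_ne (by rw [hW, hθ]; exact one_ne_zero)
  -- Reading the coefficient through the functional `θ` shows that it is smooth in `z`.
  let a : F → F → ℝ := fun X z => θ (covDeriv G u W z X - fderiv ℝ u z X) / θ (W z)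
  have ha : ∀ᶠ z in nhds s, ∀ X, covDeriv G u W z X = fderiv ℝ u z X + a X z • W z := by
    filter_upwards [hprop, hθW] with z hz hθz X
    obtain ⟨k, hk⟩ := hz X
    have : a X z = k := by
      simp only [a, hk, map_smul, smul_eq_mul]
      rw [mul_div_assoc, div_self hθz, mul_one]
    rw [this, ← hk]
    abel
  have hdus : ∀ X, ContDiffAt ℝ ∞ (fun z => fderiv ℝ u z X) s := fun X =>
    (hus.fderiv_right (m := ∞) (by simp)).clm_apply contDiffAt_const
  have has : ∀ X, ContDiffAt ℝ ∞ (a X) s := fun X =>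
    (θ.contDiff.contDiffAt.comp s ((hG.contDiffAt_covDeriv hs hus (hWs hus hms) X).sub
      (hdus X))).div (θ.contDiff.contDiffAt.comp s (hWs hus hms)) hθW.self_of_nhds
  have hcc : ∀ X Y, covDeriv G u (fun z => covDeriv G u W z Y) s X = covHessian G u s X Y
      + (fderiv ℝ (a Y) s X • W s + a Y s • covDeriv G u W s X) := by
    intro X Y
    rw [covDeriv_congr (W' := fun z => fderiv ℝ u z Y + a Y z • W z)
      (Filter.EventuallyEq.refl _ u) (ha.mono fun z hz => hz Y),
      covDeriv_add_smul ((hdus Y).differentiableAt (by simp))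
      ((hWs hus hms).differentiableAt (by simp)) ((has Y).differentiableAt (by simp)),
      covDeriv_fderiv hus]
  obtain ⟨X, hX⟩ := exists_notMem_span_pair hF (m s) Y
  have hcurv := hG.covDeriv_covDeriv_sub hs hus (hWs hus hms) X Y
  -- The curvature term vanishes because `W` is orthogonal to all tangent vectors, and the Hessian
  -- terms cancel by symmetry. A linear relation between `m s`, `X` and `Y` remains, with
  -- coefficient `a Y s` at `X`.
  rw [hK _ hs, horth.self_of_nhds, horth.self_of_nhds, zero_smul, zero_smul, sub_zero, smul_zero,
    hcc, hcc, covHessian_symm hG hus hs Y X, ha.self_of_nhds X, ha.self_of_nhds Y] at hcurv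
  have hlin : fderiv ℝ u s ((fderiv ℝ (a Y) s X - fderiv ℝ (a X) s Y) • m s
      + a Y s • X - a X s • Y) = 0 := by
    rw [map_sub, map_add, map_smul, map_smul, map_smul, ← hcurv]
    change _ • W s + _ - _ = _
    module
  have hzero := hinj (hlin.trans (map_zero _).symm)
  have haY : a Y s = 0 := by
    by_contra hne
    refine hX ?_
    have : X = (-(a Y s)⁻¹ * (fderiv ℝ (a Y) s X - fderiv ℝ (a X) s Y)) • m s
        + ((a Y s)⁻¹ * a X s) • Y := by
      have h1 : a Y s • X = a X s • Y - (fderiv ℝ (a Y) s X - fderiv ℝ (a X) s Y) • m s := by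
        rw [← sub_eq_zero, ← hzero]
        abel
      calc X = (a Y s)⁻¹ • (a Y s • X) := by rw [smul_smul, inv_mul_cancel₀ hne, one_smul]
        _ = _ := by rw [h1]; module
    exact Submodule.mem_span_pair.2 ⟨_, _, this.symm⟩
  rw [ha.self_of_nhds, haY, zero_smul, add_zero]

/-- In constant curvature, a totally umbilical lightlike hypersurface is conical at time `1` with
respect to its normalized normal field. -/
theorem isConical_of_isNormal [FiniteDimensional ℝ E] [FiniteDimensional ℝ F]
    (hF : 3 ≤ finrank ℝ F)
    (hdim : finrank ℝ F + 1 = finrank ℝ E)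
    (hG : IsMetricOn G U) (hL : ∀ y ∈ U, IsLorentzForm (G y)) {K : ℝ}
    (hK : ∀ y ∈ U, ∀ u v w, curvatureMap G y u v w = K • (G y v w • u - G y u w • v))
    {m : F → F}
    (h : ∀ᶠ z in nhds s, u z ∈ U ∧ ContDiffAt ℝ ∞ u z ∧ Function.Injective (fderiv ℝ u z) ∧
      ContDiffAt ℝ ∞ m z ∧ IsNormal G u z (m z)) :
    IsConical G u (fun z => fderiv ℝ u z (m z)) s 1 := by
  obtain ⟨-, hus, hinj, hms, hN⟩ := h.self_of_nhds
  have hcov := covDeriv_normal hF hdim hG hL hK h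
  refine ⟨hus, (hus.fderiv_right (m := ∞) (by simp)).clm_apply hms, ?_, hN.fderiv_ne_zero hinj,
    fun X => by rw [hcov, one_smul], fun X hX => ?_⟩
  · filter_upwards [h] with z hz using hz.2.2.2.2.radical (m z)
  · rw [hcov] at hX
    exact hinj (hX.trans (map_zero _).symm)

end Hypersurface

/-! ### Maps between manifolds read in charts. -/

section LocalRep

variable {E : Type*} [NormedAddCommGroup E] [NormedSpace ℝ E]
  {M : Type*} [TopologicalSpace M] [ChartedSpace E M]
  {F : Type*} [NormedAddCommGroup F] [NormedSpace ℝ F]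
  {V : Type*} [TopologicalSpace V] [ChartedSpace F V]

/-- The expression of a map `f : V → M` in the preferred charts at `x` and `c`. -/
def localRep (F E : Type*) [NormedAddCommGroup E] [NormedSpace ℝ E]
    {M : Type*} [TopologicalSpace M] [ChartedSpace E M] [NormedAddCommGroup F] [NormedSpace ℝ F]
    {V : Type*} [TopologicalSpace V] [ChartedSpace F V] (x : V) (c : M) (f : V → M) (z : F) : E :=
  extChartAt 𝓘(ℝ, E) c (f ((extChartAt 𝓘(ℝ, F) x).symm z))

theorem eventually_symm {x : V} {P : V → Prop} {z : F} (hz : z ∈ (extChartAt 𝓘(ℝ, F) x).target)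
    (h : ∀ᶠ v in nhds ((extChartAt 𝓘(ℝ, F) x).symm z), P v) :
    ∀ᶠ w in nhds z, P ((extChartAt 𝓘(ℝ, F) x).symm w) :=
  (continuousAt_extChartAt_symm'' hz).eventually h

theorem eventually_of_symm {x : V} {P : V → Prop}
    (h : ∀ᶠ w in nhds (extChartAt 𝓘(ℝ, F) x x), P ((extChartAt 𝓘(ℝ, F) x).symm w)) :
    ∀ᶠ v in nhds x, P v := by
  filter_upwards [(continuousAt_extChartAt x).eventually h,
    extChartAt_source_mem_nhds (I := 𝓘(ℝ, F)) x] with v hv hv'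
  rwa [(extChartAt 𝓘(ℝ, F) x).left_inv hv'] at hv

theorem continuousAt_of_symm {X : Type*} [TopologicalSpace X] {x : V} {f : V → X}
    (h : ContinuousAt (fun z => f ((extChartAt 𝓘(ℝ, F) x).symm z)) (extChartAt 𝓘(ℝ, F) x x)) :
    ContinuousAt f x := by
  refine (h.comp (continuousAt_extChartAt x)).congr ?_
  filter_upwards [extChartAt_source_mem_nhds (I := 𝓘(ℝ, F)) x] with v hv
  simp only [Function.comp_apply, (extChartAt 𝓘(ℝ, F) x).left_inv hv]

theorem mfderiv_eq_fderiv_localRep {f : V → M} {x : V}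
    (hf : MDifferentiableAt 𝓘(ℝ, F) 𝓘(ℝ, E) f x) :
    (mfderiv 𝓘(ℝ, F) 𝓘(ℝ, E) f x : F →L[ℝ] E)
      = fderiv ℝ (localRep F E x (f x) f) (extChartAt 𝓘(ℝ, F) x x) := by
  have h : (mfderiv 𝓘(ℝ, F) 𝓘(ℝ, E) f x : F →L[ℝ] E)
      = fderivWithin ℝ (localRep F E x (f x) f) (range (id : F → F))
        (extChartAt 𝓘(ℝ, F) x x) := hf.mfderiv
  rw [h, range_id, fderivWithin_univ]

/-- The local expressions of a map in different charts differ by the transition maps. -/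
theorem localRep_eventuallyEq {x x' : V} {c c' : M} {f : V → M}
    (hf : Continuous f) {z : F} (hz : z ∈ (extChartAt 𝓘(ℝ, F) x).target)
    (hx' : (extChartAt 𝓘(ℝ, F) x).symm z ∈ (extChartAt 𝓘(ℝ, F) x').source)
    (hc : f ((extChartAt 𝓘(ℝ, F) x).symm z) ∈ (extChartAt 𝓘(ℝ, E) c).source) :
    localRep F E x c' f =ᶠ[nhds z]
      fun w => transition E c c' (localRep F E x' c f (transition F x x' w)) := by
  have h1 : ∀ᶠ w in nhds z, f ((extChartAt 𝓘(ℝ, F) x).symm w) ∈ (extChartAt 𝓘(ℝ, E) c).source :=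
    eventually_symm hz (hf.continuousAt.eventually
      ((isOpen_extChartAt_source (I := 𝓘(ℝ, E)) c).eventually_mem hc))
  filter_upwards [h1, eventually_symm_mem_source hz hx'] with w hw hw'
  simp only [localRep, symm_transition hw'.2]
  rw [transition, (extChartAt 𝓘(ℝ, E) c).left_inv hw]

variable [IsManifold 𝓘(ℝ, E) ∞ M]

theorem firstForm_eq (g : LorentzianMetric E M) {ι : V → M} {x : V}
    (hι : MDifferentiableAt 𝓘(ℝ, F) 𝓘(ℝ, E) ι x) (X Y : F) :
    firstForm g ι x X Y
      = g.coord (ι x) (localRep F E x (ι x) ι (extChartAt 𝓘(ℝ, F) x x))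
        (fderiv ℝ (localRep F E x (ι x) ι) (extChartAt 𝓘(ℝ, F) x x) X)
        (fderiv ℝ (localRep F E x (ι x) ι) (extChartAt 𝓘(ℝ, F) x x) Y) := by
  rw [← mfderiv_eq_fderiv_localRep hι]
  have h : localRep F E x (ι x) ι (extChartAt 𝓘(ℝ, F) x x) = extChartAt 𝓘(ℝ, E) (ι x) (ι x) := by
    rw [localRep, extChartAt_to_inv]
  rw [h, g.coord_self]
  rfl

/-- `hessian` is by definition the covariant Hessian in the preferred charts, so only the scalar
product and the derivative need translation. -/
theorem secondForm_eq (g : LorentzianMetric E M) {ι : V → M} {x : V}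
    (hι : MDifferentiableAt 𝓘(ℝ, F) 𝓘(ℝ, E) ι x) (N X Y : F) :
    secondForm g ι x N X Y
      = -g.coord (ι x) (localRep F E x (ι x) ι (extChartAt 𝓘(ℝ, F) x x))
        (covHessian (g.coord (ι x)) (localRep F E x (ι x) ι) (extChartAt 𝓘(ℝ, F) x x) X Y)
        (fderiv ℝ (localRep F E x (ι x) ι) (extChartAt 𝓘(ℝ, F) x x) N) := by
  rw [← mfderiv_eq_fderiv_localRep hι]
  have h : localRep F E x (ι x) ι (extChartAt 𝓘(ℝ, F) x x) = extChartAt 𝓘(ℝ, E) (ι x) (ι x) := by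
    rw [localRep, extChartAt_to_inv]
  rw [h, g.coord_self]
  rfl

variable [IsManifold 𝓘(ℝ, F) ∞ V]

theorem contDiffAt_comp_symm {x : V} {f : V → E} (hf : ContMDiff 𝓘(ℝ, F) 𝓘(ℝ, E) ∞ f) {z : F}
    (hz : z ∈ (extChartAt 𝓘(ℝ, F) x).target) :
    ContDiffAt ℝ ∞ (fun z => f ((extChartAt 𝓘(ℝ, F) x).symm z)) z := by
  rw [← contMDiffAt_iff_contDiffAt]
  exact hf.contMDiffAt.comp z ((contMDiffOn_extChartAt_symm (n := ∞) x).contMDiffAt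
    ((isOpen_extChartAt_target x).mem_nhds hz))

theorem contDiffAt_localRep {x : V} {c : M} {f : V → M}
    (hf : ContMDiff 𝓘(ℝ, F) 𝓘(ℝ, E) ∞ f) {z : F} (hz : z ∈ (extChartAt 𝓘(ℝ, F) x).target)
    (hc : f ((extChartAt 𝓘(ℝ, F) x).symm z) ∈ (extChartAt 𝓘(ℝ, E) c).source) :
    ContDiffAt ℝ ∞ (localRep F E x c f) z := by
  rw [← contMDiffAt_iff_contDiffAt]
  have h1 : ContMDiffAt 𝓘(ℝ, F) 𝓘(ℝ, E) ∞ (fun z => f ((extChartAt 𝓘(ℝ, F) x).symm z)) z :=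
    hf.contMDiffAt.comp z ((contMDiffOn_extChartAt_symm (n := ∞) x).contMDiffAt
      ((isOpen_extChartAt_target x).mem_nhds hz))
  have h2 : ContMDiffAt 𝓘(ℝ, E) 𝓘(ℝ, E) ∞ (extChartAt 𝓘(ℝ, E) c)
      (f ((extChartAt 𝓘(ℝ, F) x).symm z)) :=
    contMDiffAt_extChartAt' (by rwa [← extChartAt_source 𝓘(ℝ, E)])
  exact ContMDiffAt.comp z h2 h1

theorem fderiv_comp_symm {x : V} {f : V → E} (hf : ContMDiff 𝓘(ℝ, F) 𝓘(ℝ, E) ∞ f) {z : F}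
    (hz : z ∈ (extChartAt 𝓘(ℝ, F) x).target) (X : F) :
    fderiv ℝ (fun z => f ((extChartAt 𝓘(ℝ, F) x).symm z)) z X
      = (mfderiv 𝓘(ℝ, F) 𝓘(ℝ, E) f ((extChartAt 𝓘(ℝ, F) x).symm z) : F →L[ℝ] E)
        (fderiv ℝ (transition F x ((extChartAt 𝓘(ℝ, F) x).symm z)) z X) := by
  rw [← mfderiv_extChartAt_symm_eq hz, ← mfderiv_eq_fderiv]
  have h := mfderiv_comp (I := 𝓘(ℝ, F)) (I' := 𝓘(ℝ, F)) (I'' := 𝓘(ℝ, E)) z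
    (g := f) (f := (extChartAt 𝓘(ℝ, F) x).symm) (hf.mdifferentiableAt (by simp))
    (((contMDiffOn_extChartAt_symm (I := 𝓘(ℝ, F)) (n := ∞) x).contMDiffAt
      ((isOpen_extChartAt_target x).mem_nhds hz)).mdifferentiableAt (by simp))
  exact congrArg (fun A : F →L[ℝ] E => A X) h

end LocalRep

/-! ### Part (a): light cones are totally umbilical. -/

section LightCone

variable {E : Type*} [NormedAddCommGroup E] [NormedSpace ℝ E] [FiniteDimensional ℝ E]
  {M : Type*} [TopologicalSpace M] [T2Space M] [ChartedSpace E M] [IsManifold 𝓘(ℝ, E) ∞ M]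
  {F : Type*} [NormedAddCommGroup F] [NormedSpace ℝ F]
  {V : Type*} [TopologicalSpace V] [ChartedSpace F V] [IsManifold 𝓘(ℝ, F) ∞ V]
  {g : LorentzianMetric E M} {K : ℝ} {ι : V → M}

/-- In constant curvature, light cones are totally umbilical lightlike hypersurfaces. -/
theorem isTotallyUmbilicalLightlike_of_isLightConeAt
    (hdim : finrank ℝ F + 1 = finrank ℝ E) (hK : g.HasConstantCurvature K) {p : M}
    (h : IsLightConeAt F g p ι) : IsTotallyUmbilicalLightlike F g ι := by
  obtain ⟨φ, hφ, hφinj, hφnull, hexp⟩ := h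
  choose β ε hε hgeo hstart hend using hexp
  let γ : V → F → ℝ → M := fun x z => β ((extChartAt 𝓘(ℝ, F) x).symm z)
  have hfam : ∀ x s, IsGeodesicFamily g (γ x) s := fun x s =>
    Filter.Eventually.of_forall fun z => ⟨_, hε _, hgeo _⟩
  have hpp : p ∈ (extChartAt 𝓘(ℝ, E) p).source := mem_extChartAt_source p
  -- At time `0` all curves are at `p`: the focal equation reads `0 = 0`, the Christoffel term drops
  -- out, and the injectivity condition is that `φ` is an immersion.
  have hzero : ∀ x, IsConicalAt g (γ x) p (extChartAt 𝓘(ℝ, F) x x) 0 := by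
    intro x
    filter_upwards [extChartAt_target_mem_nhds (I := 𝓘(ℝ, F)) x] with z hz
    have hY : (fun z => extChartAt 𝓘(ℝ, E) p (γ x z 0)) = fun _ => extChartAt 𝓘(ℝ, E) p p :=
      funext fun z => congrArg _ (hstart _).1
    have hW : (fun z => deriv (extChartAt 𝓘(ℝ, E) p ∘ γ x z) 0)
        = fun z => φ ((extChartAt 𝓘(ℝ, F) x).symm z) := funext fun z => (hstart _).2.deriv
    have hcov : ∀ X, covDeriv (g.coord p) (fun _ => extChartAt 𝓘(ℝ, E) p p)
        (fun z => φ ((extChartAt 𝓘(ℝ, F) x).symm z)) z X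
        = fderiv ℝ (fun z => φ ((extChartAt 𝓘(ℝ, F) x).symm z)) z X := fun X => by
      simp [covDeriv]
    refine ⟨by rw [show γ x z 0 = p from (hstart _).1]; exact hpp, ?_⟩
    rw [hY, hW]
    refine ⟨contDiffAt_const, contDiffAt_comp_symm hφ hz, ?_, (hφnull _).1, fun X => by simp,
      fun X hX => ?_⟩
    · refine Filter.Eventually.of_forall fun w => ?_
      rw [g.coord_self]
      exact (hφnull _).2
    · rw [hcov, fderiv_comp_symm hφ hz] at hX
      have h1 := hφinj _ (hX.trans (map_zero _).symm)
      exact (fderiv_transition_bijective hz (mem_extChartAt_source _)).1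
        (h1.trans (map_zero _).symm)
  have hone : ∀ x, IsConicalAt g (γ x) (ι x) (extChartAt 𝓘(ℝ, F) x x) 1 := by
    intro x
    have h0 : γ x (extChartAt 𝓘(ℝ, F) x x) 0 = p := (hstart _).1
    have h1 : γ x (extChartAt 𝓘(ℝ, F) x x) 1 = ι x := by
      simp only [γ, extChartAt_to_inv]
      exact hend x
    have := (hfam x (extChartAt 𝓘(ℝ, F) x x)).isConicalAt hK (t := 0) (t' := 1) (by simp) (by simp)
      (by rw [h0]; exact hzero x)
    rwa [h1] at this
  have hrep : ∀ x c, (fun z => extChartAt 𝓘(ℝ, E) c (γ x z 1)) = localRep F E x c ι := fun x c =>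
    funext fun z => congrArg _ (hend _)
  -- Smoothness of `ι` is not assumed in the light cone condition; it comes from the conical
  -- condition at time `1`.
  have hsmooth : ContMDiff 𝓘(ℝ, F) 𝓘(ℝ, E) ∞ ι := by
    intro x
    refine contMDiffAt_iff.2 ⟨?_, ?_⟩
    · refine continuousAt_of_symm (F := F) ?_
      have := (hone x).continuousAt
      rwa [show (fun z => γ x z 1) = fun z => ι ((extChartAt 𝓘(ℝ, F) x).symm z) from
        funext fun z => hend _] at this
    · have := (hone x).self_of_nhds.2.contDiffAt_fst
      rw [hrep] at this
      exact this.contDiffWithinAt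
  have hmd : ∀ x, MDifferentiableAt 𝓘(ℝ, F) 𝓘(ℝ, E) ι x := fun x =>
    hsmooth.mdifferentiableAt (by simp)
  have hcone : ∀ x, ∀ᶠ z in nhds (extChartAt 𝓘(ℝ, F) x x),
      localRep F E x (ι x) ι z ∈ (extChartAt 𝓘(ℝ, E) (ι x)).target ∧
      IsConical (g.coord (ι x)) (localRep F E x (ι x) ι)
        (fun z => deriv (extChartAt 𝓘(ℝ, E) (ι x) ∘ γ x z) 1) z 1 := by
    intro x
    filter_upwards [hone x] with z hz
    rw [hrep] at hz
    refine ⟨?_, hz.2⟩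
    rw [← hrep]
    exact (extChartAt 𝓘(ℝ, E) (ι x)).map_source hz.1
  refine ⟨⟨hsmooth, fun x => ?_⟩, fun x N hN => ?_⟩
  · obtain ⟨hs, hc⟩ := (hcone x).self_of_nhds
    have hG := g.isMetricOn_coord (ι x)
    refine ⟨?_, ?_⟩
    · have := hc.fderiv_injective
      rw [← mfderiv_eq_fderiv_localRep (hmd x)] at this
      exact this
    · obtain ⟨m, hm, hmW⟩ := hc.exists_fderiv_eq hG (g.isLorentzForm_coord hs) hdim hs
      refine ⟨m, hm, fun X => ?_⟩
      refine (firstForm_eq g (hmd x) m X).trans ?_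
      rw [hmW, hG.symm _ hs]
      exact hc.orthogonal hG hs X
  · obtain ⟨hs, hc⟩ := (hcone x).self_of_nhds
    obtain ⟨l, hl, hlXY⟩ := IsConical.umbilical (g.isMetricOn_coord (ι x))
      (g.isLorentzForm_coord hs) hdim (hcone x) hN.1
      (fun X => (firstForm_eq g (hmd x) N X).symm.trans (hN.2 X))
    refine ⟨l, hl, fun X Y => ?_⟩
    exact ((secondForm_eq g (hmd x) N X Y).trans (hlXY X Y)).trans
      (congrArg (l * ·) (firstForm_eq g (hmd x) X Y).symm)

end LightCone

/-! ### Part (b): the vertex of a totally umbilical lightlike hypersurface. -/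

section Vertex

variable {E : Type*} [NormedAddCommGroup E] [NormedSpace ℝ E]
  {M : Type*} [TopologicalSpace M] [ChartedSpace E M]
  {F : Type*} [NormedAddCommGroup F] [NormedSpace ℝ F]
  {V : Type*} [TopologicalSpace V] [ChartedSpace F V]
  {g : LorentzianMetric E M} {K : ℝ} {ι : V → M}

theorem IsNormal.congr {G : E → E →L[ℝ] E →L[ℝ] ℝ} {u u' : F → E} {s N : F} (h : IsNormal G u s N)
    (hu : u' =ᶠ[nhds s] u) : IsNormal G u' s N := by
  have h1 : covHessian G u' s = covHessian G u s := by
    funext X Y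
    rw [covHessian, covHessian, hu.fderiv.fderiv_eq, hu.fderiv_eq, hu.self_of_nhds]
  refine ⟨h.ne_zero, fun X => ?_, fun X Y => ?_⟩
  · rw [hu.self_of_nhds, hu.fderiv_eq, h.radical]
  · rw [h1, hu.self_of_nhds, hu.fderiv_eq, h.second]

theorem LorentzianMetric.IsGeodesicOn.comp_sub_const {β : ℝ → M}
    (h : g.IsGeodesicOn β univ) (a : ℝ) : g.IsGeodesicOn (fun t => β (t - a)) univ := by
  refine ⟨?_, fun t _ c hc => ?_⟩
  · rw [contMDiffOn_univ] at *
    have h1 : ContMDiff 𝓘(ℝ, ℝ) 𝓘(ℝ, ℝ) ∞ (fun t : ℝ => t - a) :=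
      (contDiff_id.sub contDiff_const).contMDiff
    exact (contMDiffOn_univ.1 h.1).comp h1
  · have h1 : deriv (extChartAt 𝓘(ℝ, E) c ∘ fun t => β (t - a))
        = fun t => deriv (extChartAt 𝓘(ℝ, E) c ∘ β) (t - a) :=
      funext fun t => deriv_comp_sub_const (f := extChartAt 𝓘(ℝ, E) c ∘ β) a t
    rw [h1, deriv_comp_sub_const]
    exact h.2 (t - a) trivial c hc

theorem LorentzianMetric.IsGeodesicOn.mono {γ : ℝ → M} {I J : Set ℝ} (h : g.IsGeodesicOn γ I)
    (hJ : J ⊆ I) : g.IsGeodesicOn γ J :=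
  ⟨h.1.mono hJ, fun t ht => h.2 t (hJ ht)⟩

theorem localRep_self_mem_target (x : V) :
    localRep F E x (ι x) ι (extChartAt 𝓘(ℝ, F) x x) ∈ (extChartAt 𝓘(ℝ, E) (ι x)).target := by
  rw [localRep, extChartAt_to_inv]
  exact mem_extChartAt_target (ι x)

theorem IsTotallyUmbilicalLightlike.fderiv_injective (h : IsTotallyUmbilicalLightlike F g ι)
    (x : V) : Function.Injective
      (fderiv ℝ (localRep F E x (ι x) ι) (extChartAt 𝓘(ℝ, F) x x)) := by
  rw [← mfderiv_eq_fderiv_localRep (h.1.1.mdifferentiableAt (by simp))]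
  exact (h.1.2 x).1

/-- A family of curves that is conical at time `0` issues locally from one point. -/
theorem IsConicalAt.eventually_eq {γ : F → ℝ → M} {c : M} {s : F} (h : IsConicalAt g γ c s 0) :
    ∀ᶠ z in nhds s, γ z 0 = γ s 0 := by
  obtain ⟨r, hr, hball⟩ := Metric.eventually_nhds_iff_ball.1 h
  filter_upwards [Metric.ball_mem_nhds s hr] with z hz
  have hs := Metric.mem_ball_self (x := s) hr
  refine (extChartAt 𝓘(ℝ, E) c).injOn (hball z hz).1 (hball s hs).1 ?_
  -- At time `0` the focal condition says that the derivative of the position is `0 • ∇_X Q`.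
  refine Metric.isOpen_ball.is_const_of_fderiv_eq_zero (𝕜 := ℝ) (convex_ball s r).isPreconnected
    (f := fun z => extChartAt 𝓘(ℝ, E) c (γ z 0)) (fun w hw => ?_) (fun w hw => ?_) hz hs
  · exact ((hball w hw).2.contDiffAt_fst.differentiableAt (by simp)).differentiableWithinAt
  · ext X
    exact ((hball w hw).2.focal X).trans (zero_smul _ _)

variable [IsManifold 𝓘(ℝ, E) ∞ M]

/-- A totally umbilical lightlike hypersurface has a normalized normal vector at each point. -/
theorem IsTotallyUmbilicalLightlike.exists_isNormal (h : IsTotallyUmbilicalLightlike F g ι)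
    (x : V) : ∃ N,
      IsNormal (g.coord (ι x)) (localRep F E x (ι x) ι) (extChartAt 𝓘(ℝ, F) x x) N := by
  have hmd : MDifferentiableAt 𝓘(ℝ, F) 𝓘(ℝ, E) ι x := h.1.1.mdifferentiableAt (by simp)
  obtain ⟨-, N, hN⟩ := h.1.2 x
  obtain ⟨l, hl, hsec⟩ := h.2 x N hN
  let N' : F := N
  -- Scaling the normal by `l⁻¹` turns the factor `l` into `1`.
  refine ⟨l⁻¹ • N', fun h0 => hN.1 ((smul_eq_zero_iff_right (inv_ne_zero hl)).1 h0),
    fun X => ?_, fun X Y => ?_⟩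
  · have h1 := (firstForm_eq g hmd N X).symm.trans (hN.2 X)
    rw [map_smul, map_smul, smul_apply]
    exact (congrArg (l⁻¹ • ·) h1).trans (smul_zero _)
  · have h1 := ((secondForm_eq g hmd N X Y).symm.trans (hsec X Y)).trans
      (congrArg (l * ·) (firstForm_eq g hmd X Y))
    rw [map_smul, map_smul, smul_eq_mul, ← mul_neg]
    refine (congrArg (l⁻¹ * ·) h1).trans ?_
    rw [← mul_assoc, inv_mul_cancel₀ hl, one_mul]

variable [IsManifold 𝓘(ℝ, F) ∞ V]

/-- Change of charts for the derivative of a local expression. -/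
theorem fderiv_localRep (hι : ContMDiff 𝓘(ℝ, F) 𝓘(ℝ, E) ∞ ι) {x₀ x : V} {c : M} {z : F}
    (hz : z ∈ (extChartAt 𝓘(ℝ, F) x₀).target) (hx : (extChartAt 𝓘(ℝ, F) x₀).symm z = x)
    (hc : ι x ∈ (extChartAt 𝓘(ℝ, E) c).source) (X : F) :
    fderiv ℝ (localRep F E x₀ c ι) z X
      = fderiv ℝ (transition E (ι x) c) (extChartAt 𝓘(ℝ, E) (ι x) (ι x))
        (fderiv ℝ (localRep F E x (ι x) ι) (extChartAt 𝓘(ℝ, F) x x)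
          (fderiv ℝ (transition F x₀ x) z X)) := by
  subst hx
  set x := (extChartAt 𝓘(ℝ, F) x₀).symm z with hx
  have hθ : ContDiffAt ℝ ∞ (transition F x₀ x) z :=
    contDiffAt_transition hz (mem_extChartAt_source _)
  have hθz : transition F x₀ x z = extChartAt 𝓘(ℝ, F) x x := rfl
  have hu : ContDiffAt ℝ ∞ (localRep F E x (ι x) ι) (transition F x₀ x z) :=
    contDiffAt_localRep hι (mem_extChartAt_target x)
      (by rw [hθz, extChartAt_to_inv]; exact mem_extChartAt_source _)
  have huz : localRep F E x (ι x) ι (transition F x₀ x z) = extChartAt 𝓘(ℝ, E) (ι x) (ι x) := by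
    rw [hθz, localRep, extChartAt_to_inv]
  have hψ : ContDiffAt ℝ ∞ (transition E (ι x) c)
      (localRep F E x (ι x) ι (transition F x₀ x z)) := by
    rw [huz]
    exact contDiffAt_transition (mem_extChartAt_target _) (by rwa [extChartAt_to_inv])
  have h1 := localRep_eventuallyEq (c := ι x) (c' := c) hι.continuous hz
    (mem_extChartAt_source (I := 𝓘(ℝ, F)) x) (mem_extChartAt_source (I := 𝓘(ℝ, E)) (ι x))
  have h2 : HasFDerivAt
      (fun w => transition E (ι x) c (localRep F E x (ι x) ι (transition F x₀ x w))) _ z :=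
    HasFDerivAt.comp (g := transition E (ι x) c) z hψ.hasFDerivAt_fderiv'
      (HasFDerivAt.comp (g := localRep F E x (ι x) ι) z hu.hasFDerivAt_fderiv'
        hθ.hasFDerivAt_fderiv')
  rw [h1.fderiv_eq, h2.fderiv, huz, hθz]
  rfl

/-- Change of charts for normal vectors. -/
theorem IsNormal.change_chart [FiniteDimensional ℝ E] (hι : ContMDiff 𝓘(ℝ, F) 𝓘(ℝ, E) ∞ ι)
    {x₀ x : V} {c : M} {z : F}
    (hz : z ∈ (extChartAt 𝓘(ℝ, F) x₀).target) (hx : (extChartAt 𝓘(ℝ, F) x₀).symm z = x)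
    (hc : ι x ∈ (extChartAt 𝓘(ℝ, E) c).source) {N : F}
    (h : IsNormal (g.coord (ι x)) (localRep F E x (ι x) ι) (extChartAt 𝓘(ℝ, F) x x)
      (fderiv ℝ (transition F x₀ x) z N)) :
    IsNormal (g.coord c) (localRep F E x₀ c ι) z N := by
  subst hx
  set x := (extChartAt 𝓘(ℝ, F) x₀).symm z with hx
  have hθ : ContDiffAt ℝ ∞ (transition F x₀ x) z :=
    contDiffAt_transition hz (mem_extChartAt_source _)
  have hθz : transition F x₀ x z = extChartAt 𝓘(ℝ, F) x x := rfl
  have hu : ContDiffAt ℝ ∞ (localRep F E x (ι x) ι) (transition F x₀ x z) :=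
    contDiffAt_localRep hι (mem_extChartAt_target x)
      (by rw [hθz, extChartAt_to_inv]; exact mem_extChartAt_source _)
  have huz : localRep F E x (ι x) ι (transition F x₀ x z) = extChartAt 𝓘(ℝ, E) (ι x) (ι x) := by
    rw [hθz, localRep, extChartAt_to_inv]
  have hmem : localRep F E x (ι x) ι (transition F x₀ x z)
      ∈ (extChartAt 𝓘(ℝ, E) (ι x)).target := localRep_self_mem_target x
  have hsrc : (extChartAt 𝓘(ℝ, E) (ι x)).symm (localRep F E x (ι x) ι (transition F x₀ x z))
      ∈ (extChartAt 𝓘(ℝ, E) c).source := by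
    rwa [huz, extChartAt_to_inv]
  refine ((h.comp_right (g.isMetricOn_coord _) hmem hu hθ).comp_isometry
    (g.isIsometryAt_transition hmem hsrc) (g.isMetricOn_coord _) (g.isMetricOn_coord c) hmem
    (transition_mem_target hsrc) (hu.comp z hθ)).congr ?_
  exact localRep_eventuallyEq (c := ι x) (c' := c) hι.continuous hz
    (mem_extChartAt_source (I := 𝓘(ℝ, F)) x) (mem_extChartAt_source (I := 𝓘(ℝ, E)) (ι x))

/-- The geodesics issuing from a totally umbilical lightlike hypersurface in the direction of the
normalized normal vectors satisfy the conical condition. -/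
theorem IsTotallyUmbilicalLightlike.isConicalAt [FiniteDimensional ℝ E] [FiniteDimensional ℝ F]
    (h : IsTotallyUmbilicalLightlike F g ι) (hF : 3 ≤ finrank ℝ F)
    (hdim : finrank ℝ F + 1 = finrank ℝ E) (hK : g.HasConstantCurvature K) {N : V → F}
    (hN : ∀ x, IsNormal (g.coord (ι x)) (localRep F E x (ι x) ι) (extChartAt 𝓘(ℝ, F) x x) (N x))
    {β : V → ℝ → M} (hβ : ∀ x, g.IsGeodesicOn (β x) univ)
    (hβ0 : ∀ x, LorentzianMetric.StartsWith (E := E) (β x) (ι x)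
      (fderiv ℝ (localRep F E x (ι x) ι) (extChartAt 𝓘(ℝ, F) x x) (N x))) (x₀ : V) :
    IsConicalAt g (fun z t => β ((extChartAt 𝓘(ℝ, F) x₀).symm z) (t - 1)) (ι x₀)
      (extChartAt 𝓘(ℝ, F) x₀ x₀) 1 := by
  have hι := h.1.1
  have hG := g.isMetricOn_coord (ι x₀)
  set u := localRep F E x₀ (ι x₀) ι with hu
  have hnear : ∀ᶠ z in nhds (extChartAt 𝓘(ℝ, F) x₀ x₀), z ∈ (extChartAt 𝓘(ℝ, F) x₀).target ∧
      ι ((extChartAt 𝓘(ℝ, F) x₀).symm z) ∈ (extChartAt 𝓘(ℝ, E) (ι x₀)).source := by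
    have h1 : ∀ᶠ v in nhds ((extChartAt 𝓘(ℝ, F) x₀).symm (extChartAt 𝓘(ℝ, F) x₀ x₀)),
        ι v ∈ (extChartAt 𝓘(ℝ, E) (ι x₀)).source := by
      rw [extChartAt_to_inv]
      exact hι.continuous.continuousAt.eventually (extChartAt_source_mem_nhds _)
    exact Filter.Eventually.and (extChartAt_target_mem_nhds x₀)
      (eventually_symm (mem_extChartAt_target x₀) h1)
  have hnormal : ∀ᶠ z in nhds (extChartAt 𝓘(ℝ, F) x₀ x₀),
      u z ∈ (extChartAt 𝓘(ℝ, E) (ι x₀)).target ∧ ContDiffAt ℝ ∞ u z ∧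
      Function.Injective (fderiv ℝ u z) ∧ ∃ m, IsNormal (g.coord (ι x₀)) u z m ∧
        fderiv ℝ u z m = deriv (extChartAt 𝓘(ℝ, E) (ι x₀) ∘
          fun t => β ((extChartAt 𝓘(ℝ, F) x₀).symm z) (t - 1)) 1 := by
    filter_upwards [hnear] with z ⟨hz, hzs⟩
    set x := (extChartAt 𝓘(ℝ, F) x₀).symm z with hx
    have hbij := fderiv_transition_bijective hz (mem_extChartAt_source (I := 𝓘(ℝ, F)) x)
    have hψ := fderiv_transition_bijective (c := ι x) (c' := ι x₀)
      (mem_extChartAt_target (I := 𝓘(ℝ, E)) (ι x)) (by rwa [extChartAt_to_inv])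
    refine ⟨(extChartAt 𝓘(ℝ, E) (ι x₀)).map_source hzs, contDiffAt_localRep hι hz hzs, ?_, ?_⟩
    · intro X Y hXY
      rw [hu, fderiv_localRep hι hz hx.symm hzs, fderiv_localRep hι hz hx.symm hzs] at hXY
      exact hbij.1 (h.fderiv_injective x (hψ.1 hXY))
    · obtain ⟨m, hm⟩ := hbij.2 (N x)
      refine ⟨m, IsNormal.change_chart hι hz hx.symm hzs (by rw [hm]; exact hN x), ?_⟩
      have hβx : β x 0 = ι x := (hβ0 x).1
      have h1 := (hβ x).deriv_chart_change isOpen_univ (t := 0) (c := ι x) (c' := ι x₀) trivial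
        (by rw [hβx]; exact mem_extChartAt_source _) (by rwa [hβx])
      have h2 : deriv (extChartAt 𝓘(ℝ, E) (ι x) ∘ β x) 0 = _ := (hβ0 x).2.deriv
      have h3 : deriv (extChartAt 𝓘(ℝ, E) (ι x₀) ∘ fun t => β x (t - 1)) 1
          = deriv (extChartAt 𝓘(ℝ, E) (ι x₀) ∘ β x) 0 := by
        have := deriv_comp_sub_const (f := extChartAt 𝓘(ℝ, E) (ι x₀) ∘ β x) 1 1
        rwa [sub_self] at this
      rw [h3, h1, h2, hβx, hu, fderiv_localRep hι hz hx.symm hzs, hm]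
  -- `N` was chosen point by point, so its smoothness is unknown. By uniqueness of normalized
  -- normals it agrees with the smooth field `m`, hence the velocities of the geodesics depend
  -- smoothly on `z`.
  obtain ⟨m, hm⟩ := exists_contDiffAt_isNormal hF hG (fun y hy => g.isLorentzForm_coord hy)
    (hnormal.mono fun z hz => ⟨hz.1, hz.2.1, hz.2.2.1, hz.2.2.2.imp fun _ h => h.1⟩)
  have hY : (fun z => extChartAt 𝓘(ℝ, E) (ι x₀)
      (β ((extChartAt 𝓘(ℝ, F) x₀).symm z) (1 - 1))) = u := funext fun z => by
    rw [sub_self, (hβ0 _).1, hu, localRep]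
  have hW : ∀ᶠ z in nhds (extChartAt 𝓘(ℝ, F) x₀ x₀), deriv (extChartAt 𝓘(ℝ, E) (ι x₀) ∘
      fun t => β ((extChartAt 𝓘(ℝ, F) x₀).symm z) (t - 1)) 1 = fderiv ℝ u z (m z) := by
    filter_upwards [hnormal, hm] with z ⟨hzU, _, hzi, m', hm', hmd⟩ hmz
    rw [← hmd, IsNormal.eq hF (g.isLorentzForm_coord hzU) hzi hmz.2 hm']
  filter_upwards [hnear, (hnormal.and hm).eventually_nhds, hW.eventually_nhds] with z hz hz' hWz
  refine ⟨?_, ?_⟩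
  · rw [sub_self, (hβ0 _).1]
    exact hz.2
  · rw [hY]
    refine (isConical_of_isNormal hF hdim hG (fun y hy => g.isLorentzForm_coord hy)
      (fun y hy => g.curvatureMap_eq hK hy) (m := m) ?_).congr
        (Filter.EventuallyEq.refl _ _) hWz
    exact hz'.mono fun w hw => ⟨hw.1.1, hw.1.2.1, hw.1.2.2.1, hw.2⟩

/-- In constant curvature and under null completeness, every totally umbilical lightlike
hypersurface is an open part of a light cone. -/
theorem IsTotallyUmbilicalLightlike.exists_isLightConeAt [FiniteDimensional ℝ E]
    [FiniteDimensional ℝ F] [T2Space M] [ConnectedSpace V]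
    (h : IsTotallyUmbilicalLightlike F g ι) (hF : 3 ≤ finrank ℝ F)
    (hdim : finrank ℝ F + 1 = finrank ℝ E) (hK : g.HasConstantCurvature K)
    (hcomplete : g.IsNullComplete) : ∃ p : M, IsLightConeAt F g p ι := by
  choose N hN using h.exists_isNormal
  have hnull : ∀ x, g.form (ι x)
      (fderiv ℝ (localRep F E x (ι x) ι) (extChartAt 𝓘(ℝ, F) x x) (N x))
      (fderiv ℝ (localRep F E x (ι x) ι) (extChartAt 𝓘(ℝ, F) x x) (N x)) = 0 := by
    intro x
    have h1 := (hN x).radical (N x)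
    rw [show localRep F E x (ι x) ι (extChartAt 𝓘(ℝ, F) x x) = extChartAt 𝓘(ℝ, E) (ι x) (ι x) by
      rw [localRep, extChartAt_to_inv], g.coord_self] at h1
    exact h1
  choose β hβ hβ0 using fun x => hcomplete (ι x) _ (hnull x)
  -- The shift puts the hypersurface at time `1` and the prospective vertex at time `0`.
  let γ : V → F → ℝ → M := fun x z t => β ((extChartAt 𝓘(ℝ, F) x).symm z) (t - 1)
  have hgeo : ∀ x, g.IsGeodesicOn (fun t => β x (t - 1)) univ := fun x =>
    (hβ x).comp_sub_const 1
  have hfam : ∀ x s, IsGeodesicFamily g (γ x) s := fun x s =>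
    Filter.Eventually.of_forall fun z => ⟨1, one_pos, (hgeo _).mono (subset_univ _)⟩
  have hγs : ∀ x t, γ x (extChartAt 𝓘(ℝ, F) x x) t = β x (t - 1) := fun x t => by
    simp only [γ, extChartAt_to_inv]
  have hzero : ∀ x, IsConicalAt g (γ x) (β x (0 - 1)) (extChartAt 𝓘(ℝ, F) x x) 0 := by
    intro x
    rw [← hγs x 0]
    refine (hfam x (extChartAt 𝓘(ℝ, F) x x)).isConicalAt hK (t := 1) (t' := 0)
      (by simp) (by simp) ?_
    rw [hγs x 1, sub_self, (hβ0 x).1]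
    exact h.isConicalAt hF hdim hK hN hβ hβ0 x
  -- Each conical family issues locally from one point, and connectedness of `V` gives a single
  -- vertex.
  have hconst : IsLocallyConstant (fun x => β x (0 - 1)) := by
    refine (IsLocallyConstant.iff_eventually_eq _).2 fun x => ?_
    refine eventually_of_symm (F := F) ?_
    filter_upwards [(hzero x).eventually_eq] with z hz
    rwa [hγs x 0] at hz
  obtain ⟨x₁⟩ := (inferInstance : Nonempty V)
  refine ⟨β x₁ (0 - 1), ?_⟩
  set p := β x₁ (0 - 1) with hp
  have hpx : ∀ x, β x (0 - 1) = p := fun x => hconst.apply_eq_of_preconnectedSpace x x₁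
  simp only [hpx] at hzero
  -- The initial velocities all lie in the one tangent space at `p`. The conical condition at time
  -- `0` shows that they are smooth, immersive, null and nonzero.
  let φ : V → E := fun x => deriv (extChartAt 𝓘(ℝ, E) p ∘ fun t => β x (t - 1)) 0
  have hself : ∀ x, IsConical (g.coord p) (fun _ => extChartAt 𝓘(ℝ, E) p p)
      (fun z => φ ((extChartAt 𝓘(ℝ, F) x).symm z)) (extChartAt 𝓘(ℝ, F) x x) 0 := by
    intro x
    have h1 := (hzero x).self_of_nhds.2
    rwa [show (fun z => extChartAt 𝓘(ℝ, E) p (γ x z 0)) = fun _ => extChartAt 𝓘(ℝ, E) p p from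
      funext fun z => congrArg _ (hpx _)] at h1
  have hφ : ContMDiff 𝓘(ℝ, F) 𝓘(ℝ, E) ∞ φ := by
    intro x
    refine contMDiffAt_iff.2 ⟨?_, ?_⟩
    · exact continuousAt_of_symm (F := F) (hself x).contDiffAt_snd.continuousAt
    · exact (hself x).contDiffAt_snd.contDiffWithinAt
  refine ⟨φ, hφ, fun x => ?_, fun x => ?_, fun x => ?_⟩
  · have h1 : (mfderiv 𝓘(ℝ, F) 𝓘(ℝ, E) φ x : F →L[ℝ] E)
        = fderiv ℝ (fun z => φ ((extChartAt 𝓘(ℝ, F) x).symm z)) (extChartAt 𝓘(ℝ, F) x x) :=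
      mfderiv_eq_fderiv_localRep (hφ.mdifferentiableAt (by simp))
    have h2 : Function.Injective
        (fderiv ℝ (fun z => φ ((extChartAt 𝓘(ℝ, F) x).symm z)) (extChartAt 𝓘(ℝ, F) x x)) := by
      rw [injective_iff_map_eq_zero]
      intro X hX
      refine (hself x).injective X ?_
      rw [covDeriv, hX]
      simp only [fderiv_fun_const, Pi.zero_apply, zero_apply, map_zero, add_zero]
    rw [← h1] at h2
    exact h2
  · have h1 := (hself x).ne_zero
    have h2 := (hself x).null.self_of_nhds
    rw [extChartAt_to_inv, g.coord_self] at h2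
    rw [extChartAt_to_inv] at h1
    exact ⟨h1, h2⟩
  · refine ⟨fun t => β x (t - 1), 1, one_pos, (hgeo x).mono (subset_univ _), ⟨hpx x, ?_⟩, ?_⟩
    · refine (hgeo x).hasDerivAt_chart isOpen_univ (t := 0) trivial ?_
      rw [hpx x]
      exact mem_extChartAt_source p
    · simp only [sub_self]
      exact (hβ0 x).1

end Vertex

end Lorentz

end

theorem theorem13
    {E : Type*} [NormedAddCommGroup E] [NormedSpace ℝ E] [FiniteDimensional ℝ E]
    {M : Type*} [TopologicalSpace M] [T2Space M] [ChartedSpace E M] [IsManifold 𝓘(ℝ, E) ∞ M]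
    {F : Type*} [NormedAddCommGroup F] [NormedSpace ℝ F] [FiniteDimensional ℝ F]
    {V : Type*} [TopologicalSpace V] [T2Space V] [ConnectedSpace V] [ChartedSpace F V]
    [IsManifold 𝓘(ℝ, F) ∞ V]
    (hn : 4 ≤ Module.finrank ℝ E) (hV : Module.finrank ℝ F + 1 = Module.finrank ℝ E)
    (g : Lorentz.LorentzianMetric E M) (K : ℝ) (hK : g.HasConstantCurvature K)
    (ι : V → M) :
    ((∃ p : M, Lorentz.IsLightConeAt F g p ι) → Lorentz.IsTotallyUmbilicalLightlike F g ι) ∧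
    (g.IsNullComplete → Lorentz.IsTotallyUmbilicalLightlike F g ι →
      ∃ p : M, Lorentz.IsLightConeAt F g p ι) := by
  have hF : 3 ≤ finrank ℝ F := by omega
  exact ⟨fun ⟨_, hp⟩ => Lorentz.isTotallyUmbilicalLightlike_of_isLightConeAt hV hK hp,
    fun hc h => h.exists_isLightConeAt hF hV hK hc⟩
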